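/- Let $r\ge 1$, $n\ge 0$, $\Omega=\{x\in\mathbb R^r: x_1\ge 0\}$, $\Gamma=\{x_1=0\}$, $D_j=\partial/\partial x_j$. Let $A_1=A_1^*>0$, $B_j=B_j^*>0$ $(2\le j\le r)$ and $C_0,C_2,\dots,C_r$ be constant complex $n\times n$ matrices. Consider smooth (up to $t=0$ and up to $\Gamma$) $\mathbb C^n$-valued functions $u(x,t)$ with $u(\cdot,t)\in L^2(\Omega)$ for every $t\ge 0$ that solve $$u_{tt}=A_1D_1^2u+\sum_{j=2}^rB_jD_j^2u+F\ \ (x\in\Omega,\ t\ge0),\qquad u=u_t=0\ \ (t=0),$$ $$C_0u_t+D_1u+\sum_{j=2}^rC_jD_ju=g\ \ (x\in\Gamma,\ t\ge 0),$$ where $F$ and $g$ are smooth and, for every $t\ge0$, $F(\cdot,t)$ and $g(\cdot,t)$ have compact support in $\Omega$ and in $\Gamma$, respectively. Write $\|\cdot\|_{H^0}$ for the $L^2$ norm, and $\|\cdot\|^2_{H^1}$ for the sum of the squared $L^2$ norms of a function and of its first-order derivatives with respect to the spatial variables (on $\Gamma$: $x_2,\dots,x_r$). All constants below are independent of $g$,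 $F$ and $u$. Definitions. (a) The problem is *Strongly Boundary Stable* if there are $\eta_0\ge0$, $K>0$ such that for $F=0$ and all $\eta\ge\eta_0$, $T\ge0$, $$\int_0^Te^{-2\eta t}\bigl(\|u(\cdot,t)\|^2_{H^1(\Gamma)}+\|u_t(\cdot,t)\|^2_{H^0(\Gamma)}\bigr)dt\le K\int_0^Te^{-2\eta t}\|g(\cdot,t)\|^2_{H^0(\Gamma)}dt .$$ (b) For $\alpha>0$ it is *Boundary Stable with exponent $\alpha$* if there are $\eta_0>0$, $K>0$ such that for $F=0$ and all $\eta\ge\eta_0$, $T\ge0$, $$\int_0^Te^{-2\eta t}\|u(\cdot,t)\|^2_{H^0(\Gamma)}dt\le \frac K{\eta^\alpha}\int_0^Te^{-2\eta t}\|g(\cdot,t)\|^2_{H^0(\Gamma)}dt ,$$ and *Boundary Stable* if this holds for some $\alpha>0$. (c) It is *Strongly Stable* if there are $\eta_0>0$, $T>0$, $K>0$ such that for all $\eta\ge\eta_0$, $$\eta\int_0^T e^{-2\eta t}\bigl(\|u\|^2_{H^1(\Gamma)}+\|u_t\|^2_{H^0(\Gamma)}\bigr)dt+\eta^2\int_0^T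 e^{-2\eta t}\bigl(\|u\|^2_{H^1(\Omega)}+\|u_t\|^2_{H^0(\Omega)}\bigr)dt\le K\Bigl[\eta\int_0^T e^{-2\eta t}\|g\|^2_{H^0(\Gamma)}dt+\int_0^T e^{-2\eta t}\|F\|^2_{H^0(\Omega)}dt\Bigr].$$ (d) It is *Stable* if it is Boundary Stable and there are $\eta_0\ge0$, $K>0$, $\alpha>0$ such that for $g=0$ and all $\eta\ge\eta_0$ with $\eta>0$ and all $T\ge0$, $$\int_0^Te^{-2\eta t}\bigl(\|u\|^2_{H^1(\Omega)}+\|u_t\|^2_{H^0(\Omega)}+\|u\|^2_{H^0(\Gamma)}\bigr)dt\le\frac K{\eta^\alpha}\int_0^Te^{-2\eta t}\|F\|^2_{H^0(\Omega)}dt .$$ (e) It is *well posed* if it is Strongly Stable or Stable, and *ill-posed* otherwise. Theorem. (1) If the problem is Strongly Boundary Stable, then there are $\eta_0\ge0$, $K>0$ such that for $F=0$ and all $\eta\ge\eta_0$, $T\ge0$, $$\int_0^Te^{-2\eta t}\bigl(\|u(\cdot,t)\|^2_{H^1(\Omega)}+\|u_t(\cdot,t)\|^2_{H^0(\Omega)}\bigr)dt\le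 K\int_0^Te^{-2\eta t}\|g(\cdot,t)\|^2_{H^0(\Gamma)}dt .$$ (2) If the problem is Boundary Stable with exponent $\alpha>0$, then there are $\tilde\alpha\ge\alpha+1$, $\eta_0>0$, $K>0$ such that for $F=0$ and all $\eta\ge\eta_0$, $T\ge0$, $$\int_0^Te^{-2\eta t}\|u(\cdot,t)\|^2_{H^0(\Omega)}dt\le\frac K{\eta^{\tilde\alpha}}\int_0^Te^{-2\eta t}\|g(\cdot,t)\|^2_{H^0(\Gamma)}dt .$$ (3) If the problem is not Boundary Stable, then it is ill-posed; moreover, for no $\eta>0$ and $K>0$ does the estimate $$\int_0^Te^{-2\eta t}\|u(\cdot,t)\|^2_{H^0(\Gamma)}dt\le K\int_0^Te^{-2\eta t}\|g(\cdot,t)\|^2_{H^0(\Gamma)}dt$$ hold for all $T\ge0$ and all $g$, $u$ as above with $F=0$. -/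

import Mathlib

open MeasureTheory Set
open scoped ENNReal ContDiff Matrix ComplexOrder

noncomputable section

namespace HalfSpaceIBVP

/-- Tangential variable `x_- = (x_2, …, x_r)`, with `r = d + 1`. -/
abbrev Tan (d : ℕ) : Type := EuclideanSpace ℝ (Fin d)

/-- Space-time points `(t, x_1, x_-)`. -/
abbrev SpaceTime (d : ℕ) : Type := ℝ × ℝ × Tan d

/-- Values of the unknown: vectors with `n` complex components and the Euclidean norm. -/
abbrev Val (n : ℕ) : Type := EuclideanSpace ℂ (Fin n)

/-- The derivative of `u` in the space-time direction `v`. -/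
def dirD {d n : ℕ} (v : SpaceTime d) (u : SpaceTime d → Val n) : SpaceTime d → Val n :=
  fun p => fderiv ℝ u p v

/-- `∂/∂t` -/
def Dt {d n : ℕ} (u : SpaceTime d → Val n) : SpaceTime d → Val n :=
  dirD ((1 : ℝ), (0 : ℝ), (0 : Tan d)) u

/-- `∂/∂x_1`, the derivative normal to the boundary. -/
def Dnor {d n : ℕ} (u : SpaceTime d → Val n) : SpaceTime d → Val n :=
  dirD ((0 : ℝ), (1 : ℝ), (0 : Tan d)) u

/-- The tangential derivatives `∂/∂x_2, …, ∂/∂x_r`. -/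
def Dtan {d n : ℕ} (j : Fin d) (u : SpaceTime d → Val n) : SpaceTime d → Val n :=
  dirD ((0 : ℝ), (0 : ℝ), EuclideanSpace.single j (1 : ℝ)) u

/-- A matrix acting on vectors. -/
def act {n : ℕ} (M : Matrix (Fin n) (Fin n) ℂ) (v : Val n) : Val n :=
  Matrix.toEuclideanLin M v

/-- `‖w(·,t)‖²` in `L²(Ω)`, where `Ω = {x_1 ≥ 0}`. -/
def sqNormInt {d n : ℕ} (w : SpaceTime d → Val n) (t : ℝ) : ℝ≥0∞ :=
  ∫⁻ x in (Ici (0 : ℝ)) ×ˢ (univ : Set (Tan d)), ‖w (t, x)‖ₑ ^ 2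

/-- `‖w(·,t)‖²` in `L²(Γ)`, where `Γ = {x_1 = 0}`. -/
def sqNormBdry {d n : ℕ} (w : SpaceTime d → Val n) (t : ℝ) : ℝ≥0∞ :=
  ∫⁻ y : Tan d, ‖w (t, 0, y)‖ₑ ^ 2

/-- `‖g(·,t)‖²` in `L²(Γ)` for a function that is given on the boundary only. -/
def sqNormDatum {d n : ℕ} (g : ℝ × Tan d → Val n) (t : ℝ) : ℝ≥0∞ :=
  ∫⁻ y : Tan d, ‖g (t, y)‖ₑ ^ 2

/-- `‖w(·,t)‖²` in `H¹(Ω)`. -/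
def sqH1Int {d n : ℕ} (w : SpaceTime d → Val n) (t : ℝ) : ℝ≥0∞ :=
  sqNormInt w t + sqNormInt (Dnor w) t + ∑ j : Fin d, sqNormInt (Dtan j w) t

/-- `‖w(·,t)‖²` in `H¹(Γ)`. -/
def sqH1Bdry {d n : ℕ} (w : SpaceTime d → Val n) (t : ℝ) : ℝ≥0∞ :=
  sqNormBdry w t + ∑ j : Fin d, sqNormBdry (Dtan j w) t

/-- `∫_0^T e^{-2ηt} N(t) dt` -/
def wInt (η T : ℝ) (N : ℝ → ℝ≥0∞) : ℝ≥0∞ :=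
  ∫⁻ t in Icc (0 : ℝ) T, ENNReal.ofReal (Real.exp (-2 * η * t)) * N t

end HalfSpaceIBVP

open HalfSpaceIBVP

/-- The coefficients of `u_tt = A_1 D_1² u + ∑ B_j D_j² u + F` with the boundary operator
`L u = C_0 u_t + D_1 u + ∑ C_j D_j u` (the sums are over the tangential variables, and the
coefficient of `D_1 u` in `L u` is normalised to the identity).
`Matrix.PosDef` contains the Hermitian symmetry. -/
structure HalfSpaceProblem (d n : ℕ) where
  A : Matrix (Fin n) (Fin n) ℂ
  B : Fin d → Matrix (Fin n) (Fin n) ℂ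
  C₀ : Matrix (Fin n) (Fin n) ℂ
  C : Fin d → Matrix (Fin n) (Fin n) ℂ
  A_pos : A.PosDef
  B_pos : ∀ j, (B j).PosDef

namespace HalfSpaceProblem

/-- The differential operator `P_0(D)`. -/
def P₀ {d n : ℕ} (P : HalfSpaceProblem d n) (u : SpaceTime d → Val n) (p : SpaceTime d) : Val n :=
  act P.A (Dnor (Dnor u) p) + ∑ j : Fin d, act (P.B j) (Dtan j (Dtan j u) p)

/-- The boundary operator `L`. -/
def L {d n : ℕ} (P : HalfSpaceProblem d n) (u : SpaceTime d → Val n) (p : SpaceTime d) : Val n :=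
  act P.C₀ (Dt u p) + Dnor u p + ∑ j : Fin d, act (P.C j) (Dtan j u p)

/-- Boundary data: smooth, and with compact support in `Γ` for every `t ≥ 0`.
As everywhere below, a smooth function on a closed set is represented by a smooth function on
the whole space, whose values off the closed set are irrelevant. -/
def IsBoundaryDatum {d n : ℕ} (g : ℝ × Tan d → Val n) : Prop :=
  ContDiff ℝ (⊤ : ℕ∞) g ∧ ∀ t : ℝ, 0 ≤ t → HasCompactSupport fun y : Tan d => g (t, y)

/-- Forcing: smooth, and with bounded support in `Ω` for every `t ≥ 0`. -/
def IsForcing {d n : ℕ} (F : SpaceTime d → Val n) : Prop :=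
  ContDiff ℝ (⊤ : ℕ∞) F ∧
    ∀ t : ℝ, 0 ≤ t → ∃ R : ℝ, ∀ (x₁ : ℝ) (y : Tan d), 0 ≤ x₁ → R < ‖(x₁, y)‖ → F (t, x₁, y) = 0

/-- `u` is a smooth solution (up to `t = 0` and up to the boundary) with homogeneous initial data,
forcing `F` and boundary data `g`, that belongs to `L²(Ω)` for every fixed `t`. -/
structure IsSolution {d n : ℕ} (P : HalfSpaceProblem d n) (F : SpaceTime d → Val n)
    (g : ℝ × Tan d → Val n) (u : SpaceTime d → Val n) : Prop where
  smooth : ContDiff ℝ (⊤ : ℕ∞) u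
  sq_integrable : ∀ t : ℝ, 0 ≤ t → sqNormInt u t < ⊤
  equation : ∀ (t x₁ : ℝ) (y : Tan d), 0 ≤ t → 0 ≤ x₁ →
    Dt (Dt u) (t, x₁, y) = P.P₀ u (t, x₁, y) + F (t, x₁, y)
  initial : ∀ (x₁ : ℝ) (y : Tan d), 0 ≤ x₁ → u (0, x₁, y) = 0
  initial_velocity : ∀ (x₁ : ℝ) (y : Tan d), 0 ≤ x₁ → Dt u (0, x₁, y) = 0
  boundary : ∀ (t : ℝ) (y : Tan d), 0 ≤ t → P.L u (t, 0, y) = g (t, y)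

/-- Strongly Boundary Stable: the boundary estimate that gains one derivative. -/
def StronglyBoundaryStable {d n : ℕ} (P : HalfSpaceProblem d n) : Prop :=
  ∃ η₀ K : ℝ, 0 ≤ η₀ ∧ 0 < K ∧
    ∀ (g : ℝ × Tan d → Val n) (u : SpaceTime d → Val n),
      IsBoundaryDatum g → P.IsSolution 0 g u →
      ∀ η T : ℝ, η₀ ≤ η → 0 ≤ T →
        wInt η T (fun t => sqH1Bdry u t + sqNormBdry (Dt u) t) ≤
          ENNReal.ofReal K * wInt η T (sqNormDatum g)

/-- The boundary estimate with the power `α`. -/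
def BoundaryStableWith {d n : ℕ} (P : HalfSpaceProblem d n) (α : ℝ) : Prop :=
  ∃ η₀ K : ℝ, 0 < η₀ ∧ 0 < K ∧
    ∀ (g : ℝ × Tan d → Val n) (u : SpaceTime d → Val n),
      IsBoundaryDatum g → P.IsSolution 0 g u →
      ∀ η T : ℝ, η₀ ≤ η → 0 ≤ T →
        wInt η T (sqNormBdry u) ≤ ENNReal.ofReal (K / η ^ α) * wInt η T (sqNormDatum g)

/-- Boundary Stable. -/
def BoundaryStable {d n : ℕ} (P : HalfSpaceProblem d n) : Prop :=
  ∃ α : ℝ, 0 < α ∧ P.BoundaryStableWith α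

/-- The interior estimate that gains one derivative. -/
def StrongInteriorEstimate {d n : ℕ} (P : HalfSpaceProblem d n) : Prop :=
  ∃ η₀ K : ℝ, 0 ≤ η₀ ∧ 0 < K ∧
    ∀ (g : ℝ × Tan d → Val n) (u : SpaceTime d → Val n),
      IsBoundaryDatum g → P.IsSolution 0 g u →
      ∀ η T : ℝ, η₀ ≤ η → 0 ≤ T →
        wInt η T (fun t => sqH1Int u t + sqNormInt (Dt u) t) ≤
          ENNReal.ofReal K * wInt η T (sqNormDatum g)

/-- The interior estimate with the power `α`. -/
def InteriorEstimate {d n : ℕ} (P : HalfSpaceProblem d n) (α : ℝ) : Prop :=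
  ∃ η₀ K : ℝ, 0 < η₀ ∧ 0 < K ∧
    ∀ (g : ℝ × Tan d → Val n) (u : SpaceTime d → Val n),
      IsBoundaryDatum g → P.IsSolution 0 g u →
      ∀ η T : ℝ, η₀ ≤ η → 0 ≤ T →
        wInt η T (sqNormInt u) ≤ ENNReal.ofReal (K / η ^ α) * wInt η T (sqNormDatum g)

/-- Strongly Stable: an estimate on some time interval `[0,T]`, with forcing and boundary data. -/
def StronglyStable {d n : ℕ} (P : HalfSpaceProblem d n) : Prop :=
  ∃ η₀ T K : ℝ, 0 < η₀ ∧ 0 < T ∧ 0 < K ∧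
    ∀ (F : SpaceTime d → Val n) (g : ℝ × Tan d → Val n) (u : SpaceTime d → Val n),
      IsForcing F → IsBoundaryDatum g → P.IsSolution F g u →
      ∀ η : ℝ, η₀ ≤ η →
        ENNReal.ofReal η * wInt η T (fun t => sqH1Bdry u t + sqNormBdry (Dt u) t) +
            ENNReal.ofReal (η ^ 2) * wInt η T (fun t => sqH1Int u t + sqNormInt (Dt u) t) ≤
          ENNReal.ofReal K *
            (ENNReal.ofReal η * wInt η T (sqNormDatum g) + wInt η T (sqNormInt F))

/-- Stable: Boundary Stable, with an estimate by the forcing when the boundary data vanish.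
(For `η = 0` the factor `K / η ^ α` is infinite, so only `η > 0` matters.) -/
def Stable {d n : ℕ} (P : HalfSpaceProblem d n) : Prop :=
  P.BoundaryStable ∧
  ∃ η₀ K α : ℝ, 0 ≤ η₀ ∧ 0 < K ∧ 0 < α ∧
    ∀ (F : SpaceTime d → Val n) (u : SpaceTime d → Val n),
      IsForcing F → P.IsSolution F 0 u →
      ∀ η T : ℝ, η₀ ≤ η → 0 < η → 0 ≤ T →
        wInt η T (fun t => sqH1Int u t + sqNormInt (Dt u) t + sqNormBdry u t) ≤
          ENNReal.ofReal (K / η ^ α) * wInt η T (sqNormInt F)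

/-- Well posed: Strongly Stable or Stable. -/
def WellPosed {d n : ℕ} (P : HalfSpaceProblem d n) : Prop :=
  P.StronglyStable ∨ P.Stable

/-- Ill-posed: not well posed. -/
def IllPosed {d n : ℕ} (P : HalfSpaceProblem d n) : Prop :=
  ¬ P.WellPosed

end HalfSpaceProblem

end

/-! Write R(u) = u_tt - P_0 u for the `residual`. Three mechanisms carry the theorem: an energy law
with boundary flux, a duality argument for the Dirichlet problem, and homogeneity under dilations.

(1) Multiplying the equation by u_t gives a conservation law. Its energy density is coercive because
A_1 and the B_j are positive, and its only flux through Γ is ⟨A_1 D_1 u, u_t⟩. The boundary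
condition expresses D_1 u by g, u_t and the tangential derivatives, so strong boundary stability
bounds this flux by g. To avoid any decay of the derivatives of u at infinity, the law is localised
(`local_energy`) by e^{-2ηt} times a cut-off that shrinks faster than signals propagate. The
cut-offs exhaust the cylinder, and Fatou's lemma yields `lintegral_energy_le_flux`. The norm of u
itself follows from that of u_t by a Hardy inequality in time.

(2) The boundary operator plays no role beyond the hypothesis: any solution with zero initial data
is controlled in Ω by its own trace, with a gain of 1/η (`dirichlet_estimate`). By duality this
comes down to bounding A_1 D_1 V on Γ by R(V), for V vanishing on Γ and near the final time;
`hidden_regularity` does so with the multiplier D_1 V. The backward Dirichlet problem never has to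
be solved: u is extended oddly across Γ to u° and tested against arbitrary V on the whole space.
Since P_0 commutes with x_1 ↦ -x_1, only the odd part of V counts, and this part vanishes on Γ.
Green's formula turns V ↦ ∫⟨u°, R(V)⟩ into a boundary functional bounded by the weighted L² norm of
R(V). Riesz representation gives an L² function x of the right norm, and `weak_unique`
(mollification and finite speed of propagation) identifies e^{ηt}x with u°.

(3) There are no lower-order terms, so u(rp) solves the problem with datum r g(rp). An estimate at
one η for all T therefore rescales to all η with a factor η^{-2}, which is boundary stability with
exponent 2. A strongly stable problem satisfies a boundary estimate on one interval for all large η;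
dilations convert it into an estimate at one η for all T, so the problem is boundary stable. Stable
problems are boundary stable by definition. -/

noncomputable section

/-! ### Coefficient matrices as real operators -/

namespace HalfSpaceIBVP

/-- A matrix as a continuous real-linear operator. -/
def actL {n : ℕ} (M : Matrix (Fin n) (Fin n) ℂ) : Val n →L[ℝ] Val n :=
  LinearMap.toContinuousLinearMap ((Matrix.toEuclideanLin M).restrictScalars ℝ)

lemma act_eq_actL {n : ℕ} (M : Matrix (Fin n) (Fin n) ℂ) (v : Val n) : act M v = actL M v := rfl

lemma real_inner_eq_re {n : ℕ} (x y : Val n) : inner ℝ x y = (inner ℂ x y).re := by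
  simp [PiLp.inner_apply, Complex.inner]

lemma actL_symm {n : ℕ} {M : Matrix (Fin n) (Fin n) ℂ} (hM : M.IsHermitian) (x y : Val n) :
    inner ℝ (actL M x) y = inner ℝ x (actL M y) := by
  rw [real_inner_eq_re, real_inner_eq_re]
  exact congrArg Complex.re (Matrix.isSymmetric_toEuclideanLin_iff.2 hM x y)

lemma actL_pos {n : ℕ} {M : Matrix (Fin n) (Fin n) ℂ} (hM : M.PosDef) {x : Val n} (hx : x ≠ 0) :
    0 < inner ℝ (actL M x) x := by
  rw [actL_symm hM.1, real_inner_eq_re]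
  have h := hM.re_dotProduct_pos (x := WithLp.ofLp x) (by simpa using hx)
  have : inner ℂ x (actL M x) = star (WithLp.ofLp x) ⬝ᵥ (M *ᵥ (WithLp.ofLp x)) := by
    rw [EuclideanSpace.inner_eq_star_dotProduct, dotProduct_comm]
    rfl
  rw [this]
  exact h

lemma exists_coercive {n : ℕ} {M : Matrix (Fin n) (Fin n) ℂ} (hM : M.PosDef) :
    ∃ c : ℝ, 0 < c ∧ ∀ x : Val n, c * ‖x‖ ^ 2 ≤ inner ℝ (actL M x) x := by
  -- The constant is the minimum of the quadratic form on the unit sphere, which is empty when n =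
  -- 0.
  rcases (Metric.sphere (0 : Val n) 1).eq_empty_or_nonempty with h | h
  · refine ⟨1, one_pos, fun x => ?_⟩
    by_cases hx : x = 0
    · simp [hx]
    · have : (‖x‖⁻¹ : ℝ) • x ∈ Metric.sphere (0 : Val n) 1 := by
        simp [norm_smul, hx]
      simp [h] at this
  · obtain ⟨z, hz, hmin⟩ := (isCompact_sphere (0 : Val n) 1).exists_isMinOn h
      (f := fun x => inner ℝ (actL M x) x) (by fun_prop)
    have hz0 : z ≠ 0 := by
      rintro rfl
      simp at hz
    refine ⟨_, actL_pos hM hz0, fun x => ?_⟩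
    by_cases hx : x = 0
    · simp [hx]
    · have hm : (‖x‖⁻¹ : ℝ) • x ∈ Metric.sphere (0 : Val n) 1 := by
        simp [norm_smul, hx]
      have h1 := isMinOn_iff.1 hmin _ hm
      simp only [map_smul, inner_smul_left, inner_smul_right, RCLike.conj_to_real] at h1
      have hn : 0 < ‖x‖ := norm_pos_iff.2 hx
      calc _ ≤ (‖x‖⁻¹ * (‖x‖⁻¹ * inner ℝ (actL M x) x)) * ‖x‖ ^ 2 := by gcongr
        _ = _ := by field_simp

/-! ### Directional derivatives of smooth functions -/

/-- The derivative of a scalar function in the direction `v`. -/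
def pd {d : ℕ} (v : SpaceTime d) (φ : SpaceTime d → ℝ) : SpaceTime d → ℝ :=
  fun p => fderiv ℝ φ p v

/-- The `t`-direction. -/
def dt {d : ℕ} : SpaceTime d := ((1 : ℝ), (0 : ℝ), (0 : Tan d))
/-- The normal direction. -/
def d1 {d : ℕ} : SpaceTime d := ((0 : ℝ), (1 : ℝ), (0 : Tan d))
/-- The tangential directions. -/
def dj {d : ℕ} (j : Fin d) : SpaceTime d := ((0 : ℝ), (0 : ℝ), EuclideanSpace.single j (1 : ℝ))

/-- Smooth. -/
abbrev Smooth {d : ℕ} {F : Type*} [NormedAddCommGroup F] [NormedSpace ℝ F]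
    (u : SpaceTime d → F) : Prop := ContDiff ℝ (⊤ : ℕ∞) u

section calculus
variable {d n : ℕ}

lemma Smooth.dirD {u : SpaceTime d → Val n} (hu : Smooth u) (v : SpaceTime d) :
    Smooth (dirD v u) :=
  (hu.fderiv_right (m := (⊤ : ℕ∞)) (by simp)).clm_apply contDiff_const

lemma Smooth.pd {u : SpaceTime d → ℝ} (hu : Smooth u) (v : SpaceTime d) :
    Smooth (pd v u) :=
  (hu.fderiv_right (m := (⊤ : ℕ∞)) (by simp)).clm_apply contDiff_const

lemma Smooth.diff {F : Type*} [NormedAddCommGroup F] [NormedSpace ℝ F] {u : SpaceTime d → F}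
    (hu : Smooth u) : Differentiable ℝ u := hu.differentiable (by simp)

lemma Smooth.actL {u : SpaceTime d → Val n} (hu : Smooth u) (M : Matrix (Fin n) (Fin n) ℂ) :
    Smooth (fun p => actL M (u p)) := (HalfSpaceIBVP.actL M).contDiff.comp hu

/-- Symmetry of the second derivative; it cancels the cross terms in the energy and momentum laws.
-/
lemma dirD_comm {u : SpaceTime d → Val n} (hu : Smooth u) (v w : SpaceTime d) (p : SpaceTime d) :
    dirD v (dirD w u) p = dirD w (dirD v u) p := by
  have hd : DifferentiableAt ℝ (fderiv ℝ u) p :=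
    ((hu.fderiv_right (m := (⊤ : ℕ∞)) (by simp)).differentiable (by simp)) p
  have key : ∀ v w : SpaceTime d, dirD v (dirD w u) p = fderiv ℝ (fderiv ℝ u) p v w := by
    intro v w
    have : HasFDerivAt (dirD w u) _ p := hd.hasFDerivAt.clm_apply (hasFDerivAt_const w p)
    unfold dirD at *
    rw [this.fderiv]
    simp
  rw [key, key]
  exact (hu.contDiffAt.isSymmSndFDerivAt
    (by simpa using WithTop.coe_le_coe.2 (le_top : (2 : ℕ∞) ≤ ⊤))) v w

lemma dirD_actL {u : SpaceTime d → Val n} (hu : Smooth u) (M : Matrix (Fin n) (Fin n) ℂ)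
    (v p : SpaceTime d) : dirD v (fun p => actL M (u p)) p = actL M (dirD v u p) := by
  have := (actL M).hasFDerivAt.comp p (hu.diff p).hasFDerivAt
  unfold dirD
  erw [this.fderiv]
  rfl

lemma pd_inner {f g : SpaceTime d → Val n} (hf : Smooth f) (hg : Smooth g) (v p : SpaceTime d) :
    pd v (fun p => inner ℝ (f p) (g p)) p =
      inner ℝ (f p) (dirD v g p) + inner ℝ (dirD v f p) (g p) :=
  fderiv_inner_apply ℝ (hf.diff p) (hg.diff p) v

lemma pd_mul {f g : SpaceTime d → ℝ} (hf : Smooth f) (hg : Smooth g) (v p : SpaceTime d) :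
    pd v (fun p => f p * g p) p = pd v f p * g p + f p * pd v g p := by
  unfold pd
  rw [fderiv_fun_mul (hf.diff p) (hg.diff p)]
  simp only [add_apply, smul_apply, smul_eq_mul]
  ring

lemma pd_add {f g : SpaceTime d → ℝ} (hf : Smooth f) (hg : Smooth g) (v p : SpaceTime d) :
    pd v (fun p => f p + g p) p = pd v f p + pd v g p := by
  unfold pd
  rw [fderiv_fun_add (hf.diff p) (hg.diff p)]
  rfl

lemma pd_sub {f g : SpaceTime d → ℝ} (hf : Smooth f) (hg : Smooth g) (v p : SpaceTime d) :
    pd v (fun p => f p - g p) p = pd v f p - pd v g p := by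
  unfold pd
  rw [fderiv_fun_sub (hf.diff p) (hg.diff p)]
  rfl

lemma pd_const_mul {f : SpaceTime d → ℝ} (hf : Smooth f) (c : ℝ) (v p : SpaceTime d) :
    pd v (fun p => c * f p) p = c * pd v f p := by
  unfold pd
  rw [fderiv_const_mul (hf.diff p)]
  rfl

lemma pd_sum {ι : Type*} (s : Finset ι) {f : ι → SpaceTime d → ℝ} (hf : ∀ i, Smooth (f i))
    (v p : SpaceTime d) :
    pd v (fun p => ∑ i ∈ s, f i p) p = ∑ i ∈ s, pd v (f i) p := by
  unfold pd
  rw [fderiv_fun_sum (fun i _ => (hf i).diff p)]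
  simp

lemma pd_quad {u : SpaceTime d → Val n} (hu : Smooth u) {M : Matrix (Fin n) (Fin n) ℂ}
    (hM : M.IsHermitian) (v p : SpaceTime d) :
    pd v (fun p => inner ℝ (actL M (u p)) (u p)) p = 2 * inner ℝ (actL M (u p)) (dirD v u p) := by
  rw [pd_inner (hu.actL M) hu, dirD_actL hu, actL_symm hM (dirD v u p),
    real_inner_comm (actL M (u p)) (dirD v u p)]
  ring

lemma pd_normSq {u : SpaceTime d → Val n} (hu : Smooth u) (v p : SpaceTime d) :
    pd v (fun p => inner ℝ (u p) (u p)) p = 2 * inner ℝ (u p) (dirD v u p) := by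
  rw [pd_inner hu hu, real_inner_comm (u p) (dirD v u p)]
  ring

lemma Smooth.inner {f g : SpaceTime d → Val n} (hf : Smooth f) (hg : Smooth g) :
    Smooth (fun p => inner ℝ (f p) (g p)) := ContDiff.inner ℝ hf hg

end calculus

end HalfSpaceIBVP

open HalfSpaceIBVP

/-! ### Pointwise identities: energy, momentum, Green -/

namespace HalfSpaceProblem
variable {d n : ℕ}

/-- The residual `u_tt - P_0 u`. -/
def residual (P : HalfSpaceProblem d n) (u : SpaceTime d → Val n) (p : SpaceTime d) : Val n :=
  dirD dt (dirD dt u) p -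
    (actL P.A (dirD d1 (dirD d1 u) p) + ∑ j : Fin d, actL (P.B j) (dirD (dj j) (dirD (dj j) u) p))

lemma Dtt_eq (P : HalfSpaceProblem d n) (u : SpaceTime d → Val n) (p : SpaceTime d) :
    dirD dt (dirD dt u) p = actL P.A (dirD d1 (dirD d1 u) p) +
      ∑ j : Fin d, actL (P.B j) (dirD (dj j) (dirD (dj j) u) p) + P.residual u p := by
  unfold residual; abel

/-- The energy density. -/
def energy (P : HalfSpaceProblem d n) (u : SpaceTime d → Val n) (p : SpaceTime d) : ℝ :=
  (1 / 2) * (inner ℝ (dirD dt u p) (dirD dt u p) +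
    inner ℝ (actL P.A (dirD d1 u p)) (dirD d1 u p) +
    ∑ j : Fin d, inner ℝ (actL (P.B j) (dirD (dj j) u p)) (dirD (dj j) u p))

lemma smooth_energy (P : HalfSpaceProblem d n) {u : SpaceTime d → Val n} (hu : Smooth u) :
    Smooth (P.energy u) :=
  contDiff_const.mul ((((hu.dirD dt).inner (hu.dirD dt)).add
    (((hu.dirD d1).actL P.A).inner (hu.dirD d1))).add
    (ContDiff.sum fun j _ => ((hu.dirD (dj j)).actL (P.B j)).inner (hu.dirD (dj j))))

lemma smooth_residual (P : HalfSpaceProblem d n) {u : SpaceTime d → Val n} (hu : Smooth u) :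
    Smooth (P.residual u) :=
  ((hu.dirD dt).dirD dt).sub ((((hu.dirD d1).dirD d1).actL P.A).add
    (ContDiff.sum fun j _ => ((hu.dirD (dj j)).dirD (dj j)).actL (P.B j)))

/-- The multiplier is u_t. Since M = A_1, B_j is Hermitian and derivatives commute, ⟨M D_v u, D_v
u_t⟩ is the divergence term D_v⟨M D_v u, u_t⟩ minus ⟨M D_v D_v u, u_t⟩, and the latter combines with
⟨u_tt, u_t⟩ into the residual. -/
lemma pd_energy (P : HalfSpaceProblem d n) {u : SpaceTime d → Val n} (hu : Smooth u)
    (p : SpaceTime d) :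
    pd dt (P.energy u) p =
      pd d1 (fun p => inner ℝ (actL P.A (dirD d1 u p)) (dirD dt u p)) p +
      ∑ j : Fin d, pd (dj j) (fun p => inner ℝ (actL (P.B j) (dirD (dj j) u p)) (dirD dt u p)) p +
      inner ℝ (P.residual u p) (dirD dt u p) := by
  have h1 : ∀ v, Smooth (dirD v u) := fun v => hu.dirD v
  have hB : ∀ j, Smooth fun p => inner ℝ (actL (P.B j) (dirD (dj j) u p)) (dirD (dj j) u p) :=
    fun j => ((h1 _).actL _).inner (h1 _)
  unfold energy
  rw [pd_const_mul ((((h1 _).inner (h1 _)).add (((h1 _).actL P.A).inner (h1 _))).add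
    (ContDiff.sum fun j _ => hB j)), pd_add (((h1 _).inner (h1 _)).add
    (((h1 _).actL P.A).inner (h1 _))) (ContDiff.sum fun j _ => hB j),
    pd_add ((h1 _).inner (h1 _)) (((h1 _).actL P.A).inner (h1 _)), pd_sum _ hB,
    pd_normSq (h1 _), pd_quad (h1 _) P.A_pos.1,
    pd_inner ((h1 _).actL P.A) (h1 _), dirD_actL (h1 _), dirD_comm hu d1 dt]
  have e2 : ∀ j, pd dt (fun p => inner ℝ (actL (P.B j) (dirD (dj j) u p)) (dirD (dj j) u p)) p =
      2 * inner ℝ (actL (P.B j) (dirD (dj j) u p)) (dirD dt (dirD (dj j) u) p) :=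
    fun j => pd_quad (h1 _) (P.B_pos j).1 _ _
  have e3 : ∀ j, pd (dj j) (fun p => inner ℝ (actL (P.B j) (dirD (dj j) u p)) (dirD dt u p)) p =
      inner ℝ (actL (P.B j) (dirD (dj j) u p)) (dirD dt (dirD (dj j) u) p) +
      inner ℝ (actL (P.B j) (dirD (dj j) (dirD (dj j) u) p)) (dirD dt u p) := by
    intro j
    rw [pd_inner ((h1 _).actL (P.B j)) (h1 _), dirD_actL (h1 _), dirD_comm hu (dj j) dt]
  simp only [e2, e3, P.Dtt_eq u p, inner_add_right, inner_sum, Finset.sum_add_distrib,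
    ← Finset.mul_sum]
  simp only [real_inner_comm (dirD dt u p)]
  ring

/-- The multiplier is D_1 u (a Rellich identity). Where u vanishes on Γ, the normal flux reduces to
½⟨A_1 D_1 u, D_1 u⟩, which is positive definite; this makes the normal derivative controllable on
the boundary. -/
lemma pd_momentum (P : HalfSpaceProblem d n) {u : SpaceTime d → Val n} (hu : Smooth u)
    (p : SpaceTime d) :
    pd dt (fun p => inner ℝ (dirD dt u p) (dirD d1 u p)) p =
      pd d1 (fun p => (1 / 2) * (inner ℝ (actL P.A (dirD d1 u p)) (dirD d1 u p) +
        inner ℝ (dirD dt u p) (dirD dt u p) -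
        ∑ j : Fin d, inner ℝ (actL (P.B j) (dirD (dj j) u p)) (dirD (dj j) u p))) p +
      ∑ j : Fin d, pd (dj j) (fun p => inner ℝ (actL (P.B j) (dirD (dj j) u p)) (dirD d1 u p)) p +
      inner ℝ (P.residual u p) (dirD d1 u p) := by
  have h1 : ∀ v, Smooth (dirD v u) := fun v => hu.dirD v
  have hB : ∀ j, Smooth fun p => inner ℝ (actL (P.B j) (dirD (dj j) u p)) (dirD (dj j) u p) :=
    fun j => ((h1 _).actL _).inner (h1 _)
  rw [pd_const_mul (((((h1 _).actL P.A).inner (h1 _)).add ((h1 _).inner (h1 _))).sub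
    (ContDiff.sum fun j _ => hB j)), pd_sub ((((h1 _).actL P.A).inner (h1 _)).add
    ((h1 _).inner (h1 _))) (ContDiff.sum fun j _ => hB j),
    pd_add (((h1 _).actL P.A).inner (h1 _)) ((h1 _).inner (h1 _)), pd_sum _ hB,
    pd_normSq (h1 _), pd_quad (h1 _) P.A_pos.1, pd_inner (h1 _) (h1 _), dirD_comm hu dt d1]
  have e2 : ∀ j, pd d1 (fun p => inner ℝ (actL (P.B j) (dirD (dj j) u p)) (dirD (dj j) u p)) p =
      2 * inner ℝ (actL (P.B j) (dirD (dj j) u p)) (dirD d1 (dirD (dj j) u) p) :=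
    fun j => pd_quad (h1 _) (P.B_pos j).1 _ _
  have e3 : ∀ j, pd (dj j) (fun p => inner ℝ (actL (P.B j) (dirD (dj j) u p)) (dirD d1 u p)) p =
      inner ℝ (actL (P.B j) (dirD (dj j) u p)) (dirD d1 (dirD (dj j) u) p) +
      inner ℝ (actL (P.B j) (dirD (dj j) (dirD (dj j) u) p)) (dirD d1 u p) := by
    intro j
    rw [pd_inner ((h1 _).actL (P.B j)) (h1 _), dirD_actL (h1 _), dirD_comm hu (dj j) d1]
  have e4 : inner ℝ (actL P.A (dirD d1 u p)) (dirD d1 (dirD d1 u) p) =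
      inner ℝ (actL P.A (dirD d1 (dirD d1 u) p)) (dirD d1 u p) := by
    rw [actL_symm P.A_pos.1, real_inner_comm]
  simp only [e2, e3, e4, P.Dtt_eq u p, inner_add_left, sum_inner, Finset.sum_add_distrib,
    ← Finset.mul_sum]
  ring

/-- In each direction the products of first derivatives cancel because the coefficient matrices are
Hermitian. -/
lemma green_identity (P : HalfSpaceProblem d n) {u v : SpaceTime d → Val n} (hu : Smooth u)
    (hv : Smooth v) (p : SpaceTime d) :
    inner ℝ (u p) (P.residual v p) - inner ℝ (P.residual u p) (v p) =
      pd dt (fun p => inner ℝ (u p) (dirD dt v p) - inner ℝ (dirD dt u p) (v p)) p +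
      pd d1 (fun p => inner ℝ (actL P.A (dirD d1 u p)) (v p) -
        inner ℝ (u p) (actL P.A (dirD d1 v p))) p +
      ∑ j : Fin d, pd (dj j) (fun p => inner ℝ (actL (P.B j) (dirD (dj j) u p)) (v p) -
        inner ℝ (u p) (actL (P.B j) (dirD (dj j) v p))) p := by
  have h1 : ∀ w, Smooth (dirD w u) := fun w => hu.dirD w
  have h2 : ∀ w, Smooth (dirD w v) := fun w => hv.dirD w
  have gen : ∀ (M : Matrix (Fin n) (Fin n) ℂ), M.IsHermitian → ∀ w,
      pd w (fun p => inner ℝ (actL M (dirD w u p)) (v p) -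
        inner ℝ (u p) (actL M (dirD w v p))) p =
      inner ℝ (actL M (dirD w (dirD w u) p)) (v p) -
        inner ℝ (u p) (actL M (dirD w (dirD w v) p)) := by
    intro M hM w
    rw [pd_sub (((h1 _).actL _).inner hv) (hu.inner ((h2 _).actL _)),
      pd_inner ((h1 _).actL _) hv, pd_inner hu ((h2 _).actL _), dirD_actL (h1 _),
      dirD_actL (h2 _), actL_symm hM (dirD w u p)]
    ring
  rw [gen _ P.A_pos.1]
  simp only [fun j => gen (P.B j) (P.B_pos j).1 (dj j)]
  rw [pd_sub (hu.inner (h2 _)) ((h1 _).inner hv), pd_inner hu (h2 _), pd_inner (h1 _) hv]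
  unfold residual
  simp only [inner_sub_left, inner_sub_right, inner_add_left, inner_add_right, sum_inner,
    inner_sum, Finset.sum_sub_distrib]
  ring

end HalfSpaceProblem

/-! ### The divergence theorem over the half-space cylinder -/

namespace HalfSpaceIBVP

instance instIsAddHaarSpace (d : ℕ) : (volume : Measure (ℝ × Tan d)).IsAddHaarMeasure := by
  rw [Measure.volume_eq_prod]; infer_instance

instance instIsAddHaarSpaceTime (d : ℕ) : (volume : Measure (SpaceTime d)).IsAddHaarMeasure := by
  rw [Measure.volume_eq_prod]; infer_instance

/-- The half space `Ω`. -/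
def halfSpace (d : ℕ) : Set (ℝ × Tan d) := Ici (0 : ℝ) ×ˢ (univ : Set (Tan d))

/-- The space-time cylinder over `Ω`. -/
def cyl (d : ℕ) (T : ℝ) : Set (SpaceTime d) := Icc (0 : ℝ) T ×ˢ halfSpace d

/-- The space-time cylinder over `Γ`. -/
def bcyl (d : ℕ) (T : ℝ) : Set (ℝ × Tan d) := Icc (0 : ℝ) T ×ˢ (univ : Set (Tan d))

/-- The boundary trace of a space-time function. -/
def trace {d : ℕ} {F : Type*} (Φ : SpaceTime d → F) : ℝ × Tan d → F := fun q => Φ (q.1, 0, q.2)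

/-- Bounded support in space, uniformly for times `t > -1`. -/
def SpaceSupp {d : ℕ} {F : Type*} [Zero F] (Φ : SpaceTime d → F) : Prop :=
  ∃ R : ℝ, ∀ t x, -1 < t → R < ‖x‖ → Φ (t, x) = 0

section
variable {d n : ℕ}

lemma measurableSet_halfSpace : MeasurableSet (halfSpace d) :=
  measurableSet_Ici.prod MeasurableSet.univ

lemma measurableSet_cyl (T : ℝ) : MeasurableSet (cyl d T) :=
  measurableSet_Icc.prod measurableSet_halfSpace

lemma measurableSet_bcyl (T : ℝ) : MeasurableSet (bcyl d T) :=
  measurableSet_Icc.prod MeasurableSet.univ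

lemma SpaceSupp.mul_right {Φ Ψ : SpaceTime d → ℝ} (h : SpaceSupp Φ) :
    SpaceSupp (fun p => Φ p * Ψ p) := by
  obtain ⟨R, hR⟩ := h
  exact ⟨R, fun t x ht hx => by simp [hR t x ht hx]⟩

lemma SpaceSupp.comp {F G : Type*} [Zero F] [Zero G] {Φ : SpaceTime d → F} (h : SpaceSupp Φ)
    {Ψ : SpaceTime d → G} (hΨ : ∀ p, Φ p = 0 → Ψ p = 0) : SpaceSupp Ψ := by
  obtain ⟨R, hR⟩ := h
  exact ⟨R, fun t x ht hx => hΨ _ (hR t x ht hx)⟩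

/-- The condition t > -1 is open and includes every t ≥ 0, so derivatives at t = 0 are covered. A
bound for all t would exclude the cone cut-offs, whose supports widen without limit as t → -∞. -/
lemma SpaceSupp.fderiv {F : Type*} [NormedAddCommGroup F] [NormedSpace ℝ F]
    {Φ : SpaceTime d → F} (h : SpaceSupp Φ) : SpaceSupp (fderiv ℝ Φ) := by
  obtain ⟨R, hR⟩ := h
  refine ⟨R, fun t x ht hx => ?_⟩
  have : Φ =ᶠ[nhds (t, x)] fun _ => 0 := by
    have h1 : ∀ᶠ p : SpaceTime d in nhds (t, x), -1 < p.1 :=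
      continuous_fst.continuousAt.eventually (lt_mem_nhds ht)
    have h2 : ∀ᶠ p : SpaceTime d in nhds (t, x), R < ‖p.2‖ :=
      (continuous_snd.norm.continuousAt (x := (t, x))).eventually (lt_mem_nhds hx)
    filter_upwards [h1, h2] with p h1 h2 using hR p.1 p.2 h1 h2
  rw [this.fderiv_eq]
  simp

lemma SpaceSupp.pd {Φ : SpaceTime d → ℝ} (h : SpaceSupp Φ) (v : SpaceTime d) :
    SpaceSupp (pd v Φ) :=
  h.fderiv.comp fun p hp => by simp [HalfSpaceIBVP.pd, hp]

lemma SpaceSupp.dirD {Φ : SpaceTime d → Val n} (h : SpaceSupp Φ) (v : SpaceTime d) :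
    SpaceSupp (dirD v Φ) :=
  h.fderiv.comp fun p hp => by simp [HalfSpaceIBVP.dirD, hp]

lemma _root_.HasCompactSupport.spaceSupp {F : Type*} [Zero F] {Φ : SpaceTime d → F}
    (h : HasCompactSupport Φ) : SpaceSupp Φ := by
  obtain ⟨R, hR⟩ := h.isBounded.exists_norm_le
  refine ⟨R, fun t x _ hx => image_eq_zero_of_notMem_tsupport fun hm => ?_⟩
  exact absurd (hR _ hm) (not_le.2 (hx.trans_le (le_max_right _ _)))

lemma SpaceSupp.hasCompactSupport_slice {F : Type*} [NormedAddCommGroup F] {Φ : SpaceTime d → F}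
    (h : SpaceSupp Φ) {t : ℝ} (ht : 0 ≤ t) : HasCompactSupport fun x => Φ (t, x) := by
  obtain ⟨R, hR⟩ := h
  refine HasCompactSupport.intro (isCompact_closedBall (0 : ℝ × Tan d) R) fun x hx => ?_
  exact hR t x (by linarith) (by simpa using hx)

lemma SpaceSupp.hasCompactSupport_normal {F : Type*} [NormedAddCommGroup F] {Φ : SpaceTime d → F}
    (h : SpaceSupp Φ) {t : ℝ} (ht : 0 ≤ t) (y : Tan d) :
    HasCompactSupport fun x₁ => Φ (t, x₁, y) := by
  obtain ⟨R, hR⟩ := h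
  refine HasCompactSupport.intro (isCompact_closedBall (0 : ℝ) R) fun x hx => ?_
  exact hR t (x, y) (by linarith) (lt_of_lt_of_le (by simpa using hx) (le_max_left _ _))

lemma SpaceSupp.hasCompactSupport_tan {F : Type*} [NormedAddCommGroup F] {Φ : SpaceTime d → F}
    (h : SpaceSupp Φ) {t : ℝ} (ht : 0 ≤ t) (x₁ : ℝ) :
    HasCompactSupport fun y => Φ (t, x₁, y) := by
  obtain ⟨R, hR⟩ := h
  refine HasCompactSupport.intro (isCompact_closedBall (0 : Tan d) R) fun y hx => ?_
  exact hR t (x₁, y) (by linarith) (lt_of_lt_of_le (by simpa using hx) (le_max_right _ _))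

lemma SpaceSupp.integrableOn_cyl {F : Type*} [NormedAddCommGroup F] {Φ : SpaceTime d → F}
    (h : SpaceSupp Φ) (hc : Continuous Φ) (T : ℝ) : IntegrableOn Φ (cyl d T) := by
  obtain ⟨R, hR⟩ := h
  have hK : IsCompact (Icc (0 : ℝ) T ×ˢ Metric.closedBall (0 : ℝ × Tan d) R) :=
    isCompact_Icc.prod (isCompact_closedBall _ _)
  refine (hc.continuousOn.integrableOn_compact hK).of_forall_sdiff_eq_zero (measurableSet_cyl T) ?_
  rintro ⟨t, x⟩ ⟨hx, hx'⟩
  refine hR t x (by linarith [hx.1.1]) ?_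
  by_contra hle
  exact hx' ⟨hx.1, by simpa using not_lt.1 hle⟩

lemma SpaceSupp.integrableOn_bcyl {F : Type*} [NormedAddCommGroup F] {Φ : SpaceTime d → F}
    (h : SpaceSupp Φ) (hc : Continuous Φ) (T : ℝ) : IntegrableOn (trace Φ) (bcyl d T) := by
  obtain ⟨R, hR⟩ := h
  have hK : IsCompact (Icc (0 : ℝ) T ×ˢ Metric.closedBall (0 : Tan d) R) :=
    isCompact_Icc.prod (isCompact_closedBall _ _)
  have hc' : Continuous (trace Φ) := hc.comp (by fun_prop)
  refine (hc'.continuousOn.integrableOn_compact hK).of_forall_sdiff_eq_zero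
    (measurableSet_bcyl T) ?_
  rintro ⟨t, y⟩ ⟨hx, hx'⟩
  refine hR t (0, y) (by linarith [hx.1.1]) (lt_of_lt_of_le ?_ (le_max_right _ _))
  by_contra hle
  exact hx' ⟨hx.1, by simpa using not_lt.1 hle⟩

lemma SpaceSupp.integrable_slice {F : Type*} [NormedAddCommGroup F] {Φ : SpaceTime d → F}
    (h : SpaceSupp Φ) (hc : Continuous Φ) {t : ℝ} (ht : 0 ≤ t) :
    Integrable fun x => Φ (t, x) :=
  (hc.comp (by fun_prop : Continuous fun x => (t, x))).integrable_of_hasCompactSupport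
    (h.hasCompactSupport_slice ht)

lemma setIntegral_cyl {Φ : SpaceTime d → ℝ} {T : ℝ} (hΦ : IntegrableOn Φ (cyl d T)) :
    ∫ p in cyl d T, Φ p = ∫ t in Icc (0 : ℝ) T, ∫ x in halfSpace d, Φ (t, x) :=
  setIntegral_prod Φ hΦ

lemma setIntegral_cyl_symm {Φ : SpaceTime d → ℝ} {T : ℝ} (hΦ : IntegrableOn Φ (cyl d T)) :
    ∫ p in cyl d T, Φ p = ∫ x in halfSpace d, ∫ t in Icc (0 : ℝ) T, Φ (t, x) := by
  have h := hΦ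
  unfold IntegrableOn cyl at h
  unfold cyl
  rw [Measure.volume_eq_prod, ← Measure.prod_restrict] at h ⊢
  exact integral_prod_symm Φ h

lemma hasDerivAt_time {Φ : SpaceTime d → ℝ} (hs : Smooth Φ) (t : ℝ) (x : ℝ × Tan d) :
    HasDerivAt (fun t => Φ (t, x)) (pd dt Φ (t, x)) t :=
  (hs.diff (t, x)).hasFDerivAt.comp_hasDerivAt t
    ((hasDerivAt_id t).prodMk (hasDerivAt_const t x))

lemma hasDerivAt_normal {Φ : SpaceTime d → ℝ} (hs : Smooth Φ) (t x₁ : ℝ) (y : Tan d) :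
    HasDerivAt (fun x₁ => Φ (t, x₁, y)) (pd d1 Φ (t, x₁, y)) x₁ :=
  (hs.diff (t, x₁, y)).hasFDerivAt.comp_hasDerivAt x₁
    ((hasDerivAt_const x₁ t).prodMk ((hasDerivAt_id x₁).prodMk (hasDerivAt_const x₁ y)))

lemma integral_pd_dt {Φ : SpaceTime d → ℝ} (hs : Smooth Φ) (h : SpaceSupp Φ) {T : ℝ}
    (hT : 0 ≤ T) :
    ∫ p in cyl d T, pd dt Φ p =
      (∫ x in halfSpace d, Φ (T, x)) - ∫ x in halfSpace d, Φ (0, x) := by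
  rw [setIntegral_cyl_symm ((h.pd _).integrableOn_cyl (hs.pd _).continuous T),
    ← integral_sub (h.integrable_slice hs.continuous hT).integrableOn
      (h.integrable_slice hs.continuous le_rfl).integrableOn]
  refine setIntegral_congr_fun measurableSet_halfSpace fun x _ => ?_
  rw [integral_Icc_eq_integral_Ioc, ← intervalIntegral.integral_of_le hT]
  refine intervalIntegral.integral_eq_sub_of_hasDerivAt (fun t _ => hasDerivAt_time hs t x) ?_
  exact ((hs.pd dt).continuous.comp (by fun_prop : Continuous fun t => (t, x))).intervalIntegrable
    _ _

/-- The sign is that of the outward normal of Ω, which is -e_1. -/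
lemma integral_pd_d1 {Φ : SpaceTime d → ℝ} (hs : Smooth Φ) (h : SpaceSupp Φ) (T : ℝ) :
    ∫ p in cyl d T, pd d1 Φ p = - ∫ q in bcyl d T, trace Φ q := by
  have hb := h.integrableOn_bcyl hs.continuous T
  have hb' : ∫ q in bcyl d T, trace Φ q =
      ∫ t in Icc (0 : ℝ) T, ∫ y in (univ : Set (Tan d)), trace Φ (t, y) :=
    setIntegral_prod (trace Φ) hb
  rw [setIntegral_cyl ((h.pd _).integrableOn_cyl (hs.pd _).continuous T), hb', ← integral_neg]
  refine setIntegral_congr_fun measurableSet_Icc fun t ht => ?_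
  have hi := ((h.pd d1).integrable_slice (hs.pd d1).continuous ht.1).integrableOn
    (s := halfSpace d)
  unfold IntegrableOn halfSpace at hi
  unfold halfSpace
  rw [Measure.volume_eq_prod, ← Measure.prod_restrict] at hi ⊢
  rw [integral_prod_symm _ hi, ← integral_neg]
  refine setIntegral_congr_fun MeasurableSet.univ fun y _ => ?_
  have hcs := h.hasCompactSupport_normal ht.1 y
  have hder : deriv (fun x₁ => Φ (t, x₁, y)) = fun x₁ => pd d1 Φ (t, x₁, y) :=
    funext fun x₁ => (hasDerivAt_normal hs t x₁ y).deriv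
  have hC1 : ContDiff ℝ 1 (fun x₁ => Φ (t, x₁, y)) :=
    (hs.of_le (by exact_mod_cast le_top)).comp (by fun_prop)
  have := hcs.integral_Ioi_deriv_eq hC1 0
  rw [hder] at this
  rw [integral_Ici_eq_integral_Ioi, this]
  rfl

lemma integral_pd_dj {Φ : SpaceTime d → ℝ} (hs : Smooth Φ) (h : SpaceSupp Φ) (T : ℝ)
    (j : Fin d) : ∫ p in cyl d T, pd (dj j) Φ p = 0 := by
  rw [setIntegral_cyl ((h.pd _).integrableOn_cyl (hs.pd _).continuous T)]
  refine setIntegral_eq_zero_of_forall_eq_zero fun t ht => ?_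
  have hi := ((h.pd (dj j)).integrable_slice (hs.pd (dj j)).continuous ht.1).integrableOn
    (s := halfSpace d)
  unfold IntegrableOn halfSpace at hi
  unfold halfSpace
  rw [Measure.volume_eq_prod] at hi ⊢
  rw [setIntegral_prod _ hi]
  refine setIntegral_eq_zero_of_forall_eq_zero fun x₁ _ => ?_
  rw [Measure.restrict_univ]
  have hfd : ∀ y, fderiv ℝ (fun y => Φ (t, x₁, y)) y (EuclideanSpace.single j 1) =
      pd (dj j) Φ (t, x₁, y) := by
    intro y
    have h2 := (hasFDerivAt_prodMk_right (𝕜 := ℝ) t (x₁, y)).comp y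
      (hasFDerivAt_prodMk_right (𝕜 := ℝ) x₁ y)
    have h1 := (hs.diff (t, x₁, y)).hasFDerivAt.comp y h2
    have h3 : fderiv ℝ (fun y => Φ (t, x₁, y)) y = _ := h1.fderiv
    rw [h3]
    rfl
  have hcs := h.hasCompactSupport_tan ht.1 x₁
  have hcs' := (h.pd (dj j)).hasCompactSupport_tan ht.1 x₁
  have hcont : Continuous fun y => Φ (t, x₁, y) := hs.continuous.comp (by fun_prop)
  have hcont' : Continuous fun y => pd (dj j) Φ (t, x₁, y) :=
    (hs.pd (dj j)).continuous.comp (by fun_prop)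
  -- Integration by parts against the constant 1; the tangential variables fill a whole space, so
  -- there is no boundary term.
  have key := integral_mul_fderiv_eq_neg_fderiv_mul_of_integrable (μ := (volume : Measure (Tan d)))
    (𝕜 := ℝ)
    (f := fun _ => (1 : ℝ)) (g := fun y => Φ (t, x₁, y)) (v := EuclideanSpace.single j 1)
    (by simp) (by simpa [hfd] using hcont'.integrable_of_hasCompactSupport hcs')
    (by simpa using hcont.integrable_of_hasCompactSupport hcs)
    (fun _ _ => differentiableAt_const _) (fun y _ => by
      have h2 : Differentiable ℝ (fun y : Tan d => ((t, x₁, y) : SpaceTime d)) := by fun_prop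
      exact (hs.diff.comp h2) y)
  simpa [hfd] using key

/-- The divergence theorem in the cylinder over the half space. -/
lemma integral_divergence {Φ₀ Φ₁ : SpaceTime d → ℝ} {Φ : Fin d → SpaceTime d → ℝ}
    (s₀ : Smooth Φ₀) (s₁ : Smooth Φ₁) (s : ∀ j, Smooth (Φ j))
    (h₀ : SpaceSupp Φ₀) (h₁ : SpaceSupp Φ₁) (h : ∀ j, SpaceSupp (Φ j)) {T : ℝ} (hT : 0 ≤ T) :
    ∫ p in cyl d T, (pd dt Φ₀ p + pd d1 Φ₁ p + ∑ j, pd (dj j) (Φ j) p) =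
      (∫ x in halfSpace d, Φ₀ (T, x)) - (∫ x in halfSpace d, Φ₀ (0, x)) -
        ∫ q in bcyl d T, trace Φ₁ q := by
  have i₀ := (h₀.pd dt).integrableOn_cyl (s₀.pd dt).continuous T
  have i₁ := (h₁.pd d1).integrableOn_cyl (s₁.pd d1).continuous T
  have i := fun j => ((h j).pd (dj j)).integrableOn_cyl ((s j).pd (dj j)).continuous T
  have i₀₁ : IntegrableOn (fun p => pd dt Φ₀ p + pd d1 Φ₁ p) (cyl d T) := i₀.add i₁
  rw [integral_add i₀₁ (integrable_finsetSum _ fun j _ => i j), integral_add i₀ i₁,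
    integral_finsetSum _ fun j _ => i j, integral_pd_dt s₀ h₀ hT, integral_pd_d1 s₁ h₁]
  simp only [fun j => integral_pd_dj (s j) (h j) T j, Finset.sum_const_zero]
  ring

end
end HalfSpaceIBVP

/-! ### Coercive energy, finite speed, localised energy inequality -/

namespace HalfSpaceProblem
variable {d n : ℕ}

/-- The normal energy flux. -/
def fluxNor (P : HalfSpaceProblem d n) (u : SpaceTime d → Val n) (p : SpaceTime d) : ℝ :=
  inner ℝ (actL P.A (dirD d1 u p)) (dirD dt u p)

/-- The tangential energy fluxes. -/
def fluxTan (P : HalfSpaceProblem d n) (j : Fin d) (u : SpaceTime d → Val n) (p : SpaceTime d) :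
    ℝ :=
  inner ℝ (actL (P.B j) (dirD (dj j) u p)) (dirD dt u p)

lemma smooth_fluxNor (P : HalfSpaceProblem d n) {u : SpaceTime d → Val n} (hu : Smooth u) :
    Smooth (P.fluxNor u) := ((hu.dirD d1).actL P.A).inner (hu.dirD dt)

lemma smooth_fluxTan (P : HalfSpaceProblem d n) (j : Fin d) {u : SpaceTime d → Val n}
    (hu : Smooth u) : Smooth (P.fluxTan j u) :=
  ((hu.dirD (dj j)).actL (P.B j)).inner (hu.dirD dt)

lemma exists_energy_coercive (P : HalfSpaceProblem d n) :
    ∃ κ : ℝ, 0 < κ ∧ (∀ x : Val n, κ * ‖x‖ ^ 2 ≤ inner ℝ (actL P.A x) x) ∧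
      ∀ (u : SpaceTime d → Val n) (p : SpaceTime d),
      κ * (‖dirD dt u p‖ ^ 2 + ‖dirD d1 u p‖ ^ 2 + ∑ j, ‖dirD (dj j) u p‖ ^ 2) ≤
        P.energy u p := by
  obtain ⟨a, ha, hA⟩ := exists_coercive P.A_pos
  choose b hb hB using fun j => exists_coercive (P.B_pos j)
  have hsum : 0 ≤ ∑ j, (b j)⁻¹ := Finset.sum_nonneg fun j _ => (inv_pos.2 (hb j)).le
  -- M⁻¹ lies below 1, below a and below every b_j at once; the further division by 2 accounts for
  -- the factor 1/2 in `energy`.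
  set M : ℝ := 1 + a⁻¹ + ∑ j, (b j)⁻¹ with hM
  have hapos := inv_pos.2 ha
  have hM0 : 0 < M := by positivity
  have hMa : M⁻¹ ≤ a := inv_le_of_inv_le₀ ha (by linarith)
  have hMb : ∀ j, M⁻¹ ≤ b j := fun j => inv_le_of_inv_le₀ (hb j) (by
    have := Finset.single_le_sum (f := fun j => (b j)⁻¹) (fun j _ => (inv_pos.2 (hb j)).le)
      (Finset.mem_univ j)
    linarith)
  have hM1 : M⁻¹ ≤ 1 := inv_le_one_of_one_le₀ (by linarith)
  have hi := inv_pos.2 hM0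
  refine ⟨M⁻¹ / 2, by positivity, fun x => ?_, fun u p => ?_⟩
  · refine le_trans ?_ (hA x)
    gcongr
    linarith
  have h1 : M⁻¹ * ‖dirD dt u p‖ ^ 2 ≤ inner ℝ (dirD dt u p) (dirD dt u p) := by
    rw [real_inner_self_eq_norm_sq]
    nlinarith [sq_nonneg ‖dirD dt u p‖]
  have h2 : M⁻¹ * ‖dirD d1 u p‖ ^ 2 ≤ inner ℝ (actL P.A (dirD d1 u p)) (dirD d1 u p) :=
    le_trans (by gcongr) (hA _)
  have h3 : M⁻¹ * ∑ j, ‖dirD (dj j) u p‖ ^ 2 ≤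
      ∑ j, inner ℝ (actL (P.B j) (dirD (dj j) u p)) (dirD (dj j) u p) := by
    rw [Finset.mul_sum]
    exact Finset.sum_le_sum fun j _ => le_trans (by gcongr; exact hMb j) (hB j _)
  unfold energy
  linarith

lemma energy_nonneg (P : HalfSpaceProblem d n) (u : SpaceTime d → Val n) (p : SpaceTime d) :
    0 ≤ P.energy u p := by
  obtain ⟨κ, hκ, -, h⟩ := P.exists_energy_coercive
  exact le_trans (by positivity) (h u p)

/-- The explicit factor 1/2, in place of κ, is what allows the forcing term in `hidden_regularity`
to be absorbed. -/
lemma half_normSq_le_energy (P : HalfSpaceProblem d n) (u : SpaceTime d → Val n)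
    (p : SpaceTime d) : (1 / 2) * ‖dirD dt u p‖ ^ 2 ≤ P.energy u p := by
  obtain ⟨a, ha, hA⟩ := exists_coercive P.A_pos
  choose b hb hB using fun j => exists_coercive (P.B_pos j)
  have h2 : 0 ≤ inner ℝ (actL P.A (dirD d1 u p)) (dirD d1 u p) :=
    le_trans (by positivity) (hA _)
  have h3 : 0 ≤ ∑ j, inner ℝ (actL (P.B j) (dirD (dj j) u p)) (dirD (dj j) u p) :=
    Finset.sum_nonneg fun j _ => le_trans (by have := hb j; positivity) (hB j _)
  unfold energy
  rw [real_inner_self_eq_norm_sq]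
  linarith

lemma abs_inner_actL_le (M : Matrix (Fin n) (Fin n) ℂ) (x y : Val n) :
    |inner ℝ (actL M x) y| ≤ ‖actL M‖ * (‖y‖ ^ 2 + ‖x‖ ^ 2) := by
  have h1 := abs_real_inner_le_norm (actL M x) y
  have h2 := (actL M).le_opNorm x
  have h3 : ‖x‖ * ‖y‖ ≤ ‖y‖ ^ 2 + ‖x‖ ^ 2 := by nlinarith [sq_nonneg (‖x‖ - ‖y‖)]
  calc _ ≤ ‖actL M x‖ * ‖y‖ := h1
    _ ≤ ‖actL M‖ * ‖x‖ * ‖y‖ := by gcongr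
    _ = ‖actL M‖ * (‖x‖ * ‖y‖) := by ring
    _ ≤ _ := by gcongr

/-- The constant `c` bounds the speed of propagation. -/
def SpeedBound (P : HalfSpaceProblem d n) (c : ℝ) : Prop :=
  ∀ (u : SpaceTime d → Val n) (p : SpaceTime d),
    |P.fluxNor u p| ≤ c * P.energy u p ∧ ∀ j, |P.fluxTan j u p| ≤ c * P.energy u p

/-- Fluxes are bilinear in the first derivatives, hence dominated by the coercive energy density.
The constant need not be the sharp speed; only its finiteness matters. -/
lemma exists_speedBound (P : HalfSpaceProblem d n) : ∃ c : ℝ, 0 < c ∧ P.SpeedBound c := by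
  obtain ⟨κ, hκ, -, h⟩ := P.exists_energy_coercive
  set N : ℝ := 1 + ‖actL P.A‖ + ∑ j, ‖actL (P.B j)‖ with hN
  have hs : 0 ≤ ∑ j, ‖actL (P.B j)‖ := Finset.sum_nonneg fun j _ => norm_nonneg _
  have hN0 : 0 < N := by positivity
  have hNA : ‖actL P.A‖ ≤ N := by linarith
  have hNB : ∀ j, ‖actL (P.B j)‖ ≤ N := fun j => by
    have := Finset.single_le_sum (f := fun j => ‖actL (P.B j)‖) (fun j _ => norm_nonneg _)
      (Finset.mem_univ j)
    linarith [norm_nonneg (actL P.A)]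
  refine ⟨N / κ, by positivity, fun u p => ?_⟩
  have key : ∀ s : ℝ, s ≤ ‖dirD dt u p‖ ^ 2 + ‖dirD d1 u p‖ ^ 2 + ∑ j, ‖dirD (dj j) u p‖ ^ 2 →
      N * s ≤ N / κ * P.energy u p := by
    intro s hs
    have := h u p
    calc N * s = N / κ * (κ * s) := by field_simp
      _ ≤ N / κ * P.energy u p := by
        gcongr
        exact le_trans (by gcongr) this
  have hn : ∀ j, ‖dirD (dj j) u p‖ ^ 2 ≤ ∑ j, ‖dirD (dj j) u p‖ ^ 2 := fun j =>
    Finset.single_le_sum (f := fun j => ‖dirD (dj j) u p‖ ^ 2) (fun j _ => by positivity)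
      (Finset.mem_univ j)
  have hn0 : 0 ≤ ∑ j, ‖dirD (dj j) u p‖ ^ 2 := Finset.sum_nonneg fun j _ => by positivity
  refine ⟨?_, fun j => ?_⟩
  · refine le_trans (abs_inner_actL_le _ _ _) (le_trans ?_ (key _ (le_add_of_nonneg_right hn0)))
    gcongr
  · refine le_trans (abs_inner_actL_le _ _ _) (le_trans ?_ (key (‖dirD dt u p‖ ^ 2 +
      ‖dirD (dj j) u p‖ ^ 2) ?_))
    · gcongr
      exact hNB j
    · nlinarith [hn j, sq_nonneg ‖dirD d1 u p‖]

/-- The energy inequality in a cone, written with a weight function. -/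
lemma local_energy (P : HalfSpaceProblem d n) {c η T : ℝ} (hc : P.SpeedBound c)
    {u : SpaceTime d → Val n} (hu : Smooth u) {w : SpaceTime d → ℝ} (hw : Smooth w)
    (hs : SpaceSupp w) (hw0 : ∀ p, 0 ≤ w p)
    (hwc : ∀ p, 2 * η * w p + c * (|pd d1 w p| + ∑ j, |pd (dj j) w p|) ≤ - pd dt w p)
    (hT : 0 ≤ T) (hres : ∀ p ∈ cyl d T, P.residual u p = 0)
    (hinit : ∀ x ∈ halfSpace d, P.energy u (0, x) = 0) :
    2 * η * ∫ p in cyl d T, w p * P.energy u p ≤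
      - ∫ q in bcyl d T, trace (fun p => w p * P.fluxNor u p) q := by
  have sE := P.smooth_energy hu
  have sN := P.smooth_fluxNor hu
  have sT := fun j => P.smooth_fluxTan j hu
  have hneg : ∀ {f : SpaceTime d → ℝ}, Smooth f → SpaceSupp f →
      Smooth (fun p => -1 * f p) ∧ SpaceSupp (fun p => -1 * f p) := fun hf h =>
    ⟨contDiff_const.mul hf, h.comp fun p hp => by simp [hp]⟩
  have n1 := hneg (hw.mul sN) (hs.mul_right (Ψ := P.fluxNor u))
  have n2 := fun j => hneg (hw.mul (sT j)) (hs.mul_right (Ψ := P.fluxTan j u))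
  have div := integral_divergence (hw.mul sE) n1.1 (fun j => (n2 j).1)
    (hs.mul_right (Ψ := P.energy u)) n1.2 (fun j => (n2 j).2) hT
  -- By the energy law the terms without derivatives of w cancel. In what remains, `hwc` lets -∂_t w
  -- times the energy outweigh the fluxes multiplied by the spatial derivatives of w, with 2ηw times
  -- the energy to spare.
  have hpt : ∀ p ∈ cyl d T, 2 * η * (w p * P.energy u p) ≤
      -(pd dt (fun p => w p * P.energy u p) p + pd d1 (fun p => -1 * (w p * P.fluxNor u p)) p +
        ∑ j, pd (dj j) (fun p => -1 * (w p * P.fluxTan j u p)) p) := by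
    intro p hp
    have e := P.pd_energy hu p
    rw [hres p hp, inner_zero_left, add_zero] at e
    change _ = pd d1 (P.fluxNor u) p + ∑ j, pd (dj j) (P.fluxTan j u) p at e
    rw [pd_mul hw sE, pd_const_mul (hw.mul sN), pd_mul hw sN]
    simp only [fun j => pd_const_mul (hw.mul (sT j)) (-1) (dj j) p,
      fun j => pd_mul hw (sT j) (dj j) p, ← Finset.mul_sum, Finset.sum_add_distrib]
    rw [e]
    have b1 : pd d1 w p * P.fluxNor u p ≥ -(|pd d1 w p| * (c * P.energy u p)) := by
      refine le_trans ?_ (neg_abs_le _)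
      rw [abs_mul]
      exact neg_le_neg (mul_le_mul_of_nonneg_left (hc u p).1 (abs_nonneg _))
    have b2 : ∑ j, pd (dj j) w p * P.fluxTan j u p ≥
        -((∑ j, |pd (dj j) w p|) * (c * P.energy u p)) := by
      rw [Finset.sum_mul, ← Finset.sum_neg_distrib]
      refine Finset.sum_le_sum fun j _ => ?_
      refine le_trans ?_ (neg_abs_le _)
      rw [abs_mul]
      exact neg_le_neg (mul_le_mul_of_nonneg_left ((hc u p).2 j) (abs_nonneg _))
    nlinarith [mul_le_mul_of_nonneg_right (hwc p) (P.energy_nonneg u p)]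
  have hwE := (hs.mul_right (Ψ := P.energy u)).integrableOn_cyl (hw.mul sE).continuous T
  have hle := setIntegral_mono_on (hwE.const_mul (2 * η)) (by
    refine Integrable.neg ?_
    refine Integrable.add (Integrable.add ?_ ?_) (integrable_finsetSum _ fun j _ => ?_)
    · exact ((hs.mul_right (Ψ := P.energy u)).pd dt).integrableOn_cyl
        (Smooth.pd (hw.mul sE) _).continuous T
    · exact (n1.2.pd d1).integrableOn_cyl (n1.1.pd _).continuous T
    · exact ((n2 j).2.pd (dj j)).integrableOn_cyl ((n2 j).1.pd _).continuous T)
    (measurableSet_cyl T) hpt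
  rw [integral_const_mul, integral_neg, div] at hle
  have hend : 0 ≤ ∫ x in halfSpace d, w (T, x) * P.energy u (T, x) :=
    integral_nonneg fun x => mul_nonneg (hw0 _) (P.energy_nonneg _ _)
  have hbeg : ∫ x in halfSpace d, w (0, x) * P.energy u (0, x) = 0 :=
    setIntegral_eq_zero_of_forall_eq_zero fun x hx => by rw [hinit x hx, mul_zero]
  have htr : ∫ q in bcyl d T, trace (fun p => -1 * (w p * P.fluxNor u p)) q =
      - ∫ q in bcyl d T, trace (fun p => w p * P.fluxNor u p) q := by
    rw [← integral_neg]
    simp [trace]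
  linarith

end HalfSpaceProblem

/-! ### Test functions, Green's formula and the normal-derivative estimate -/

namespace HalfSpaceIBVP
variable {d n : ℕ}

/-- Test functions: smooth with compact support, and vanishing near and after the time `T`. -/
structure IsTest (T : ℝ) (V : SpaceTime d → Val n) : Prop where
  smooth : Smooth V
  compact : HasCompactSupport V
  final : ∃ T' < T, ∀ t x, T' < t → V (t, x) = 0

lemma IsTest.dirD_final {T : ℝ} {V : SpaceTime d → Val n} (h : IsTest T V) (v : SpaceTime d) :
    ∃ T' < T, ∀ t x, T' < t → dirD v V (t, x) = 0 := by
  obtain ⟨T', hT', h0⟩ := h.final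
  refine ⟨T', hT', fun t x ht => ?_⟩
  have : V =ᶠ[nhds (t, x)] fun _ => 0 := by
    filter_upwards [continuous_fst.continuousAt.eventually (lt_mem_nhds ht)] with p hp
    exact h0 p.1 p.2 hp
  unfold dirD
  rw [this.fderiv_eq]
  simp

lemma IsTest.dirD {T : ℝ} {V : SpaceTime d → Val n} (h : IsTest T V) (v : SpaceTime d) :
    IsTest T (dirD v V) :=
  ⟨h.smooth.dirD v, h.compact.fderiv_apply ℝ v, h.dirD_final v⟩

lemma IsTest.eq_zero {T : ℝ} {V : SpaceTime d → Val n} (h : IsTest T V) (x : ℝ × Tan d) :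
    V (T, x) = 0 := by
  obtain ⟨T', hT', h0⟩ := h.final
  exact h0 T x hT'

lemma dirD_dt_boundary {V : SpaceTime d → Val n} (hs : Smooth V)
    (hb : ∀ t y, V (t, 0, y) = 0) (t : ℝ) (y : Tan d) : dirD dt V (t, 0, y) = 0 := by
  have h1 : HasDerivAt (fun t => V (t, 0, y)) (dirD dt V (t, 0, y)) t :=
    (hs.diff (t, 0, y)).hasFDerivAt.comp_hasDerivAt t
      ((hasDerivAt_id t).prodMk (hasDerivAt_const t ((0 : ℝ), y)))
  have h2 : (fun t => V (t, 0, y)) = fun _ => 0 := funext fun t => hb t y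
  rw [h2] at h1
  exact h1.unique (hasDerivAt_const t 0)

lemma dirD_dj_boundary {V : SpaceTime d → Val n} (hs : Smooth V)
    (hb : ∀ t y, V (t, 0, y) = 0) (j : Fin d) (t : ℝ) (y : Tan d) :
    dirD (dj j) V (t, 0, y) = 0 := by
  have h2 := (hasFDerivAt_prodMk_right (𝕜 := ℝ) t ((0 : ℝ), y)).comp y
    (hasFDerivAt_prodMk_right (𝕜 := ℝ) (0 : ℝ) y)
  have h1 := (hs.diff (t, 0, y)).hasFDerivAt.comp y h2
  have h3 : (V ∘ (fun z => (t, z)) ∘ fun y => ((0 : ℝ), y)) = fun _ => 0 := funext fun y => hb t y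
  rw [h3] at h1
  exact (ContinuousLinearMap.ext_iff.1 (h1.unique (hasFDerivAt_const 0 y)))
    (EuclideanSpace.single j 1)

end HalfSpaceIBVP

namespace HalfSpaceProblem
variable {d n : ℕ}

/-- The terms at t = T vanish because of V and those at t = 0 because of u. On Γ the term containing
V itself drops out, which leaves the trace of u paired with the conormal derivative of V. -/
lemma green_formula (P : HalfSpaceProblem d n) {T : ℝ} (hT : 0 ≤ T)
    {u V : SpaceTime d → Val n} (hu : Smooth u) (hV : IsTest T V)
    (hb : ∀ t y, V (t, 0, y) = 0) (hres : ∀ p ∈ cyl d T, P.residual u p = 0)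
    (hu0 : ∀ x ∈ halfSpace d, u (0, x) = 0) (hu1 : ∀ x ∈ halfSpace d, dirD dt u (0, x) = 0) :
    ∫ p in cyl d T, inner ℝ (u p) (P.residual V p) =
      ∫ q in bcyl d T, trace (fun p => inner ℝ (u p) (actL P.A (dirD d1 V p))) q := by
  have hVs := hV.smooth
  have sV : SpaceSupp V := hV.compact.spaceSupp
  have sV' : ∀ v, SpaceSupp (dirD v V) := fun v => sV.dirD v
  have supp : ∀ (f g : SpaceTime d → ℝ), (∀ p, V p = 0 → f p = 0) →
      (∀ p, fderiv ℝ V p = 0 → g p = 0) → SpaceSupp (fun p => f p - g p) := by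
    intro f g hf hg
    obtain ⟨R, hR⟩ := sV
    obtain ⟨R', hR'⟩ := hV.compact.spaceSupp.fderiv
    refine ⟨max R R', fun t x ht hx => ?_⟩
    simp [hf _ (hR t x ht (lt_of_le_of_lt (le_max_left _ _) hx)),
      hg _ (hR' t x ht (lt_of_le_of_lt (le_max_right _ _) hx))]
  have fz : ∀ {p}, fderiv ℝ V p = 0 → ∀ v, dirD v V p = 0 := fun h v => by simp [dirD, h]
  have supp' : ∀ (f g : SpaceTime d → ℝ), (∀ p, fderiv ℝ V p = 0 → f p = 0) →
      (∀ p, V p = 0 → g p = 0) → SpaceSupp (fun p => f p - g p) := fun f g hf hg =>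
    (supp g f hg hf).comp fun p hp => by linarith
  have div := integral_divergence (d := d)
    ((hu.inner (hVs.dirD dt)).sub ((hu.dirD dt).inner hVs))
    ((((hu.dirD d1).actL P.A).inner hVs).sub (hu.inner ((hVs.dirD d1).actL P.A)))
    (fun j => (((hu.dirD (dj j)).actL (P.B j)).inner hVs).sub
      (hu.inner ((hVs.dirD (dj j)).actL (P.B j))))
    (supp' _ _ (fun p hp => by simp [fz hp]) (fun p hp => by simp [hp]))
    (supp _ _ (fun p hp => by simp [hp]) (fun p hp => by simp [fz hp]))
    (fun j => supp _ _ (fun p hp => by simp [hp]) (fun p hp => by simp [fz hp])) hT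
  have e1 : ∫ p in cyl d T, inner ℝ (u p) (P.residual V p) =
      ∫ p in cyl d T, (inner ℝ (u p) (P.residual V p) - inner ℝ (P.residual u p) (V p)) :=
    setIntegral_congr_fun (measurableSet_cyl T) fun p hp => by
      simp only [hres p hp, inner_zero_left, sub_zero]
  have e2 : ∫ x in halfSpace d, (inner ℝ (u (T, x)) (dirD dt V (T, x)) -
      inner ℝ (dirD dt u (T, x)) (V (T, x))) = 0 :=
    setIntegral_eq_zero_of_forall_eq_zero fun x _ => by
      rw [hV.eq_zero, (hV.dirD dt).eq_zero]; simp
  have e3 : ∫ x in halfSpace d, (inner ℝ (u (0, x)) (dirD dt V (0, x)) -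
      inner ℝ (dirD dt u (0, x)) (V (0, x))) = 0 :=
    setIntegral_eq_zero_of_forall_eq_zero fun x hx => by
      rw [hu0 x hx, hu1 x hx]; simp
  rw [e1]
  simp only [P.green_identity hu hVs]
  rw [div, e2, e3, sub_zero, zero_sub, ← integral_neg]
  refine integral_congr_ae (Filter.Eventually.of_forall fun q => ?_)
  simp [trace, hb]

lemma hasCompactSupport_residual (P : HalfSpaceProblem d n) {T : ℝ} {V : SpaceTime d → Val n}
    (hV : IsTest T V) : HasCompactSupport (P.residual V) := by
  refine HasCompactSupport.of_support_subset_isCompact (K := tsupport V) hV.compact ?_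
  intro p hp
  by_contra hn
  refine hp ?_
  have h3 : ∀ v, dirD v (dirD v V) p = 0 := fun v => by
    refine image_eq_zero_of_notMem_tsupport fun hm => hn ?_
    have s1 : ∀ f : SpaceTime d → Val n, tsupport (dirD v f) ⊆ tsupport f := fun f =>
      tsupport_fderiv_apply_subset ℝ _
    exact s1 _ (s1 _ hm)
  simp [residual, h3]

/-- The weighted trace estimate for the normal derivative in the backward Dirichlet problem. -/
lemma hidden_regularity (P : HalfSpaceProblem d n) :
    ∃ C : ℝ, 0 < C ∧ ∀ (η T : ℝ) (V : SpaceTime d → Val n), 0 < η → 0 ≤ T → IsTest T V →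
      (∀ t y, V (t, 0, y) = 0) →
      ∫ q in bcyl d T, trace (fun p => Real.exp (2 * η * p.1) * ‖actL P.A (dirD d1 V p)‖ ^ 2) q ≤
        C / η * ∫ p in cyl d T, Real.exp (2 * η * p.1) * ‖P.residual V p‖ ^ 2 := by
  obtain ⟨κ, hκ, hA, hco⟩ := P.exists_energy_coercive
  set N := ‖actL P.A‖
  refine ⟨2 * (N ^ 2 + 1) / κ * (1 / κ + 1 / 2), by positivity, fun η T V hη hT hV hb => ?_⟩
  have hu := hV.smooth
  have sV : SpaceSupp (fderiv ℝ V) := hV.compact.spaceSupp.fderiv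
  have fz : ∀ {p}, fderiv ℝ V p = 0 → ∀ v, dirD v V p = 0 := fun h v => by simp [dirD, h]
  -- V vanishes near t = T, so the problem runs backwards and the weight has to grow: ∂_t θ = 2ηθ
  -- has the favourable sign.
  set θ : SpaceTime d → ℝ := fun p => Real.exp (2 * η * p.1) with hθ
  have sθ : Smooth θ := by
    rw [hθ]; exact Real.contDiff_exp.comp (contDiff_const.mul contDiff_fst)
  have θ0 : ∀ p, 0 < θ p := fun p => Real.exp_pos _
  have pdθ : ∀ v p, pd v θ p = 2 * η * v.1 * θ p := by
    intro v p
    have h1 : HasFDerivAt (fun p : SpaceTime d => 2 * η * p.1)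
        ((2 * η) • ContinuousLinearMap.fst ℝ ℝ (ℝ × Tan d)) p :=
      (ContinuousLinearMap.fst ℝ ℝ (ℝ × Tan d)).hasFDerivAt.const_mul (2 * η)
    have h2 := h1.exp
    unfold pd
    rw [hθ, h2.fderiv]
    simp
    ring
  have pdt : ∀ p, pd dt θ p = 2 * η * θ p := fun p => by rw [pdθ]; simp [dt]
  have pd1 : ∀ p, pd d1 θ p = 0 := fun p => by rw [pdθ]; simp [d1]
  have pdj : ∀ j p, pd (dj j) θ p = 0 := fun j p => by rw [pdθ]; simp [dj]
  have sE := P.smooth_energy hu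
  have sN := P.smooth_fluxNor hu
  have sT := fun j => P.smooth_fluxTan j hu
  have sR := P.smooth_residual hu
  have suppE : SpaceSupp (P.energy V) := sV.comp fun p hp => by simp [energy, fz hp]
  have suppR : SpaceSupp (P.residual V) := (P.hasCompactSupport_residual hV).spaceSupp
  have mulθ : ∀ {f : SpaceTime d → ℝ}, SpaceSupp f → SpaceSupp fun p => θ p * f p := fun h =>
    h.comp fun p hp => by simp [hp]
  have hneg : ∀ {f : SpaceTime d → ℝ}, Smooth f → SpaceSupp f →
      Smooth (fun p => -1 * (θ p * f p)) ∧ SpaceSupp (fun p => -1 * (θ p * f p)) := fun hf h =>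
    ⟨contDiff_const.mul (sθ.mul hf), h.comp fun p hp => by simp [hp]⟩
  -- integrability of the quantities that occur
  have iE : IntegrableOn (fun p => θ p * P.energy V p) (cyl d T) :=
    (mulθ suppE).integrableOn_cyl (sθ.mul sE).continuous T
  have iE0 : IntegrableOn (fun x => P.energy V (0, x)) (halfSpace d) :=
    (suppE.integrable_slice sE.continuous le_rfl).integrableOn
  have iR : IntegrableOn (fun p => θ p * ‖P.residual V p‖ ^ 2) (cyl d T) :=
    SpaceSupp.integrableOn_cyl (suppR.comp fun p hp => by simp [hp])
      (sθ.continuous.mul (sR.continuous.norm.pow 2)) T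
  have iRD : ∀ v, IntegrableOn (fun p => θ p * inner ℝ (P.residual V p) (dirD v V p)) (cyl d T) :=
    fun v => SpaceSupp.integrableOn_cyl (suppR.comp fun p hp => by simp [hp])
      (sθ.continuous.mul (sR.inner (hu.dirD v)).continuous) T
  set X := ∫ p in cyl d T, θ p * P.energy V p with hX
  set E0 := ∫ x in halfSpace d, P.energy V (0, x) with hE0
  set F := ∫ p in cyl d T, θ p * ‖P.residual V p‖ ^ 2 with hF
  have hX0 : 0 ≤ X := integral_nonneg fun p => mul_nonneg (θ0 p).le (P.energy_nonneg _ _)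
  have hE00 : 0 ≤ E0 := integral_nonneg fun p => P.energy_nonneg _ _
  have hF0 : 0 ≤ F := integral_nonneg fun p => mul_nonneg (θ0 p).le (by positivity)
  have hexp0 : ∀ x : ℝ × Tan d, θ (0, x) = 1 := fun x => by simp [hθ]
  -- bounds for the forcing terms
  have young : ∀ (v : SpaceTime d) (c : ℝ), (∀ p, ‖dirD v V p‖ ^ 2 ≤ c * P.energy V p) →
      |∫ p in cyl d T, θ p * inner ℝ (P.residual V p) (dirD v V p)| ≤
        F / (2 * η) + η / 2 * c * X := by
    intro v c hcv
    rw [hF, hX, ← integral_div, ← integral_const_mul, ← integral_add (iR.div_const _)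
      (iE.const_mul _)]
    refine abs_integral_le_integral_abs.trans ?_
    refine integral_mono (iRD v).abs ((iR.div_const _).add (iE.const_mul _)) fun p => ?_
    simp only [abs_mul, abs_of_pos (θ0 p)]
    have h1 := abs_real_inner_le_norm (P.residual V p) (dirD v V p)
    have h2 : ‖P.residual V p‖ * ‖dirD v V p‖ ≤
        ‖P.residual V p‖ ^ 2 / (2 * η) + η / 2 * ‖dirD v V p‖ ^ 2 := by
      rw [div_add' _ _ _ (by positivity), le_div_iff₀ (by positivity)]
      nlinarith [sq_nonneg (‖P.residual V p‖ - η * ‖dirD v V p‖)]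
    calc θ p * |inner ℝ (P.residual V p) (dirD v V p)|
        ≤ θ p * (‖P.residual V p‖ ^ 2 / (2 * η) + η / 2 * (c * P.energy V p)) := by
          refine mul_le_mul_of_nonneg_left (h1.trans (h2.trans ?_)) (θ0 p).le
          gcongr
          exact hcv p
      _ = _ := by ring
  have hco2 : ∀ p, κ * (‖dirD dt V p‖ ^ 2 + ‖dirD d1 V p‖ ^ 2) ≤ P.energy V p := fun p => by
    have h0 : 0 ≤ ∑ j, ‖dirD (dj j) V p‖ ^ 2 := Finset.sum_nonneg fun j _ => by positivity
    nlinarith [hco V p, mul_nonneg hκ.le h0]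
  have hco1 : ∀ p, κ * ‖dirD d1 V p‖ ^ 2 ≤ P.energy V p := fun p => by
    nlinarith [hco2 p, mul_nonneg hκ.le (sq_nonneg ‖dirD dt V p‖)]
  -- With the constant 2 the Young remainder is ηX, half of the 2ηX that the energy identity
  -- provides.
  have yt := young dt 2 fun p => by linarith [P.half_normSq_le_energy V p]
  have y1 := young d1 (1 / κ) fun p => by
    rw [one_div, ← div_eq_inv_mul, le_div_iff₀ hκ]; linarith [hco1 p]
  -- the energy identity
  have hEn : η * X + E0 ≤ F / (2 * η) := by
    have n1 := hneg sN (sV.comp (Ψ := P.fluxNor V) fun p hp => by simp [fluxNor, fz hp])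
    have n2 := fun j => hneg (sT j) (sV.comp (Ψ := P.fluxTan j V) fun p hp => by
      simp [fluxTan, fz hp])
    have div := integral_divergence (sθ.mul sE) n1.1 (fun j => (n2 j).1) (mulθ suppE) n1.2
      (fun j => (n2 j).2) hT
    have hpt : ∀ p, (pd dt (fun p => θ p * P.energy V p) p +
        pd d1 (fun p => -1 * (θ p * P.fluxNor V p)) p +
        ∑ j, pd (dj j) (fun p => -1 * (θ p * P.fluxTan j V p)) p) =
        2 * η * (θ p * P.energy V p) + θ p * inner ℝ (P.residual V p) (dirD dt V p) := by
      intro p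
      have e := P.pd_energy hu p
      change _ = pd d1 (P.fluxNor V) p + ∑ j, pd (dj j) (P.fluxTan j V) p + _ at e
      rw [pd_mul sθ sE, pd_const_mul (sθ.mul sN), pd_mul sθ sN]
      simp only [fun j => pd_const_mul (sθ.mul (sT j)) (-1) (dj j) p,
        fun j => pd_mul sθ (sT j) (dj j) p, ← Finset.mul_sum, Finset.sum_add_distrib,
        pdj, zero_mul, Finset.sum_const_zero, pd1, pdt]
      rw [e]
      ring
    simp only [hpt] at div
    rw [integral_add (iE.const_mul _) (iRD dt), integral_const_mul] at div
    have e2 : ∫ x in halfSpace d, θ (T, x) * P.energy V (T, x) = 0 :=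
      setIntegral_eq_zero_of_forall_eq_zero fun x _ => by
        simp [energy, (hV.dirD _).eq_zero]
    have e3 : ∫ q in bcyl d T, trace (fun p => -1 * (θ p * P.fluxNor V p)) q = 0 :=
      setIntegral_eq_zero_of_forall_eq_zero fun q _ => by
        simp [trace, fluxNor, dirD_dt_boundary hu hb]
    simp only [e2, e3, hexp0, one_mul] at div
    have := (abs_le.1 yt).1
    linarith
  -- the momentum identity
  set sQ : SpaceTime d → ℝ := fun p => (1 / 2) * (inner ℝ (actL P.A (dirD d1 V p)) (dirD d1 V p) +
        inner ℝ (dirD dt V p) (dirD dt V p) -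
        ∑ j : Fin d, inner ℝ (actL (P.B j) (dirD (dj j) V p)) (dirD (dj j) V p)) with hQ
  have sQs : Smooth sQ := contDiff_const.mul (((((hu.dirD _).actL P.A).inner (hu.dirD _)).add
    ((hu.dirD _).inner (hu.dirD _))).sub
    (ContDiff.sum fun j _ => ((hu.dirD _).actL _).inner (hu.dirD _)))
  have sM : Smooth (fun p => inner ℝ (dirD dt V p) (dirD d1 V p)) := (hu.dirD _).inner (hu.dirD _)
  have suppM : SpaceSupp (fun p => inner ℝ (dirD dt V p) (dirD d1 V p)) :=
    sV.comp fun p hp => by simp [fz hp]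
  have iM : IntegrableOn (fun p => θ p * inner ℝ (dirD dt V p) (dirD d1 V p)) (cyl d T) :=
    (mulθ suppM).integrableOn_cyl (sθ.mul sM).continuous T
  have sJ : ∀ j, Smooth (fun p => inner ℝ (actL (P.B j) (dirD (dj j) V p)) (dirD d1 V p)) :=
    fun j => ((hu.dirD _).actL _).inner (hu.dirD _)
  have hM1 : ∀ p, |inner ℝ (dirD dt V p) (dirD d1 V p)| ≤ 1 / (2 * κ) * P.energy V p := by
    intro p
    have h1 := abs_real_inner_le_norm (dirD dt V p) (dirD d1 V p)
    have h2 : ‖dirD dt V p‖ * ‖dirD d1 V p‖ ≤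
        1 / (2 * κ) * (κ * (‖dirD dt V p‖ ^ 2 + ‖dirD d1 V p‖ ^ 2)) := by
      field_simp
      nlinarith [sq_nonneg (‖dirD dt V p‖ - ‖dirD d1 V p‖)]
    refine h1.trans (h2.trans ?_)
    gcongr
    exact hco2 p
  have hMo : ∫ q in bcyl d T, trace (fun p => θ p * sQ p) q ≤ (1 / κ + 1 / 2) * (F / η) := by
    have n1 := hneg sQs (sV.comp (Ψ := sQ) fun p hp => by simp [hQ, fz hp])
    have n2 := fun j => hneg (sJ j) (sV.comp fun p hp => by simp [fz hp])
    have div := integral_divergence (sθ.mul sM) n1.1 (fun j => (n2 j).1) (mulθ suppM) n1.2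
      (fun j => (n2 j).2) hT
    have hpt : ∀ p, (pd dt (fun p => θ p * inner ℝ (dirD dt V p) (dirD d1 V p)) p +
        pd d1 (fun p => -1 * (θ p * sQ p)) p +
        ∑ j, pd (dj j) (fun p => -1 * (θ p *
          inner ℝ (actL (P.B j) (dirD (dj j) V p)) (dirD d1 V p))) p) =
        2 * η * (θ p * inner ℝ (dirD dt V p) (dirD d1 V p)) +
          θ p * inner ℝ (P.residual V p) (dirD d1 V p) := by
      intro p
      have e := P.pd_momentum hu p
      rw [pd_mul sθ sM, pd_const_mul (sθ.mul sQs), pd_mul sθ sQs]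
      simp only [fun j => pd_const_mul (sθ.mul (sJ j)) (-1) (dj j) p,
        fun j => pd_mul sθ (sJ j) (dj j) p, ← Finset.mul_sum, Finset.sum_add_distrib,
        pdj, zero_mul, Finset.sum_const_zero, pd1, pdt]
      rw [e]
      ring
    simp only [hpt] at div
    rw [integral_add (iM.const_mul _) (iRD d1), integral_const_mul] at div
    have e2 : ∫ x in halfSpace d, θ (T, x) * inner ℝ (dirD dt V (T, x)) (dirD d1 V (T, x)) = 0 :=
      setIntegral_eq_zero_of_forall_eq_zero fun x _ => by
        simp [(hV.dirD _).eq_zero]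
    have e3 : ∫ q in bcyl d T, trace (fun p => -1 * (θ p * sQ p)) q =
        - ∫ q in bcyl d T, trace (fun p => θ p * sQ p) q := by
      rw [← integral_neg]
      simp [trace]
    simp only [e2, e3, hexp0, one_mul] at div
    -- V need not vanish at t = 0; the momentum there is bounded by the initial energy E0, which the
    -- energy identity also controls.
    have b0 : |∫ x in halfSpace d, inner ℝ (dirD dt V (0, x)) (dirD d1 V (0, x))| ≤
        1 / (2 * κ) * E0 := by
      rw [hE0, ← integral_const_mul]
      refine abs_integral_le_integral_abs.trans ?_
      exact integral_mono ((suppM.integrable_slice sM.continuous le_rfl).integrableOn (s := _)).abs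
        (iE0.const_mul _) fun x => hM1 _
    have b1 : |∫ p in cyl d T, θ p * inner ℝ (dirD dt V p) (dirD d1 V p)| ≤
        1 / (2 * κ) * X := by
      rw [hX, ← integral_const_mul]
      refine abs_integral_le_integral_abs.trans ?_
      refine integral_mono iM.abs (iE.const_mul _) fun p => ?_
      simp only [abs_mul, abs_of_pos (θ0 p)]
      calc _ ≤ θ p * (1 / (2 * κ) * P.energy V p) :=
            mul_le_mul_of_nonneg_left (hM1 p) (θ0 p).le
        _ = _ := by ring
    have b0' := (abs_le.1 b0).2
    have b1' := mul_le_mul_of_nonneg_left (abs_le.1 b1).2 (by positivity : 0 ≤ 2 * η)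
    have y1' := (abs_le.1 y1).2
    have hfin : 1 / (2 * κ) * E0 + 2 * η * (1 / (2 * κ) * X) + (F / (2 * η) + η / 2 * (1 / κ) * X)
        ≤ (1 / κ + 1 / 2) * (F / η) := by
      have h3 : 2 / κ * (η * X + E0) ≤ 2 / κ * (F / (2 * η)) := by gcongr
      have h4 : 2 / κ * (F / (2 * η)) = 1 / κ * (F / η) := by field_simp
      have h5 : F / (2 * η) = 1 / 2 * (F / η) := by field_simp
      have h6 : 0 ≤ 1 / κ * E0 := by positivity
      have h7 : 0 ≤ 1 / κ * (η * X) := by positivity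
      have h8 : 1 / (2 * κ) = 1 / 2 * (1 / κ) := by field_simp
      have h9 : 2 / κ = 2 * (1 / κ) := by ring
      rw [h4, h9] at h3
      rw [h8, h5]
      nlinarith
    linarith
  -- conclusion
  have iQ : IntegrableOn (trace (fun p => θ p * sQ p)) (bcyl d T) :=
    SpaceSupp.integrableOn_bcyl (sV.comp fun p hp => by simp [hQ, fz hp])
      (sθ.mul sQs).continuous T
  have iL : IntegrableOn (trace (fun p => θ p * ‖actL P.A (dirD d1 V p)‖ ^ 2)) (bcyl d T) :=
    SpaceSupp.integrableOn_bcyl (sV.comp fun p hp => by simp [fz hp])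
      (sθ.continuous.mul (((hu.dirD d1).actL P.A).continuous.norm.pow 2)) T
  calc ∫ q in bcyl d T, trace (fun p => θ p * ‖actL P.A (dirD d1 V p)‖ ^ 2) q
      ≤ ∫ q in bcyl d T, 2 * (N ^ 2 + 1) / κ * trace (fun p => θ p * sQ p) q := by
        refine integral_mono iL (iQ.const_mul _) fun q => ?_
        -- On Γ the time and tangential derivatives of V vanish, so only ½⟨A_1 D_1 V, D_1 V⟩ is left
        -- of sQ.
        simp only [trace, hQ, dirD_dt_boundary hu hb, dirD_dj_boundary hu hb, map_zero,
          inner_zero_left, Finset.sum_const_zero, add_zero, sub_zero]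
        have h1 : ‖actL P.A (dirD d1 V (q.1, 0, q.2))‖ ^ 2 ≤
            N ^ 2 * ‖dirD d1 V (q.1, 0, q.2)‖ ^ 2 := by
          rw [← mul_pow]
          gcongr
          exact (actL P.A).le_opNorm _
        have h2 := hA (dirD d1 V (q.1, 0, q.2))
        have h3 : N ^ 2 * ‖dirD d1 V (q.1, 0, q.2)‖ ^ 2 ≤
            (N ^ 2 + 1) / κ * (κ * ‖dirD d1 V (q.1, 0, q.2)‖ ^ 2) := by
          field_simp
          nlinarith [sq_nonneg ‖dirD d1 V (q.1, 0, q.2)‖]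
        calc _ ≤ θ (q.1, 0, q.2) * ((N ^ 2 + 1) / κ *
              inner ℝ (actL P.A (dirD d1 V (q.1, 0, q.2))) (dirD d1 V (q.1, 0, q.2))) := by
              refine mul_le_mul_of_nonneg_left (h1.trans (h3.trans ?_)) (θ0 _).le
              gcongr
          _ = _ := by ring
    _ = 2 * (N ^ 2 + 1) / κ * ∫ q in bcyl d T, trace (fun p => θ p * sQ p) q :=
        integral_const_mul _ _
    _ ≤ 2 * (N ^ 2 + 1) / κ * ((1 / κ + 1 / 2) * (F / η)) := by gcongr
    _ = _ := by ring

end HalfSpaceProblem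

/-! ### Cut-off functions along propagation cones -/

namespace HalfSpaceIBVP
variable {d n : ℕ}

/-- A smooth substitute for the distance of the space variables from `x₀`. -/
def softDist (x₀ : ℝ × Tan d) (p : SpaceTime d) : ℝ :=
  Real.sqrt (1 + (p.2.1 - x₀.1) ^ 2 + ‖p.2.2 - x₀.2‖ ^ 2)

lemma softDist_arg_pos (x₀ : ℝ × Tan d) (p : SpaceTime d) :
    0 < 1 + (p.2.1 - x₀.1) ^ 2 + ‖p.2.2 - x₀.2‖ ^ 2 := by positivity

lemma smooth_softDist (x₀ : ℝ × Tan d) : Smooth (softDist x₀) := by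
  refine ContDiff.sqrt ?_ fun p => (softDist_arg_pos x₀ p).ne'
  exact (contDiff_const.add ((contDiff_fst.comp contDiff_snd).sub contDiff_const |>.pow 2)).add
    (ContDiff.norm_sq ℝ ((contDiff_snd.comp contDiff_snd).sub contDiff_const))

lemma softDist_pos (x₀ : ℝ × Tan d) (p : SpaceTime d) : 0 < softDist x₀ p :=
  Real.sqrt_pos.2 (softDist_arg_pos x₀ p)

lemma dist_le_softDist (x₀ : ℝ × Tan d) (p : SpaceTime d) :
    |p.2.1 - x₀.1| ≤ softDist x₀ p ∧ ‖p.2.2 - x₀.2‖ ≤ softDist x₀ p := by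
  constructor
  · refine Real.abs_le_sqrt ?_
    nlinarith [sq_nonneg ‖p.2.2 - x₀.2‖]
  · refine Real.le_sqrt_of_sq_le ?_
    nlinarith [sq_nonneg (p.2.1 - x₀.1)]

lemma norm_le_softDist_add (x₀ : ℝ × Tan d) (p : SpaceTime d) :
    ‖p.2‖ ≤ softDist x₀ p + ‖x₀‖ := by
  have h : ‖p.2 - x₀‖ ≤ softDist x₀ p := max_le (dist_le_softDist x₀ p).1 (dist_le_softDist x₀ p).2
  calc ‖p.2‖ = ‖(p.2 - x₀) + x₀‖ := by rw [sub_add_cancel]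
    _ ≤ _ := (norm_add_le _ _).trans (by gcongr)

lemma pd_softDist (x₀ : ℝ × Tan d) (v p : SpaceTime d) :
    pd v (softDist x₀) p =
      ((p.2.1 - x₀.1) * v.2.1 + inner ℝ (p.2.2 - x₀.2) v.2.2) / softDist x₀ p := by
  have h1 : HasFDerivAt (fun p : SpaceTime d => p.2.1 - x₀.1)
      ((ContinuousLinearMap.fst ℝ ℝ (Tan d)).comp (ContinuousLinearMap.snd ℝ ℝ (ℝ × Tan d))) p :=
    ((ContinuousLinearMap.fst ℝ ℝ (Tan d)).comp
      (ContinuousLinearMap.snd ℝ ℝ (ℝ × Tan d))).hasFDerivAt.sub_const _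
  have h2 : HasFDerivAt (fun p : SpaceTime d => p.2.2 - x₀.2)
      ((ContinuousLinearMap.snd ℝ ℝ (Tan d)).comp (ContinuousLinearMap.snd ℝ ℝ (ℝ × Tan d))) p :=
    ((ContinuousLinearMap.snd ℝ ℝ (Tan d)).comp
      (ContinuousLinearMap.snd ℝ ℝ (ℝ × Tan d))).hasFDerivAt.sub_const _
  have h3 := (((h1.pow 2).const_add 1).add h2.norm_sq).sqrt (softDist_arg_pos x₀ p).ne'
  have h4 : fderiv ℝ (softDist x₀) p = _ := h3.fderiv
  unfold pd
  rw [h4]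
  unfold softDist
  simp
  field_simp
  rw [inner_sub_left]

lemma abs_pd_softDist_le (x₀ : ℝ × Tan d) (p : SpaceTime d) :
    pd dt (softDist x₀) p = 0 ∧ |pd d1 (softDist x₀) p| ≤ 1 ∧
      ∀ j, |pd (dj j) (softDist x₀) p| ≤ 1 := by
  have hpos := softDist_pos x₀ p
  refine ⟨by simp [pd_softDist, dt], ?_, fun j => ?_⟩
  · rw [pd_softDist, abs_div, abs_of_pos hpos, div_le_one hpos]
    simpa [d1] using (dist_le_softDist x₀ p).1
  · rw [pd_softDist, abs_div, abs_of_pos hpos, div_le_one hpos]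
    refine le_trans ?_ (dist_le_softDist x₀ p).2
    have := abs_real_inner_le_norm (p.2.2 - x₀.2) (EuclideanSpace.single j (1 : ℝ))
    simpa [dj] using this

/-- A cut-off function that decreases along a cone of slope `c`. -/
def cutoff (c R : ℝ) (x₀ : ℝ × Tan d) (p : SpaceTime d) : ℝ :=
  Real.smoothTransition (R - c * p.1 - softDist x₀ p)

lemma smooth_cutoff (c R : ℝ) (x₀ : ℝ × Tan d) : Smooth (cutoff c R x₀) :=
  Real.smoothTransition.contDiff.comp
    ((contDiff_const.sub (contDiff_const.mul contDiff_fst)).sub (smooth_softDist x₀))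

lemma cutoff_nonneg (c R : ℝ) (x₀ : ℝ × Tan d) (p : SpaceTime d) : 0 ≤ cutoff c R x₀ p :=
  Real.smoothTransition.nonneg _

lemma cutoff_le_one (c R : ℝ) (x₀ : ℝ × Tan d) (p : SpaceTime d) : cutoff c R x₀ p ≤ 1 :=
  Real.smoothTransition.le_one _

lemma pd_cutoff (c R : ℝ) (x₀ : ℝ × Tan d) (v p : SpaceTime d) :
    pd v (cutoff c R x₀) p = deriv Real.smoothTransition (R - c * p.1 - softDist x₀ p) *
      (-(c * v.1) - pd v (softDist x₀) p) := by
  have h1 : HasFDerivAt (fun p : SpaceTime d => R - c * p.1 - softDist x₀ p)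
      (-(c • ContinuousLinearMap.fst ℝ ℝ (ℝ × Tan d)) - fderiv ℝ (softDist x₀) p) p :=
    (((ContinuousLinearMap.fst ℝ ℝ (ℝ × Tan d)).hasFDerivAt.const_mul c).const_sub R).sub
      ((smooth_softDist x₀).diff p).hasFDerivAt
  have h2 : HasDerivAt Real.smoothTransition
      (deriv Real.smoothTransition (R - c * p.1 - softDist x₀ p)) (R - c * p.1 - softDist x₀ p) :=
    ((Real.smoothTransition.contDiff (n := 1)).differentiable (by simp) _).hasDerivAt
  have h3 : fderiv ℝ (cutoff c R x₀) p = _ := (h2.comp_hasFDerivAt p h1).fderiv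
  unfold pd
  rw [h3]
  simp

/-- Each of the 1 + d spatial derivatives is at most the slope m of the profile in modulus; the cone
slope c(1 + d) makes the time derivative pay for all of them together. -/
lemma cutoff_speed (c R : ℝ) (hc : 0 ≤ c) (x₀ : ℝ × Tan d) (p : SpaceTime d) :
    c * (|pd d1 (cutoff (c * (1 + d)) R x₀) p| + ∑ j, |pd (dj j) (cutoff (c * (1 + d)) R x₀) p|) ≤
      - pd dt (cutoff (c * (1 + d)) R x₀) p := by
  obtain ⟨h0, h1, hj⟩ := abs_pd_softDist_le x₀ p
  set m := deriv Real.smoothTransition (R - c * (1 + d) * p.1 - softDist x₀ p) with hm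
  have hm0 : 0 ≤ m := Real.smoothTransition.monotone.deriv_nonneg
  have e1 : |pd d1 (cutoff (c * (1 + d)) R x₀) p| ≤ m := by
    rw [pd_cutoff, ← hm, abs_mul, abs_of_nonneg hm0]
    simp only [d1, mul_zero, neg_zero, zero_sub, abs_neg] at h1 ⊢
    nlinarith
  have ej : ∀ j, |pd (dj j) (cutoff (c * (1 + d)) R x₀) p| ≤ m := by
    intro j
    have := hj j
    rw [pd_cutoff, ← hm, abs_mul, abs_of_nonneg hm0]
    simp only [dj, mul_zero, neg_zero, zero_sub, abs_neg] at this ⊢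
    nlinarith
  have es : ∑ j, |pd (dj j) (cutoff (c * (1 + d)) R x₀) p| ≤ d * m := by
    refine (Finset.sum_le_sum fun j _ => ej j).trans ?_
    simp
  have et : pd dt (cutoff (c * (1 + d)) R x₀) p = - (c * (1 + d) * m) := by
    rw [pd_cutoff, ← hm, h0]
    simp only [dt]
    ring
  rw [et, neg_neg]
  calc _ ≤ c * (m + d * m) := by gcongr
    _ = _ := by ring

/-- The exponentially weighted cut-off function. -/
def weight (c η R : ℝ) (x₀ : ℝ × Tan d) (p : SpaceTime d) : ℝ :=
  Real.exp (-2 * η * p.1) * cutoff (c * (1 + d)) R x₀ p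

lemma smooth_exp_mul_time (a : ℝ) : Smooth (fun p : SpaceTime d => Real.exp (a * p.1)) :=
  Real.contDiff_exp.comp (contDiff_const.mul contDiff_fst)

lemma pd_exp_mul_time (a : ℝ) (v p : SpaceTime d) :
    pd v (fun p : SpaceTime d => Real.exp (a * p.1)) p = a * v.1 * Real.exp (a * p.1) := by
  have h1 : HasFDerivAt (fun p : SpaceTime d => a * p.1)
      (a • ContinuousLinearMap.fst ℝ ℝ (ℝ × Tan d)) p :=
    (ContinuousLinearMap.fst ℝ ℝ (ℝ × Tan d)).hasFDerivAt.const_mul a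
  have h2 := h1.exp
  unfold pd
  rw [h2.fderiv]
  simp
  ring

lemma smooth_weight (c η R : ℝ) (x₀ : ℝ × Tan d) : Smooth (weight c η R x₀) :=
  (smooth_exp_mul_time _).mul (smooth_cutoff _ _ _)

lemma weight_nonneg (c η R : ℝ) (x₀ : ℝ × Tan d) (p : SpaceTime d) : 0 ≤ weight c η R x₀ p :=
  mul_nonneg (Real.exp_pos _).le (cutoff_nonneg _ _ _ _)

lemma weight_le (c η R : ℝ) (x₀ : ℝ × Tan d) (p : SpaceTime d) :
    weight c η R x₀ p ≤ Real.exp (-2 * η * p.1) :=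
  mul_le_of_le_one_right (Real.exp_pos _).le (cutoff_le_one _ _ _ _)

/-- For t > -1 the cross-section of the cone has soft radius at most R + c(1 + d). -/
lemma spaceSupp_weight {c : ℝ} (hc : 0 ≤ c) (η R : ℝ) (x₀ : ℝ × Tan d) :
    SpaceSupp (weight c η R x₀) := by
  refine ⟨R + c * (1 + d) + ‖x₀‖, fun t x ht hx => ?_⟩
  have h := norm_le_softDist_add x₀ (t, x)
  have h2 : 0 ≤ c * (1 + d) := by positivity
  have h3 : cutoff (c * (1 + d)) R x₀ (t, x) = 0 := by
    refine Real.smoothTransition.zero_of_nonpos ?_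
    simp only at h ⊢
    nlinarith
  rw [weight, h3, mul_zero]

/-- The exponential contributes the term 2ηw and the cut-off the remaining inequality. This is the
hypothesis on the weight in `local_energy`. -/
lemma weight_speed {c : ℝ} (hc : 0 ≤ c) (η R : ℝ) (x₀ : ℝ × Tan d) (p : SpaceTime d) :
    2 * η * weight c η R x₀ p +
      c * (|pd d1 (weight c η R x₀) p| + ∑ j, |pd (dj j) (weight c η R x₀) p|) ≤
      - pd dt (weight c η R x₀) p := by
  have key : ∀ v, pd v (weight c η R x₀) p =
      -2 * η * v.1 * weight c η R x₀ p +
        Real.exp (-2 * η * p.1) * pd v (cutoff (c * (1 + d)) R x₀) p := by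
    intro v
    have := pd_mul (smooth_exp_mul_time (-2 * η)) (smooth_cutoff (c * (1 + d)) R x₀) v p
    rw [pd_exp_mul_time] at this
    unfold weight at *
    rw [this]
    ring
  have k1 : pd d1 (weight c η R x₀) p =
      Real.exp (-2 * η * p.1) * pd d1 (cutoff (c * (1 + d)) R x₀) p := by
    rw [key]; simp [d1]
  have kj : ∀ j, pd (dj j) (weight c η R x₀) p =
      Real.exp (-2 * η * p.1) * pd (dj j) (cutoff (c * (1 + d)) R x₀) p := fun j => by
    rw [key]; simp [dj]
  have kt : pd dt (weight c η R x₀) p = -2 * η * weight c η R x₀ p +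
      Real.exp (-2 * η * p.1) * pd dt (cutoff (c * (1 + d)) R x₀) p := by
    rw [key]; simp [dt]
  simp only [k1, kj, kt, abs_mul, abs_of_pos (Real.exp_pos (-2 * η * p.1)), ← Finset.mul_sum,
    ← mul_add]
  have := mul_le_mul_of_nonneg_left (cutoff_speed c R hc x₀ p) (Real.exp_pos (-2 * η * p.1)).le
  linarith

lemma hasDerivAt_time_val {u : SpaceTime d → Val n} (hu : Smooth u) (t : ℝ) (x : ℝ × Tan d) :
    HasDerivAt (fun t => u (t, x)) (dirD dt u (t, x)) t :=
  (hu.diff (t, x)).hasFDerivAt.comp_hasDerivAt t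
    ((hasDerivAt_id t).prodMk (hasDerivAt_const t x))

lemma dirD_translate (u : SpaceTime d → Val n) (s v p : SpaceTime d) :
    dirD v (fun p => u (p + s)) p = dirD v u (p + s) := by
  unfold dirD
  rw [fderiv_comp_add_right]

lemma Smooth.translate {u : SpaceTime d → Val n} (hu : Smooth u) (s : SpaceTime d) :
    Smooth (fun p => u (p + s)) := hu.comp (contDiff_id.add contDiff_const)

end HalfSpaceIBVP

/-! ### Uniqueness for smooth solutions in the whole space -/

namespace HalfSpaceProblem
variable {d n : ℕ}

lemma residual_translate (P : HalfSpaceProblem d n) (u : SpaceTime d → Val n)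
    (s p : SpaceTime d) : P.residual (fun p => u (p + s)) p = P.residual u (p + s) := by
  have h : ∀ v, dirD v (fun p => u (p + s)) = fun p => dirD v u (p + s) := fun v =>
    funext fun p => dirD_translate u s v p
  simp only [residual, h, dirD_translate]

/-- Uniqueness for the Cauchy problem in the whole space. -/
lemma cauchy_unique (P : HalfSpaceProblem d n) {W : SpaceTime d → Val n} (hW : Smooth W)
    {t₀ T : ℝ} (hres : ∀ p : SpaceTime d, p.1 < T → P.residual W p = 0)
    (hinit : ∀ p : SpaceTime d, p.1 < t₀ → W p = 0) (p : SpaceTime d) (hp : p.1 < T) :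
    W p = 0 := by
  obtain ⟨c, hc, hspeed⟩ := P.exists_speedBound
  rcases lt_or_ge p.1 t₀ with hlt | hge
  · exact hinit p hlt
  set S : ℝ := p.1 - t₀ + 1 with hS
  have hS0 : 0 < S := by linarith
  -- On the axis of the cone the soft distance is 1, so the argument of the cut-off stays at least 1
  -- up to time S. On x_1 = 0 the soft distance is at least R and the cut-off vanishes. The
  -- whole-space cone thus sits inside the half space without boundary flux.
  set R : ℝ := c * (1 + d) * S + 2 with hR
  have hR0 : 0 < R := by positivity
  -- The translation puts p at (S, R, 0) and makes u vanish for t < 1, so all derivatives of u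
  -- vanish at t = 0.
  set s : SpaceTime d := (t₀ - 1, p.2.1 - R, p.2.2) with hs
  set u : SpaceTime d → Val n := fun q => W (q + s) with hu
  have us : Smooth u := hW.translate s
  have u0 : ∀ q : SpaceTime d, q.1 < 1 → u q = 0 := fun q hq => hinit _ (by
    simp only [hs, Prod.fst_add]; linarith)
  have du0 : ∀ (v q : SpaceTime d), q.1 < 1 → dirD v u q = 0 := by
    intro v q hq
    have : u =ᶠ[nhds q] fun _ => 0 := by
      filter_upwards [continuous_fst.continuousAt.eventually (gt_mem_nhds hq)] with r hr
      exact u0 r hr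
    unfold dirD
    rw [this.fderiv_eq]
    simp
  set w : SpaceTime d → ℝ := weight c 1 R ((R, 0) : ℝ × Tan d) with hw
  have hloc := P.local_energy (T := S) (η := 1) hspeed us (smooth_weight c 1 R (R, 0))
    (spaceSupp_weight hc.le 1 R (R, 0)) (weight_nonneg c 1 R (R, 0))
    (weight_speed hc.le 1 R (R, 0)) hS0.le
    (fun q hq => by
      rw [residual_translate]
      refine hres _ ?_
      have := hq.1.2
      simp only [hs, Prod.fst_add]
      linarith)
    (fun x _ => by simp [energy, du0 _ (0, x) (by norm_num)])
  have hbd : ∫ q in bcyl d S, trace (fun p => weight c 1 R (R, 0) p * P.fluxNor u p) q = 0 := by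
    refine setIntegral_eq_zero_of_forall_eq_zero fun q hq => ?_
    have h1 : cutoff (c * (1 + d)) R (R, 0) (q.1, 0, q.2) = 0 := by
      refine Real.smoothTransition.zero_of_nonpos ?_
      have h2 := (dist_le_softDist ((R, 0) : ℝ × Tan d) (q.1, 0, q.2)).1
      simp only [zero_sub, abs_neg, abs_of_pos hR0] at h2
      have h3 : 0 ≤ c * (1 + d) * q.1 := mul_nonneg (by positivity) hq.1.1
      simp only
      linarith
    simp [trace, weight, h1]
  rw [hbd] at hloc
  have sE := P.smooth_energy us
  have sw := smooth_weight c 1 R ((R, 0) : ℝ × Tan d)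
  have hnn : ∀ q, 0 ≤ weight c 1 R (R, 0) q * P.energy u q := fun q =>
    mul_nonneg (weight_nonneg _ _ _ _ _) (P.energy_nonneg _ _)
  have hint := ((spaceSupp_weight hc.le 1 R ((R, 0) : ℝ × Tan d)).mul_right
    (Ψ := P.energy u)).integrableOn_cyl (sw.mul sE).continuous S
  have hzero : ∫ q in cyl d S, weight c 1 R (R, 0) q * P.energy u q = 0 :=
    le_antisymm (by linarith) (integral_nonneg hnn)
  have hae := (integral_eq_zero_iff_of_nonneg hnn hint).1 hzero
  set U : Set (SpaceTime d) := Ioo (0 : ℝ) S ×ˢ (Ioi (0 : ℝ) ×ˢ (univ : Set (Tan d))) with hU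
  have hUo : IsOpen U := isOpen_Ioo.prod (isOpen_Ioi.prod isOpen_univ)
  have hUc : U ⊆ cyl d S := prod_mono Ioo_subset_Icc_self (prod_mono Ioi_subset_Ici_self le_rfl)
  have hUz := Measure.eqOn_open_of_ae_eq (ae_restrict_of_ae_restrict_of_subset hUc hae) hUo
    (sw.mul sE).continuous.continuousOn continuousOn_const
  -- On the axis the weight is positive, so the energy vanishes and with it u_t; u then keeps its
  -- initial value 0 up to p.
  have hDt : ∀ t ∈ Ico (0 : ℝ) S, dirD dt u (t, R, 0) = 0 := by
    intro t ht
    rcases ht.1.eq_or_lt with h0 | h0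
    · exact du0 _ _ (by rw [← h0]; norm_num)
    · have h1 : weight c 1 R (R, 0) (t, R, 0) * P.energy u (t, R, 0) = 0 :=
        hUz (x := (t, R, 0)) ⟨⟨h0, ht.2⟩, hR0, mem_univ _⟩
      have h2 : 0 < weight c 1 R (R, 0) (t, R, (0 : Tan d)) := by
        refine mul_pos (Real.exp_pos _) (Real.smoothTransition.pos_of_pos ?_)
        have : softDist ((R, 0) : ℝ × Tan d) (t, R, 0) = 1 := by simp [softDist]
        rw [this]
        have : c * (1 + d) * t ≤ c * (1 + d) * S := by
          have := ht.2.le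
          gcongr
        simp only
        linarith
      have h3 : P.energy u (t, R, 0) = 0 := (mul_eq_zero.1 h1).resolve_left h2.ne'
      have h4 := P.half_normSq_le_energy u (t, R, 0)
      rw [h3] at h4
      have h5 : ‖dirD dt u (t, R, 0)‖ ^ 2 = 0 := le_antisymm (by linarith) (by positivity)
      simpa using h5
  have hder : ∀ t, HasDerivAt (fun t => u (t, R, 0)) (dirD dt u (t, R, 0)) t := fun t =>
    hasDerivAt_time_val us t (R, 0)
  have hconst := constant_of_has_deriv_right_zero (f := fun t => u (t, R, 0)) (a := 0) (b := S)
    (fun t _ => (hder t).continuousAt.continuousWithinAt)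
    (fun t ht => by
      have := hder t
      rw [hDt t ht] at this
      exact this.hasDerivWithinAt) S (right_mem_Icc.2 hS0.le)
  rw [u0 (0, R, 0) (by norm_num)] at hconst
  have hpS : ((S, R, 0) : SpaceTime d) + s = p := by
    simp only [hs, hS]
    ext <;> simp
  rw [← hpS]
  exact hconst

end HalfSpaceProblem

/-! ### Mollification and uniqueness of weak solutions -/

namespace HalfSpaceIBVP
variable {d n : ℕ}

instance instIsNegInvariantSpaceTime (d : ℕ) :
    (volume : Measure (SpaceTime d)).IsNegInvariant :=
  Measure.IsAddHaarMeasure.isNegInvariant_of_innerRegular _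

/-- The mollification `∫ ψ(p - q) z(q) dq`. -/
def mollify (z : SpaceTime d → Val n) (ψ : SpaceTime d → ℝ) : SpaceTime d → Val n :=
  convolution z ψ (ContinuousLinearMap.lsmul ℝ ℝ).flip volume

lemma mollify_apply (z : SpaceTime d → Val n) (ψ : SpaceTime d → ℝ) (p : SpaceTime d) :
    mollify z ψ p = ∫ q, ψ (p - q) • z q := rfl

lemma integrable_mollify {z : SpaceTime d → Val n} (hz : LocallyIntegrable z volume)
    {ψ : SpaceTime d → ℝ} (hψ : Continuous ψ) (hc : HasCompactSupport ψ) (p : SpaceTime d) :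
    Integrable fun q => ψ (p - q) • z q :=
  hc.convolutionExists_right (ContinuousLinearMap.lsmul ℝ ℝ).flip hz hψ p

lemma smooth_mollify {z : SpaceTime d → Val n} (hz : LocallyIntegrable z volume)
    {ψ : SpaceTime d → ℝ} (hψ : Smooth ψ) (hc : HasCompactSupport ψ) : Smooth (mollify z ψ) :=
  hc.contDiff_convolution_right _ hz hψ

lemma dirD_mollify {z : SpaceTime d → Val n} (hz : LocallyIntegrable z volume)
    {ψ : SpaceTime d → ℝ} (hψ : Smooth ψ) (hc : HasCompactSupport ψ) (v : SpaceTime d) :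
    dirD v (mollify z ψ) = mollify z (pd v ψ) := by
  funext p
  have h1 := hc.hasFDerivAt_convolution_right (ContinuousLinearMap.lsmul ℝ ℝ).flip hz
    (hψ.of_le (by exact_mod_cast le_top)) p
  unfold dirD mollify
  rw [h1.fderiv]
  exact convolution_precompR_apply _ hz (hc.fderiv ℝ)
    (hψ.continuous_fderiv (by simp)) p v

lemma dirD_reflect_smul {ψ : SpaceTime d → ℝ} (hψ : Smooth ψ) (p : SpaceTime d) (e : Val n)
    (v : SpaceTime d) :
    dirD v (fun q => ψ (p - q) • e) = fun q => (-1 : ℝ) • (pd v ψ (p - q) • e) := by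
  funext q
  have h2 : HasFDerivAt (fun q : SpaceTime d => p - q) (-ContinuousLinearMap.id ℝ _) q :=
    (hasFDerivAt_id q).const_sub p
  have h1 := ((hψ.diff (p - q)).hasFDerivAt.comp q h2).smul_const e
  have h3 : fderiv ℝ (fun q => ψ (p - q) • e) q = _ := h1.fderiv
  unfold dirD
  rw [h3]
  simp [pd]

/-- The sign from q ↦ p - q occurs twice and cancels, so the second-order operator passes unchanged
from the mollifier to the test function. -/
lemma dirD_dirD_reflect_smul {ψ : SpaceTime d → ℝ} (hψ : Smooth ψ) (p : SpaceTime d) (e : Val n)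
    (v q : SpaceTime d) :
    dirD v (dirD v (fun q => ψ (p - q) • e)) q = pd v (pd v ψ) (p - q) • e := by
  rw [dirD_reflect_smul hψ]
  have h : (fun q => (-1 : ℝ) • (pd v ψ (p - q) • e)) =
      fun q => pd v ψ (p - q) • ((-1 : ℝ) • e) := by
    funext q
    rw [smul_comm]
  rw [h, dirD_reflect_smul (hψ.pd v)]
  simp

end HalfSpaceIBVP

namespace HalfSpaceProblem
variable {d n : ℕ}

/-- All derivatives can be placed on ψ, and the Hermitian matrices can be moved onto e. The residual
of the mollification is thus z tested against q ↦ ψ(p - q)e. -/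
lemma inner_residual_mollify (P : HalfSpaceProblem d n) {z : SpaceTime d → Val n}
    (hz : LocallyIntegrable z volume) {ψ : SpaceTime d → ℝ} (hψ : Smooth ψ)
    (hc : HasCompactSupport ψ) (p : SpaceTime d) (e : Val n) :
    inner ℝ (P.residual (mollify z ψ) p) e =
      ∫ q, inner ℝ (z q) (P.residual (fun q => ψ (p - q) • e) q) := by
  have hcp : ∀ v, HasCompactSupport (pd v ψ) := fun v => hc.fderiv_apply ℝ v
  have h2 : ∀ v, dirD v (dirD v (mollify z ψ)) = mollify z (pd v (pd v ψ)) := fun v => by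
    rw [dirD_mollify hz hψ hc, dirD_mollify hz (hψ.pd v) (hcp v)]
  have hi : ∀ v, Integrable fun q => pd v (pd v ψ) (p - q) • z q := fun v =>
    integrable_mollify hz ((hψ.pd v).pd v).continuous ((hcp v).fderiv_apply ℝ v) p
  have hin : ∀ (v : SpaceTime d) (x : Val n), inner ℝ (mollify z (pd v (pd v ψ)) p) x =
      ∫ q, inner ℝ (z q) (pd v (pd v ψ) (p - q) • x) := by
    intro v x
    rw [mollify_apply, real_inner_comm, ← integral_inner (hi v)]
    refine integral_congr_ae (Filter.Eventually.of_forall fun q => ?_)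
    simp only [inner_smul_right, real_inner_comm x]
  have hint : ∀ (v : SpaceTime d) (x : Val n),
      Integrable fun q => inner ℝ (z q) (pd v (pd v ψ) (p - q) • x) := by
    intro v x
    refine ((hi v).inner_const x).congr (Filter.Eventually.of_forall fun q => ?_)
    simp [inner_smul_left, inner_smul_right]
  simp only [residual, h2, dirD_dirD_reflect_smul hψ, map_smul, inner_sub_left, inner_add_left,
    sum_inner, inner_sub_right, inner_add_right, inner_sum]
  have i3 : Integrable fun q => ∑ j, inner ℝ (z q)
      (pd (dj j) (pd (dj j) ψ) (p - q) • actL (P.B j) e) :=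
    integrable_finsetSum _ fun j _ => hint _ _
  have i2 : Integrable fun q => inner ℝ (z q) (pd d1 (pd d1 ψ) (p - q) • actL P.A e) +
      ∑ j, inner ℝ (z q) (pd (dj j) (pd (dj j) ψ) (p - q) • actL (P.B j) e) :=
    (hint _ _).add i3
  rw [integral_sub (hint _ _) i2, integral_add (hint _ _) i3,
    integral_finsetSum _ fun j _ => hint _ _]
  simp only [← hin, actL_symm P.A_pos.1, fun j => actL_symm (P.B_pos j).1]

/-- Uniqueness of weak solutions of the Cauchy problem. -/
lemma weak_unique (P : HalfSpaceProblem d n) {T : ℝ} {z : SpaceTime d → Val n}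
    (hz : LocallyIntegrable z volume) (hz0 : ∀ p : SpaceTime d, p.1 < 0 → z p = 0)
    (hweak : ∀ V, IsTest T V → ∫ q, inner ℝ (z q) (P.residual V q) = 0) :
    ∀ᵐ p : SpaceTime d, p.1 < T → z p = 0 := by
  set φ : ℕ → ContDiffBump (0 : SpaceTime d) := fun i =>
    ⟨1 / (i + 1), 2 / (i + 1), by positivity, by gcongr; norm_num⟩ with hφ
  have hlim : Filter.Tendsto (fun i => (φ i).rOut) Filter.atTop (nhds 0) := by
    have := (tendsto_one_div_add_atTop_nhds_zero_nat (𝕜 := ℝ)).const_mul 2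
    simp only [mul_zero] at this
    refine this.congr fun i => ?_
    simp [hφ, div_eq_mul_inv]
  -- The outer radii are exactly twice the inner ones; a bounded ratio is what almost everywhere
  -- convergence requires.
  have hae := ContDiffBump.ae_convolution_tendsto_right_of_locallyIntegrable (μ := volume)
    (K := 2) (φ := φ) hlim (Filter.Eventually.of_forall fun i => by
      simp only [hφ]; exact le_of_eq (by ring)) hz
  filter_upwards [hae] with p hp hpT
  have hsm : ∀ i, Smooth ((φ i).normed (volume : Measure (SpaceTime d))) := fun i =>
    (φ i).contDiff_normed
  have hcs : ∀ i, HasCompactSupport ((φ i).normed (volume : Measure (SpaceTime d))) := fun i =>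
    (φ i).hasCompactSupport_normed
  have hsupp : ∀ i (q : SpaceTime d), (φ i).rOut ≤ |q.1| →
      (φ i).normed (volume : Measure (SpaceTime d)) q = 0 := by
    intro i q hq
    by_contra hne
    have : q ∈ Function.support ((φ i).normed (volume : Measure (SpaceTime d))) := hne
    rw [(φ i).support_normed_eq, mem_ball_zero_iff] at this
    exact absurd (lt_of_le_of_lt (norm_fst_le q) this) (not_lt.2 hq)
  have hconv : ∀ i, convolution ((φ i).normed volume) z (ContinuousLinearMap.lsmul ℝ ℝ) volume p =
      mollify z ((φ i).normed volume) p := fun i => by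
    rw [mollify, convolution_flip]
  -- Mollifying costs one radius at each end: the test function must vanish before T, and the
  -- support of z may spread back to time -rOut.
  have hzero : ∀ i, p.1 < T - (φ i).rOut → mollify z ((φ i).normed volume) p = 0 := by
    intro i hi
    refine P.cauchy_unique (smooth_mollify hz (hsm i) (hcs i)) (t₀ := -(φ i).rOut)
      (T := T - (φ i).rOut) (fun r hr => ?_) (fun r hr => ?_) p hi
    -- The vector e is the residual itself, so the weak equation says that its squared norm is zero.
    · have htest : IsTest T (fun q => (φ i).normed volume (r - q) •
          P.residual (mollify z ((φ i).normed volume)) r) := by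
        refine ⟨((hsm i).comp (contDiff_const.sub contDiff_id)).smul contDiff_const, ?_,
          r.1 + (φ i).rOut, by linarith, fun t x ht => ?_⟩
        · exact ((hcs i).comp_homeomorph (Homeomorph.subLeft r)).smul_right
        · rw [hsupp i, zero_smul]
          simp only [Prod.fst_sub]
          rw [abs_sub_comm]
          exact le_trans (by linarith) (le_abs_self _)
      have h := P.inner_residual_mollify hz (hsm i) (hcs i) r
        (P.residual (mollify z ((φ i).normed volume)) r)
      rw [hweak _ htest] at h
      exact inner_self_eq_zero.1 h
    · rw [mollify_apply]
      refine integral_eq_zero_of_ae (Filter.Eventually.of_forall fun q => ?_)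
      simp only [Pi.zero_apply]
      rcases lt_or_ge q.1 0 with h | h
      · rw [hz0 q h, smul_zero]
      · rw [hsupp i, zero_smul]
        simp only [Prod.fst_sub]
        rw [abs_sub_comm]
        exact le_trans (by linarith) (le_abs_self _)
  have hev : ∀ᶠ i in Filter.atTop, convolution ((φ i).normed volume) z
      (ContinuousLinearMap.lsmul ℝ ℝ) volume p = 0 := by
    filter_upwards [hlim.eventually (gt_mem_nhds (sub_pos.2 hpT))] with i hi
    rw [hconv, hzero i (by linarith)]
  exact tendsto_nhds_unique hp (Filter.Tendsto.congr' (hev.mono fun i hi => hi.symm)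
    tendsto_const_nhds)

end HalfSpaceProblem

/-! ### Riesz representation through a linear map -/

/-- A linear functional that is bounded through a linear map into a Hilbert space is represented
by an element of that space. -/
lemma exists_representative {V H : Type*} [AddCommGroup V] [Module ℝ V] [NormedAddCommGroup H]
    [InnerProductSpace ℝ H] [CompleteSpace H] (Φ : V →ₗ[ℝ] H) (l : V →ₗ[ℝ] ℝ) {M : ℝ}
    (hM : 0 ≤ M) (h : ∀ v, |l v| ≤ M * ‖Φ v‖) :
    ∃ x : H, ‖x‖ ≤ M ∧ ∀ v, l v = inner ℝ x (Φ v) := by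
  -- The bound makes l vanish on the kernel of Φ, so l descends to a bounded functional on the
  -- range.
  have hker : LinearMap.ker Φ ≤ LinearMap.ker l := fun v hv => by
    have := h v
    rw [LinearMap.mem_ker.1 hv, norm_zero, mul_zero] at this
    exact abs_nonpos_iff.1 this
  set g : LinearMap.range Φ →ₗ[ℝ] ℝ :=
    ((LinearMap.ker Φ).liftQ l hker).comp Φ.quotKerEquivRange.symm.toLinearMap with hg
  have hgv : ∀ v, g ⟨Φ v, LinearMap.mem_range_self Φ v⟩ = l v := by
    intro v
    have : Φ.quotKerEquivRange.symm ⟨Φ v, LinearMap.mem_range_self Φ v⟩ =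
        (LinearMap.ker Φ).mkQ v := Φ.quotKerEquivRange_symm_apply_image v _
    simp only [hg, LinearMap.comp_apply, LinearEquiv.coe_coe]
    rw [this]
    simp
  have hgb : ∀ y, ‖g y‖ ≤ M * ‖y‖ := by
    rintro ⟨_, v, rfl⟩
    rw [hgv]
    exact h v
  -- The range need not be closed, so a norm-preserving extension precedes Riesz.
  obtain ⟨G, hG, hGn⟩ := exists_extension_norm_eq (𝕜 := ℝ) (LinearMap.range Φ)
    (g.mkContinuous M hgb)
  refine ⟨(InnerProductSpace.toDual ℝ H).symm G, ?_, fun v => ?_⟩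
  · rw [LinearIsometryEquiv.norm_map, hGn]
    exact g.mkContinuous_norm_le hM hgb
  · rw [InnerProductSpace.toDual_symm_apply, ← hgv]
    exact (hG ⟨Φ v, LinearMap.mem_range_self Φ v⟩).symm

/-! ### Reflection, antisymmetrisation and odd extension -/

namespace HalfSpaceIBVP
variable {d n : ℕ}

/-- The reflection `x₁ ↦ -x₁`. -/
def refl (d : ℕ) : SpaceTime d ≃L[ℝ] SpaceTime d :=
  (ContinuousLinearEquiv.refl ℝ ℝ).prodCongr
    ((ContinuousLinearEquiv.neg ℝ).prodCongr (ContinuousLinearEquiv.refl ℝ (Tan d)))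

@[simp] lemma refl_apply (p : SpaceTime d) : refl d p = (p.1, -p.2.1, p.2.2) := rfl

lemma measurePreserving_refl : MeasurePreserving (refl d) volume volume :=
  (MeasurePreserving.id volume).prod ((Measure.measurePreserving_neg (volume : Measure ℝ)).prod
    (MeasurePreserving.id volume))

/-- The space-time slab. -/
def slab (d : ℕ) (T : ℝ) : Set (SpaceTime d) := Icc (0 : ℝ) T ×ˢ (univ : Set (ℝ × Tan d))

lemma measurableSet_slab (T : ℝ) : MeasurableSet (slab d T) :=
  measurableSet_Icc.prod MeasurableSet.univ

lemma cyl_subset_slab (T : ℝ) : cyl d T ⊆ slab d T := prod_mono le_rfl (subset_univ _)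

lemma cyl_ae_eq_open (T : ℝ) : (Icc (0 : ℝ) T ×ˢ (Ioi (0 : ℝ) ×ˢ (univ : Set (Tan d))) :
    Set (SpaceTime d)) =ᵐ[volume] cyl d T :=
  Measure.set_prod_ae_eq (ae_eq_refl _) (Measure.set_prod_ae_eq Ioi_ae_eq_Ici (ae_eq_refl _))

lemma refl_preimage_sdiff (T : ℝ) : refl d ⁻¹' (slab d T \ cyl d T) =
    (Icc (0 : ℝ) T ×ˢ (Ioi (0 : ℝ) ×ˢ (univ : Set (Tan d)))) := by
  ext p
  simp only [slab, cyl, halfSpace, mem_preimage, refl_apply, mem_sdiff, mem_prod, mem_univ,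
    and_true, mem_Ici, mem_Ioi, not_and, not_le, Left.nonneg_neg_iff]
  tauto

/-- The part x_1 < 0 is folded onto x_1 > 0; the hyperplane x_1 = 0 is null, so the folded integral
may be taken over `cyl`. -/
lemma setIntegral_slab {f : SpaceTime d → ℝ} {T : ℝ} (hf : IntegrableOn f (slab d T)) :
    ∫ p in slab d T, f p = (∫ p in cyl d T, f p) + ∫ p in cyl d T, f (refl d p) := by
  have h1 : ∫ p in slab d T \ cyl d T, f p = ∫ p in cyl d T, f (refl d p) := by
    rw [← setIntegral_congr_set (cyl_ae_eq_open T), ← refl_preimage_sdiff,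
      measurePreserving_refl.setIntegral_preimage_emb
        (refl d).toHomeomorph.measurableEmbedding f (slab d T \ cyl d T)]
  rw [← h1, ← setIntegral_union disjoint_sdiff_right ((measurableSet_slab T).diff
    (measurableSet_cyl T)) (hf.mono_set (cyl_subset_slab T)) (hf.mono_set sdiff_subset),
    union_sdiff_cancel (cyl_subset_slab T)]

lemma dirD_comp_refl {u : SpaceTime d → Val n} (hu : Smooth u) (v p : SpaceTime d) :
    dirD v (fun p => u (refl d p)) p = dirD (refl d v) u (refl d p) := by
  have h : fderiv ℝ (fun p => u (refl d p)) p = _ :=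
    ((hu.diff (refl d p)).hasFDerivAt.comp p (refl d).hasFDerivAt).fderiv
  unfold dirD
  rw [h]
  rfl

lemma dirD_neg_dir (u : SpaceTime d → Val n) (v p : SpaceTime d) :
    dirD (-v) u p = - dirD v u p := by simp [dirD]

lemma Smooth.comp_refl {u : SpaceTime d → Val n} (hu : Smooth u) :
    Smooth (fun p => u (refl d p)) := hu.comp (refl d).contDiff

lemma refl_dt : refl d dt = dt := by simp [dt]
lemma refl_dj (j : Fin d) : refl d (dj j) = dj j := by simp [dj]
lemma refl_d1 : refl d d1 = -d1 := by simp [d1]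

lemma IsTest.zero (T : ℝ) : IsTest T (0 : SpaceTime d → Val n) :=
  ⟨contDiff_const, HasCompactSupport.zero, T - 1, by linarith, fun _ _ _ => rfl⟩

lemma IsTest.add {T : ℝ} {V W : SpaceTime d → Val n} (hV : IsTest T V) (hW : IsTest T W) :
    IsTest T (V + W) := by
  obtain ⟨a, ha, hVa⟩ := hV.final
  obtain ⟨b, hb, hWb⟩ := hW.final
  refine ⟨hV.smooth.add hW.smooth, hV.compact.add hW.compact, max a b, max_lt ha hb,
    fun t x ht => ?_⟩
  simp [hVa t x (lt_of_le_of_lt (le_max_left _ _) ht),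
    hWb t x (lt_of_le_of_lt (le_max_right _ _) ht)]

lemma IsTest.smul {T : ℝ} {V : SpaceTime d → Val n} (hV : IsTest T V) (c : ℝ) :
    IsTest T (c • V) := by
  obtain ⟨a, ha, hVa⟩ := hV.final
  refine ⟨contDiff_const.smul hV.smooth, hV.compact.smul_left, a, ha, fun t x ht => ?_⟩
  simp [hVa t x ht]

lemma IsTest.comp_refl {T : ℝ} {V : SpaceTime d → Val n} (hV : IsTest T V) :
    IsTest T (fun p => V (refl d p)) := by
  obtain ⟨a, ha, hVa⟩ := hV.final
  exact ⟨hV.smooth.comp_refl, hV.compact.comp_homeomorph (refl d).toHomeomorph, a, ha,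
    fun t x ht => hVa t _ ht⟩

/-- The space of test functions. -/
def testSpace (d n : ℕ) (T : ℝ) : Submodule ℝ (SpaceTime d → Val n) where
  carrier := {V | IsTest T V}
  add_mem' := IsTest.add
  zero_mem' := IsTest.zero T
  smul_mem' c _ hV := hV.smul c

/-- The antisymmetric part of a function under the reflection. -/
def antisymm (V : SpaceTime d → Val n) : SpaceTime d → Val n :=
  V + (-1 : ℝ) • fun p => V (refl d p)

lemma IsTest.antisymm {T : ℝ} {V : SpaceTime d → Val n} (hV : IsTest T V) :
    IsTest T (antisymm V) := hV.add (hV.comp_refl.smul _)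

lemma antisymm_boundary (V : SpaceTime d → Val n) (t : ℝ) (y : Tan d) :
    antisymm V (t, 0, y) = 0 := by simp [antisymm]

lemma dirD_add {u v : SpaceTime d → Val n} (hu : Smooth u) (hv : Smooth v) (w : SpaceTime d) :
    dirD w (u + v) = dirD w u + dirD w v := by
  funext p
  unfold dirD
  rw [fderiv_add (hu.diff p) (hv.diff p)]
  rfl

lemma dirD_smul {u : SpaceTime d → Val n} (hu : Smooth u) (c : ℝ) (w : SpaceTime d) :
    dirD w (c • u) = c • dirD w u := by
  funext p
  unfold dirD
  rw [fderiv_const_smul (hu.diff p)]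
  rfl

/-- The odd extension of a function on the half space. -/
def oddExt (u : SpaceTime d → Val n) (p : SpaceTime d) : Val n :=
  if 0 ≤ p.2.1 then u p else - u (refl d p)

lemma locallyIntegrable_oddExt {u : SpaceTime d → Val n} (hu : Continuous u) :
    LocallyIntegrable (oddExt u) volume := by
  have hc : Continuous fun p => ‖u p‖ + ‖u (refl d p)‖ :=
    hu.norm.add (hu.comp (refl d).continuous).norm
  refine hc.locallyIntegrable.mono ?_ (Filter.Eventually.of_forall fun p => ?_)
  · refine StronglyMeasurable.aestronglyMeasurable ?_
    exact StronglyMeasurable.ite (measurableSet_le measurable_const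
      (measurable_fst.comp measurable_snd)) hu.stronglyMeasurable
      (hu.comp (refl d).continuous).neg.stronglyMeasurable
  · unfold oddExt
    rw [Real.norm_of_nonneg (by positivity)]
    split_ifs
    · exact le_add_of_nonneg_right (norm_nonneg _)
    · rw [norm_neg]
      exact le_add_of_nonneg_left (norm_nonneg _)

end HalfSpaceIBVP

namespace HalfSpaceProblem
variable {d n : ℕ}

lemma residual_add (P : HalfSpaceProblem d n) {u v : SpaceTime d → Val n} (hu : Smooth u)
    (hv : Smooth v) : P.residual (u + v) = P.residual u + P.residual v := by
  funext p
  simp only [residual, dirD_add hu hv, dirD_add (hu.dirD _) (hv.dirD _), Pi.add_apply, map_add,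
    Finset.sum_add_distrib]
  abel

lemma residual_smul (P : HalfSpaceProblem d n) {u : SpaceTime d → Val n} (hu : Smooth u) (c : ℝ) :
    P.residual (c • u) = c • P.residual u := by
  funext p
  simp only [residual, dirD_smul hu, dirD_smul (hu.dirD _), Pi.smul_apply, map_smul,
    ← Finset.smul_sum, smul_sub, smul_add]

/-- Here the form of P_0 matters: x_1 enters only through D_1², with no mixed derivative D_1 D_j, so
the two signs cancel. -/
lemma residual_comp_refl (P : HalfSpaceProblem d n) {u : SpaceTime d → Val n} (hu : Smooth u)
    (p : SpaceTime d) : P.residual (fun p => u (refl d p)) p = P.residual u (refl d p) := by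
  have h : ∀ v, dirD v (fun p => u (refl d p)) = fun p => dirD (refl d v) u (refl d p) :=
    fun v => funext fun p => dirD_comp_refl hu v p
  have h1 : dirD d1 (dirD d1 fun p => u (refl d p)) p = dirD d1 (dirD d1 u) (refl d p) := by
    have e : (dirD d1 fun p => u (refl d p)) = (-1 : ℝ) • fun p => dirD d1 u (refl d p) := by
      rw [h, refl_d1]
      funext p
      simp [dirD_neg_dir]
    rw [e, dirD_smul (hu.dirD d1).comp_refl, Pi.smul_apply, dirD_comp_refl (hu.dirD d1), refl_d1,
      dirD_neg_dir]
    simp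
  simp only [residual, h1]
  simp only [h, fun v => dirD_comp_refl (hu.dirD v), refl_dt, refl_dj]

lemma residual_antisymm (P : HalfSpaceProblem d n) {V : SpaceTime d → Val n} (hV : Smooth V)
    (p : SpaceTime d) : P.residual (antisymm V) p = P.residual V p - P.residual V (refl d p) := by
  change P.residual (V + (-1 : ℝ) • fun p => V (refl d p)) p = _
  have hs : Smooth ((-1 : ℝ) • fun p => V (refl d p)) := contDiff_const.smul hV.comp_refl
  rw [P.residual_add hV hs,
    P.residual_smul hV.comp_refl]
  rw [Pi.add_apply, Pi.smul_apply, P.residual_comp_refl hV, neg_one_smul, sub_eq_add_neg]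

end HalfSpaceProblem

/-! ### Duality and the Dirichlet estimate -/

namespace HalfSpaceProblem
variable {d n : ℕ}

lemma cauchy_schwarz_integral {α : Type*} [MeasurableSpace α] {μ : Measure α} {f g : α → ℝ}
    (hf : MemLp f 2 μ) (hg : MemLp g 2 μ) (hf0 : ∀ x, 0 ≤ f x) (hg0 : ∀ x, 0 ≤ g x) :
    ∫ x, f x * g x ∂μ ≤ Real.sqrt (∫ x, f x ^ 2 ∂μ) * Real.sqrt (∫ x, g x ^ 2 ∂μ) := by
  have h := integral_mul_le_Lp_mul_Lq_of_nonneg (μ := μ) Real.HolderConjugate.two_two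
    (Filter.Eventually.of_forall hf0) (Filter.Eventually.of_forall hg0)
    (by simpa using hf) (by simpa using hg)
  simpa [Real.sqrt_eq_rpow] using h

lemma _root_.HasCompactSupport.mul_normSq {f : SpaceTime d → Val n} (h : HasCompactSupport f)
    (w : SpaceTime d → ℝ) : HasCompactSupport fun p => w p * ‖f p‖ ^ 2 :=
  h.mono fun p hp h0 => hp (by simp [h0])

lemma hasCompactSupport_residual_refl (P : HalfSpaceProblem d n) {T : ℝ} {V : SpaceTime d → Val n}
    (hV : IsTest T V) : HasCompactSupport fun p => P.residual V (refl d p) := by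
  have h := P.hasCompactSupport_residual hV.comp_refl
  have e : P.residual (fun p => V (refl d p)) = fun p => P.residual V (refl d p) :=
    funext fun p => P.residual_comp_refl hV.smooth p
  rwa [e] at h

/-- The bound for the boundary functional that is dual to the Dirichlet problem. -/
lemma boundary_functional_bound (P : HalfSpaceProblem d n) :
    ∃ C : ℝ, 0 < C ∧ ∀ (η T : ℝ) (u V : SpaceTime d → Val n), 0 < η → 0 ≤ T → Smooth u →
      Integrable (fun q => Real.exp (-2 * η * q.1) * ‖trace u q‖ ^ 2)
        (volume.restrict (bcyl d T)) → IsTest T V →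
      |∫ q in bcyl d T, trace (fun p => inner ℝ (u p) (actL P.A (dirD d1 (antisymm V) p))) q| ≤
        Real.sqrt (C / η * ∫ q in bcyl d T, Real.exp (-2 * η * q.1) * ‖trace u q‖ ^ 2) *
        Real.sqrt (∫ p in slab d T, Real.exp (2 * η * p.1) * ‖P.residual V p‖ ^ 2) := by
  obtain ⟨C, hC, hreg⟩ := P.hidden_regularity
  refine ⟨2 * C, by positivity, fun η T u V hη hT hu hB hV => ?_⟩
  have hW := hV.antisymm
  set W := antisymm V
  set G := fun p : SpaceTime d => actL P.A (dirD d1 W p) with hG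
  have sG : Smooth G := (hW.smooth.dirD d1).actL P.A
  have suppG : SpaceSupp G := (hW.dirD d1).compact.spaceSupp.comp fun p hp => by simp [hG, hp]
  have hr := hreg η T W hη hT hW (antisymm_boundary V)
  -- the residual of the antisymmetric part
  have hcR := P.hasCompactSupport_residual hV
  have sR := P.smooth_residual hV.smooth
  have iR : IntegrableOn (fun p : SpaceTime d => Real.exp (2 * η * p.1) * ‖P.residual V p‖ ^ 2)
      (slab d T) := by
    exact (Continuous.integrable_of_hasCompactSupport
      ((smooth_exp_mul_time _).continuous.mul (sR.continuous.norm.pow 2))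
      (hcR.mul_normSq _)).integrableOn
  have iR1 := iR.mono_set (cyl_subset_slab T)
  have iR2 : IntegrableOn (fun p : SpaceTime d => Real.exp (2 * η * p.1) *
      ‖P.residual V (refl d p)‖ ^ 2) (cyl d T) := by
    exact (Continuous.integrable_of_hasCompactSupport ((smooth_exp_mul_time _).continuous.mul
      ((sR.continuous.comp (refl d).continuous).norm.pow 2))
      ((P.hasCompactSupport_residual_refl hV).mul_normSq _)).integrableOn
  -- The residual of the odd part is the difference of two reflected copies. The inequality ‖a - b‖²
  -- ≤ 2‖a‖² + 2‖b‖² produces the factor 2, and folding back restores the slab.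
  have hres : ∫ p in cyl d T, Real.exp (2 * η * p.1) * ‖P.residual W p‖ ^ 2 ≤
      2 * ∫ p in slab d T, Real.exp (2 * η * p.1) * ‖P.residual V p‖ ^ 2 := by
    rw [setIntegral_slab iR]
    simp only [refl_apply]
    have e2 : ∫ p in cyl d T, Real.exp (2 * η * p.1) * ‖P.residual V (p.1, -p.2.1, p.2.2)‖ ^ 2 =
      ∫ p in cyl d T, Real.exp (2 * η * p.1) * ‖P.residual V (refl d p)‖ ^ 2 := rfl
    rw [e2, ← integral_add iR1 iR2, ← integral_const_mul]
    refine integral_mono_of_nonneg (Filter.Eventually.of_forall fun p => by positivity)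
      ((iR1.add iR2).const_mul 2) (Filter.Eventually.of_forall fun p => ?_)
    simp only
    rw [P.residual_antisymm hV.smooth, ← mul_add, mul_left_comm]
    refine mul_le_mul_of_nonneg_left ?_ (Real.exp_pos _).le
    have h1 := norm_sub_le (P.residual V p) (P.residual V (refl d p))
    nlinarith [sq_nonneg (‖P.residual V p‖ - ‖P.residual V (refl d p)‖),
      norm_nonneg (P.residual V p - P.residual V (refl d p))]
  -- Cauchy-Schwarz
  set f : ℝ × Tan d → ℝ := fun q => Real.exp (-η * q.1) * ‖trace u q‖ with hf
  set g : ℝ × Tan d → ℝ := fun q => Real.exp (η * q.1) * ‖trace G q‖ with hg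
  have cu : Continuous (trace u) := hu.continuous.comp (by fun_prop)
  have cG : Continuous (trace G) := sG.continuous.comp (by fun_prop)
  have cf : Continuous f := by rw [hf]; fun_prop
  have cg : Continuous g := by rw [hg]; fun_prop
  have f2 : ∀ q, f q ^ 2 = Real.exp (-2 * η * q.1) * ‖trace u q‖ ^ 2 := fun q => by
    simp only [hf]
    rw [mul_pow, ← Real.exp_nat_mul]
    congr 2
    push_cast
    ring
  have g2 : ∀ q, g q ^ 2 = trace (fun p => Real.exp (2 * η * p.1) * ‖G p‖ ^ 2) q := fun q => by
    simp only [hg, trace]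
    rw [mul_pow, ← Real.exp_nat_mul]
    congr 2
    push_cast
    ring
  have mf : MemLp f 2 (volume.restrict (bcyl d T)) :=
    (memLp_two_iff_integrable_sq cf.aestronglyMeasurable).2 (by simpa only [f2] using hB)
  have mg : MemLp g 2 (volume.restrict (bcyl d T)) := by
    refine (memLp_two_iff_integrable_sq cg.aestronglyMeasurable).2 ?_
    simp only [g2]
    exact SpaceSupp.integrableOn_bcyl (suppG.comp fun p hp => by simp [hp])
      ((smooth_exp_mul_time _).continuous.mul (sG.continuous.norm.pow 2)) T
  have hcs := cauchy_schwarz_integral mf mg (fun q => by simp only [hf]; positivity)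
    (fun q => by simp only [hg]; positivity)
  simp only [f2, g2] at hcs
  have hle : |∫ q in bcyl d T, trace (fun p => inner ℝ (u p) (G p)) q| ≤
      ∫ q in bcyl d T, f q * g q := by
    refine abs_integral_le_integral_abs.trans ?_
    refine integral_mono_of_nonneg (Filter.Eventually.of_forall fun q => abs_nonneg _)
      (mf.integrable_mul mg) (Filter.Eventually.of_forall fun q => ?_)
    have e1 : f q * g q = ‖trace u q‖ * ‖trace G q‖ := by
      simp only [hf, hg]
      rw [mul_mul_mul_comm, ← Real.exp_add]
      simp
    simp only [e1]
    exact abs_real_inner_le_norm _ _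
  refine hle.trans (hcs.trans ?_)
  rw [← Real.sqrt_mul (integral_nonneg fun q => by positivity),
    ← Real.sqrt_mul (mul_nonneg (by positivity) (integral_nonneg fun q => by positivity))]
  refine Real.sqrt_le_sqrt ?_
  set B := ∫ q in bcyl d T, Real.exp (-2 * η * q.1) * ‖trace u q‖ ^ 2
  have hB0 : 0 ≤ B := integral_nonneg fun q => by positivity
  calc B * ∫ q in bcyl d T, trace (fun p => Real.exp (2 * η * p.1) * ‖G p‖ ^ 2) q
      ≤ B * (C / η * (2 * ∫ p in slab d T, Real.exp (2 * η * p.1) * ‖P.residual V p‖ ^ 2)) := by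
        refine mul_le_mul_of_nonneg_left (hr.trans ?_) hB0
        gcongr
    _ = _ := by ring

lemma lintegral_normSq_eq_ofReal {H : Type*} [NormedAddCommGroup H] [InnerProductSpace ℝ H]
    {α : Type*} [MeasurableSpace α] {μ : Measure α} (x : Lp H 2 μ) :
    ∫⁻ a, ‖x a‖ₑ ^ 2 ∂μ = ENNReal.ofReal (‖x‖ ^ 2) := by
  have h := eLpNorm_eq_lintegral_rpow_enorm_toReal (μ := μ) (f := x) (p := 2) (by simp) (by simp)
  have hn : ENNReal.ofReal ‖x‖ = eLpNorm x 2 μ := by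
    rw [Lp.norm_def, ENNReal.ofReal_toReal (Lp.eLpNorm_ne_top x)]
  rw [ENNReal.ofReal_pow (norm_nonneg _), hn, h, ← ENNReal.rpow_natCast, ← ENNReal.rpow_mul]
  simp

end HalfSpaceProblem

namespace HalfSpaceProblem
variable {d n : ℕ}

lemma integrable_oddExt_residual (P : HalfSpaceProblem d n) {T : ℝ} {u V : SpaceTime d → Val n}
    (hu : Continuous u) (hV : IsTest T V) :
    Integrable (fun p => inner ℝ (oddExt u p) (P.residual V p)) volume := by
  have hc := P.hasCompactSupport_residual hV
  have hk := (locallyIntegrable_oddExt hu).integrableOn_isCompact hc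
  obtain ⟨M, hM⟩ := hc.exists_bound_of_continuous (P.smooth_residual hV.smooth).continuous
  have h1 : IntegrableOn (fun p => inner ℝ (oddExt u p) (P.residual V p))
      (tsupport (P.residual V)) := by
    refine (hk.norm.mul_const M).mono' ?_ (Filter.Eventually.of_forall fun p => ?_)
    · exact hk.aestronglyMeasurable.inner
        (P.smooth_residual hV.smooth).continuous.aestronglyMeasurable
    · refine (norm_inner_le_norm _ _).trans ?_
      gcongr
      exact hM p
  refine (integrableOn_iff_integrable_of_support_subset fun p hp => ?_).1 h1
  refine subset_tsupport _ fun h0 => hp ?_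
  simp [h0]

/-- Folding the slab along x_1 = 0 replaces V by its antisymmetric part. That part vanishes on Γ, so
Green's formula leaves only the trace of u. -/
lemma integral_oddExt_residual (P : HalfSpaceProblem d n) {T : ℝ} (hT : 0 ≤ T)
    {u V : SpaceTime d → Val n} (hu : Smooth u) (hV : IsTest T V)
    (hres : ∀ p ∈ cyl d T, P.residual u p = 0)
    (hu0 : ∀ x ∈ halfSpace d, u (0, x) = 0) (hu1 : ∀ x ∈ halfSpace d, dirD dt u (0, x) = 0) :
    ∫ p in slab d T, inner ℝ (oddExt u p) (P.residual V p) =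
      ∫ q in bcyl d T, trace (fun p => inner ℝ (u p) (actL P.A (dirD d1 (antisymm V) p))) q := by
  rw [← P.green_formula hT hu hV.antisymm (antisymm_boundary _) hres hu0 hu1,
    setIntegral_slab (P.integrable_oddExt_residual hu.continuous hV).integrableOn]
  have e1 : ∫ p in cyl d T, inner ℝ (oddExt u p) (P.residual V p) =
      ∫ p in cyl d T, inner ℝ (u p) (P.residual V p) :=
    setIntegral_congr_fun (measurableSet_cyl T) fun p hp => by
      have : 0 ≤ p.2.1 := hp.2.1
      simp [oddExt, this]
  have e2 : ∫ p in cyl d T, inner ℝ (oddExt u (refl d p)) (P.residual V (refl d p)) =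
      ∫ p in cyl d T, - inner ℝ (u p) (P.residual V (refl d p)) := by
    rw [← setIntegral_congr_set (cyl_ae_eq_open T), ← setIntegral_congr_set (cyl_ae_eq_open T)]
    refine setIntegral_congr_fun
      (measurableSet_Icc.prod (measurableSet_Ioi.prod MeasurableSet.univ)) fun p hp => ?_
    have : ¬ p.2.1 ≤ 0 := not_le.2 hp.2.1
    simp [oddExt, this]
  have i1 : IntegrableOn (fun p => inner ℝ (u p) (P.residual V p)) (cyl d T) :=
    SpaceSupp.integrableOn_cyl ((P.hasCompactSupport_residual hV).spaceSupp.comp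
      fun p hp => by simp [hp]) (hu.inner (P.smooth_residual hV.smooth)).continuous T
  have i2 : IntegrableOn (fun p => - inner ℝ (u p) (P.residual V (refl d p))) (cyl d T) :=
    SpaceSupp.integrableOn_cyl ((P.hasCompactSupport_residual_refl hV).spaceSupp.comp
      fun p hp => by rw [Pi.neg_apply, hp, inner_zero_right, neg_zero])
      (hu.inner (P.smooth_residual hV.smooth).comp_refl).continuous.neg T
  rw [e1, e2, ← integral_add i1 i2]
  refine integral_congr_ae (Filter.Eventually.of_forall fun p => ?_)
  simp only
  rw [P.residual_antisymm hV.smooth, inner_sub_right, sub_eq_add_neg]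

/-- The exponentially weighted residual. -/
def weightedResidual (P : HalfSpaceProblem d n) (η : ℝ) (V : SpaceTime d → Val n)
    (p : SpaceTime d) : Val n := Real.exp (η * p.1) • P.residual V p

lemma memLp_weightedResidual (P : HalfSpaceProblem d n) (η : ℝ) {T : ℝ} {V : SpaceTime d → Val n}
    (hV : IsTest T V) : MemLp (P.weightedResidual η V) 2 (volume.restrict (slab d T)) := by
  have hc : Continuous (P.weightedResidual η V) :=
    (smooth_exp_mul_time η).continuous.smul (P.smooth_residual hV.smooth).continuous
  have hs : HasCompactSupport (P.weightedResidual η V) :=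
    (P.hasCompactSupport_residual hV).mono fun p hp h0 => hp (by simp [weightedResidual, h0])
  exact (hc.memLp_of_hasCompactSupport hs).restrict _

/-- The weighted residual as a linear map into `L²`. -/
def residualLp (P : HalfSpaceProblem d n) (η T : ℝ) :
    testSpace d n T →ₗ[ℝ] Lp (Val n) 2 (volume.restrict (slab d T)) where
  toFun V := (P.memLp_weightedResidual η V.2).toLp _
  map_add' V W := by
    rw [← MemLp.toLp_add (P.memLp_weightedResidual η V.2) (P.memLp_weightedResidual η W.2)]
    refine MemLp.toLp_congr _ _ (Filter.Eventually.of_forall fun p => ?_)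
    rw [Submodule.coe_add]
    simp only [weightedResidual, P.residual_add V.2.smooth W.2.smooth, Pi.add_apply, smul_add]
  map_smul' c V := by
    rw [RingHom.id_apply, ← MemLp.toLp_const_smul c (P.memLp_weightedResidual η V.2)]
    refine MemLp.toLp_congr _ _ (Filter.Eventually.of_forall fun p => ?_)
    rw [Submodule.coe_smul]
    simp only [weightedResidual, P.residual_smul V.2.smooth, Pi.smul_apply]
    rw [smul_comm]

lemma residualLp_ae (P : HalfSpaceProblem d n) (η : ℝ) {T : ℝ} (V : testSpace d n T) :
    P.residualLp η T V =ᵐ[volume.restrict (slab d T)] P.weightedResidual η V :=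
  MemLp.coeFn_toLp (P.memLp_weightedResidual η V.2)

lemma norm_residualLp (P : HalfSpaceProblem d n) (η : ℝ) {T : ℝ} (V : testSpace d n T) :
    ‖P.residualLp η T V‖ =
      Real.sqrt (∫ p in slab d T, Real.exp (2 * η * p.1) * ‖P.residual V p‖ ^ 2) := by
  rw [eq_comm, Real.sqrt_eq_iff_mul_self_eq (integral_nonneg fun p => by positivity)
    (norm_nonneg _), ← real_inner_self_eq_norm_mul_norm, L2.inner_def]
  refine integral_congr_ae ?_
  filter_upwards [P.residualLp_ae η V] with p hp
  rw [hp, real_inner_self_eq_norm_sq]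
  simp only [weightedResidual, norm_smul, Real.norm_eq_abs, Real.abs_exp, mul_pow]
  rw [← Real.exp_nat_mul]
  congr 2
  push_cast
  ring

/-- The functional `V ↦ ∫ ⟨u°, V_tt - P_0 V⟩`. -/
def oddFunctional (P : HalfSpaceProblem d n) (T : ℝ) {u : SpaceTime d → Val n}
    (hu : Continuous u) : testSpace d n T →ₗ[ℝ] ℝ where
  toFun V := ∫ p in slab d T, inner ℝ (oddExt u p) (P.residual V p)
  map_add' V W := by
    rw [← integral_add (P.integrable_oddExt_residual hu V.2).integrableOn
      (P.integrable_oddExt_residual hu W.2).integrableOn]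
    simp only [Submodule.coe_add, P.residual_add V.2.smooth W.2.smooth, Pi.add_apply,
      inner_add_right]
  map_smul' c V := by
    rw [RingHom.id_apply, smul_eq_mul, ← integral_const_mul]
    simp only [Submodule.coe_smul, P.residual_smul V.2.smooth, Pi.smul_apply, inner_smul_right]

/-- A representative of the functional is the weighted odd extension. -/
lemma ae_eq_of_representative (P : HalfSpaceProblem d n) {η T : ℝ} {u : SpaceTime d → Val n}
    (hη : 0 < η) (hu : Continuous u) (x : Lp (Val n) 2 (volume.restrict (slab d T)))
    (hx : ∀ V, P.oddFunctional T hu V = inner ℝ x (P.residualLp η T V)) :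
    ∀ᵐ p : SpaceTime d, p.1 < T → p ∈ slab d T → Real.exp (η * p.1) • x p = oddExt u p := by
  set y : SpaceTime d → Val n := (slab d T).indicator fun p => Real.exp (η * p.1) • x p with hy
  have hzo : LocallyIntegrable (oddExt u) volume := locallyIntegrable_oddExt hu
  have hxm : MemLp x 2 (volume.restrict (slab d T)) := Lp.memLp x
  have hym : MemLp (fun p : SpaceTime d => Real.exp (η * p.1) • x p) 2
      (volume.restrict (slab d T)) := by
    refine MemLp.of_le_mul (c := Real.exp (η * T)) hxm ?_ ?_
    · exact (smooth_exp_mul_time η).continuous.aestronglyMeasurable.smul hxm.1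
    · filter_upwards [ae_restrict_mem (measurableSet_slab T)] with p hp
      rw [norm_smul, Real.norm_eq_abs, Real.abs_exp]
      gcongr
      exact hp.1.2
  have hyl : LocallyIntegrable y volume :=
    ((memLp_indicator_iff_restrict (measurableSet_slab T)).2 hym).locallyIntegrable (by norm_num)
  -- Both terms represent the same functional, so their difference is orthogonal to R(V) for every
  -- test function V. It also vanishes for t < 0, and `weak_unique` applies.
  have hzl : LocallyIntegrable (y - (slab d T).indicator (oddExt u)) volume :=
    hyl.sub (hzo.indicator (measurableSet_slab T))
  have hinit : ∀ p : SpaceTime d, p.1 < 0 → (y - (slab d T).indicator (oddExt u)) p = 0 := by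
    intro p hp
    have : p ∉ slab d T := fun h => absurd h.1.1 (not_le.2 hp)
    simp [hy, this]
  have hweak : ∀ V, IsTest T V →
      ∫ p, inner ℝ ((y - (slab d T).indicator (oddExt u)) p) (P.residual V p) = 0 := by
    intro V hV
    have e : ∀ p, inner ℝ (y p) (P.residual V p) =
        (slab d T).indicator (fun p => inner ℝ (x p) (P.weightedResidual η V p)) p := by
      intro p
      by_cases hp : p ∈ slab d T
      · simp only [hy, indicator_of_mem hp, weightedResidual, inner_smul_left, inner_smul_right,
          RCLike.conj_to_real]
      · simp only [hy, indicator_of_notMem hp, inner_zero_left]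
    have e' : ∀ p, inner ℝ ((slab d T).indicator (oddExt u) p) (P.residual V p) =
        (slab d T).indicator (fun p => inner ℝ (oddExt u p) (P.residual V p)) p := by
      intro p
      by_cases hp : p ∈ slab d T
      · simp only [indicator_of_mem hp]
      · simp only [indicator_of_notMem hp, inner_zero_left]
    have i3 : IntegrableOn (fun p => inner ℝ (x p) (P.weightedResidual η V p)) (slab d T) := by
      refine (L2.integrable_inner (𝕜 := ℝ) x (P.residualLp η T ⟨V, hV⟩)).congr ?_
      filter_upwards [P.residualLp_ae η ⟨V, hV⟩] with p hp
      rw [hp]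
    have h1 : P.oddFunctional T hu ⟨V, hV⟩ =
        ∫ p in slab d T, inner ℝ (x p) (P.weightedResidual η V p) := by
      rw [hx, L2.inner_def]
      refine integral_congr_ae ?_
      filter_upwards [P.residualLp_ae η ⟨V, hV⟩] with p hp
      rw [hp]
    simp only [Pi.sub_apply, inner_sub_left, e, e']
    rw [integral_sub (i3.integrable_indicator (measurableSet_slab T))
      ((P.integrable_oddExt_residual hu hV).indicator (measurableSet_slab T)),
      integral_indicator (measurableSet_slab T), integral_indicator (measurableSet_slab T), ← h1]
    exact sub_self _
  filter_upwards [P.weak_unique hzl hinit hweak] with p hp hpT hps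
  have h := hp hpT
  simp only [Pi.sub_apply, hy, indicator_of_mem hps] at h
  exact sub_eq_zero.1 h

/-- The Dirichlet problem: the solution is controlled by its boundary values. -/
lemma dirichlet_estimate_of_integrable (P : HalfSpaceProblem d n) :
    ∃ C : ℝ, 0 < C ∧ ∀ (η T : ℝ) (u : SpaceTime d → Val n), 0 < η → 0 ≤ T → Smooth u →
      (∀ p ∈ cyl d T, P.residual u p = 0) → (∀ x ∈ halfSpace d, u (0, x) = 0) →
      (∀ x ∈ halfSpace d, dirD dt u (0, x) = 0) →
      Integrable (fun q => Real.exp (-2 * η * q.1) * ‖trace u q‖ ^ 2)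
        (volume.restrict (bcyl d T)) →
      ∫⁻ p in cyl d T, ENNReal.ofReal (Real.exp (-2 * η * p.1)) * ‖u p‖ₑ ^ 2 ≤
        ENNReal.ofReal
          (C / η * ∫ q in bcyl d T, Real.exp (-2 * η * q.1) * ‖trace u q‖ ^ 2) := by
  obtain ⟨C, hC, hbound⟩ := P.boundary_functional_bound
  refine ⟨C, hC, fun η T u hη hT hu hres hu0 hu1 hB => ?_⟩
  set B := ∫ q in bcyl d T, Real.exp (-2 * η * q.1) * ‖trace u q‖ ^ 2 with hBdef
  have hB0 : 0 ≤ B := integral_nonneg fun q => by positivity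
  obtain ⟨x, hxM, hxl⟩ := exists_representative (P.residualLp η T)
    (P.oddFunctional T hu.continuous) (Real.sqrt_nonneg (C / η * B)) fun V => by
      rw [norm_residualLp]
      change |∫ p in slab d T, inner ℝ (oddExt u p) (P.residual V p)| ≤ _
      rw [P.integral_oddExt_residual hT hu V.2 hres hu0 hu1]
      exact hbound η T u V hη hT hu hB V.2
  have hrep := P.ae_eq_of_representative hη hu.continuous x hxl
  -- The identification of x holds only for t < T; the final slice is null.
  have hae : (Ico (0 : ℝ) T ×ˢ halfSpace d : Set (SpaceTime d)) =ᵐ[volume] cyl d T :=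
    Measure.set_prod_ae_eq Ico_ae_eq_Icc (ae_eq_refl _)
  calc ∫⁻ p in cyl d T, ENNReal.ofReal (Real.exp (-2 * η * p.1)) * ‖u p‖ₑ ^ 2
      = ∫⁻ p in cyl d T, ‖x p‖ₑ ^ 2 := by
        rw [← setLIntegral_congr hae, ← setLIntegral_congr hae]
        refine setLIntegral_congr_fun_ae (measurableSet_Ico.prod measurableSet_halfSpace) ?_
        filter_upwards [hrep] with p hp hpm
        have h2 : p ∈ slab d T := ⟨Ico_subset_Icc_self hpm.1, mem_univ _⟩
        have h3 : 0 ≤ p.2.1 := hpm.2.1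
        have h1 := hp hpm.1.2 h2
        simp only [oddExt, h3, if_true] at h1
        rw [← h1, enorm_smul, mul_pow, ← mul_assoc,
          Real.enorm_eq_ofReal (Real.exp_pos _).le, ← ENNReal.ofReal_pow (Real.exp_pos _).le,
          ← ENNReal.ofReal_mul (Real.exp_pos _).le, ← Real.exp_nat_mul, ← Real.exp_add]
        have : -2 * η * p.1 + (2 : ℕ) * (η * p.1) = 0 := by push_cast; ring
        rw [this]
        simp
    _ ≤ ∫⁻ p in slab d T, ‖x p‖ₑ ^ 2 := lintegral_mono_set (cyl_subset_slab T)
    _ = ENNReal.ofReal (‖x‖ ^ 2) := lintegral_normSq_eq_ofReal x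
    _ ≤ ENNReal.ofReal (C / η * B) := by
        refine ENNReal.ofReal_le_ofReal ?_
        have := pow_le_pow_left₀ (norm_nonneg x) hxM 2
        rwa [Real.sq_sqrt (by positivity)] at this

end HalfSpaceProblem

/-! ### Weighted time integrals and the Hardy inequality -/

namespace HalfSpaceIBVP
variable {d n : ℕ}

/-- The exponential weight as an extended nonnegative number. -/
def ew (η t : ℝ) : ℝ≥0∞ := ENNReal.ofReal (Real.exp (-2 * η * t))

lemma continuous_ew (η : ℝ) : Continuous (ew η) :=
  ENNReal.continuous_ofReal.comp (by fun_prop)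

lemma measurable_sqNorm {α : Type*} [TopologicalSpace α] [MeasurableSpace α]
    [OpensMeasurableSpace α]
    {w : α → Val n} (hw : Continuous w) : Measurable fun p => ‖w p‖ₑ ^ 2 :=
  hw.enorm.measurable.pow_const 2

lemma lintegral_cylinder {E : Type*} [MeasureSpace E] [SFinite (volume : Measure E)] (T : ℝ)
    (S : Set E) {f : ℝ × E → ℝ≥0∞} (hf : Measurable f) :
    ∫⁻ p in Icc (0 : ℝ) T ×ˢ S, f p = ∫⁻ t in Icc (0 : ℝ) T, ∫⁻ x in S, f (t, x) := by
  rw [Measure.volume_eq_prod, ← Measure.prod_restrict, lintegral_prod _ hf.aemeasurable]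

lemma lintegral_cylinder_symm {E : Type*} [MeasureSpace E] [SFinite (volume : Measure E)] (T : ℝ)
    (S : Set E) {f : ℝ × E → ℝ≥0∞} (hf : Measurable f) :
    ∫⁻ p in Icc (0 : ℝ) T ×ˢ S, f p = ∫⁻ x in S, ∫⁻ t in Icc (0 : ℝ) T, f (t, x) := by
  rw [Measure.volume_eq_prod, ← Measure.prod_restrict, lintegral_prod_symm _ hf.aemeasurable]

lemma wInt_eq_lintegral {E : Type*} [MeasureSpace E] [SFinite (volume : Measure E)] (η T : ℝ)
    (S : Set E) {f : ℝ × E → ℝ≥0∞} (hf : Measurable f) :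
    wInt η T (fun t => ∫⁻ x in S, f (t, x)) = ∫⁻ p in Icc (0 : ℝ) T ×ˢ S, ew η p.1 * f p := by
  have hm : Measurable fun p : ℝ × E => ew η p.1 * f p :=
    ((continuous_ew η).measurable.comp measurable_fst).mul hf
  rw [lintegral_cylinder T S hm]
  refine lintegral_congr fun t => ?_
  exact (lintegral_const_mul _ (hf.comp measurable_prodMk_left)).symm

lemma wInt_sqNormInt (η T : ℝ) {w : SpaceTime d → Val n} (hw : Continuous w) :
    wInt η T (sqNormInt w) = ∫⁻ p in cyl d T, ew η p.1 * ‖w p‖ₑ ^ 2 :=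
  wInt_eq_lintegral η T (halfSpace d) (measurable_sqNorm hw)

lemma wInt_sqNormDatum (η T : ℝ) {g : ℝ × Tan d → Val n} (hg : Continuous g) :
    wInt η T (sqNormDatum g) = ∫⁻ q in bcyl d T, ew η q.1 * ‖g q‖ₑ ^ 2 := by
  rw [bcyl, ← wInt_eq_lintegral η T univ (measurable_sqNorm hg)]
  simp only [Measure.restrict_univ]
  rfl

lemma continuous_trace {w : SpaceTime d → Val n} (hw : Continuous w) : Continuous (trace w) :=
  hw.comp (by fun_prop)

lemma sqNormBdry_eq (w : SpaceTime d → Val n) : sqNormBdry w = sqNormDatum (trace w) := rfl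

lemma wInt_sqNormBdry (η T : ℝ) {w : SpaceTime d → Val n} (hw : Continuous w) :
    wInt η T (sqNormBdry w) = ∫⁻ q in bcyl d T, ew η q.1 * ‖trace w q‖ₑ ^ 2 := by
  rw [sqNormBdry_eq, wInt_sqNormDatum η T (continuous_trace hw)]

lemma measurable_sqNormInt {w : SpaceTime d → Val n} (hw : Continuous w) :
    Measurable (sqNormInt w) :=
  (measurable_sqNorm hw).lintegral_prod_right'

lemma measurable_sqNormBdry {w : SpaceTime d → Val n} (hw : Continuous w) :
    Measurable (sqNormBdry w) :=
  (measurable_sqNorm (continuous_trace hw)).lintegral_prod_right'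

lemma wInt_add (η T : ℝ) {M : ℝ → ℝ≥0∞} (hM : Measurable M) (N : ℝ → ℝ≥0∞) :
    wInt η T (fun t => M t + N t) = wInt η T M + wInt η T N := by
  simp only [wInt, mul_add]
  exact lintegral_add_left ((continuous_ew η).measurable.mul hM) _

lemma wInt_sum (η T : ℝ) {M : Fin d → ℝ → ℝ≥0∞} (hM : ∀ j, Measurable (M j)) :
    wInt η T (fun t => ∑ j, M j t) = ∑ j, wInt η T (M j) := by
  simp only [wInt, Finset.mul_sum]
  exact lintegral_finsetSum _ fun j _ => (continuous_ew η).measurable.mul (hM j)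

lemma wInt_mono (η T : ℝ) {M N : ℝ → ℝ≥0∞} (h : ∀ t, M t ≤ N t) : wInt η T M ≤ wInt η T N :=
  lintegral_mono fun t => mul_le_mul_right (h t) _

lemma ofReal_normSq {E : Type*} [NormedAddCommGroup E] (x : E) :
    ENNReal.ofReal (‖x‖ ^ 2) = ‖x‖ₑ ^ 2 := by
  rw [ENNReal.ofReal_pow (norm_nonneg _), ofReal_norm]

/-- A weighted function with vanishing initial value is controlled by its derivative. -/
lemma hardy_real {f f' : ℝ → Val n} (hf : ∀ t, HasDerivAt f (f' t) t) (hf' : Continuous f')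
    (h0 : f 0 = 0) (η : ℝ) (hη : 0 < η) {T : ℝ} (hT : 0 ≤ T) :
    η ^ 2 * ∫ t in (0 : ℝ)..T, Real.exp (-2 * η * t) * ‖f t‖ ^ 2 ≤
      ∫ t in (0 : ℝ)..T, Real.exp (-2 * η * t) * ‖f' t‖ ^ 2 := by
  have hc : Continuous f := continuous_iff_continuousAt.2 fun t => (hf t).continuousAt
  have hd : ∀ t, HasDerivAt (fun t => Real.exp (-2 * η * t) * ‖f t‖ ^ 2)
      (Real.exp (-2 * η * t) * (-2 * η) * ‖f t‖ ^ 2 +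
        Real.exp (-2 * η * t) * (2 * inner ℝ (f t) (f' t))) t := by
    intro t
    have h1 : HasDerivAt (fun t => Real.exp (-2 * η * t)) (Real.exp (-2 * η * t) * (-2 * η)) t := by
      simpa using ((hasDerivAt_id t).const_mul (-2 * η)).exp
    exact h1.mul (hf t).norm_sq
  have hint := intervalIntegral.integral_eq_sub_of_hasDerivAt (a := 0) (b := T)
    (fun t _ => hd t) ((by fun_prop : Continuous _).intervalIntegrable _ _)
  -- η times the derivative of e^{-2ηt}‖f‖², plus η² times this function, is pointwise at most
  -- e^{-2ηt}‖f'‖² by completing the square. The derivative integrates to a nonnegative end value,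
  -- since f(0) = 0.
  have hle : ∫ t in (0 : ℝ)..T, (η * (Real.exp (-2 * η * t) * (-2 * η) * ‖f t‖ ^ 2 +
        Real.exp (-2 * η * t) * (2 * inner ℝ (f t) (f' t))) +
        η ^ 2 * (Real.exp (-2 * η * t) * ‖f t‖ ^ 2)) ≤
      ∫ t in (0 : ℝ)..T, Real.exp (-2 * η * t) * ‖f' t‖ ^ 2 := by
    refine intervalIntegral.integral_mono hT ((by fun_prop : Continuous _).intervalIntegrable _ _)
      ((by fun_prop : Continuous _).intervalIntegrable _ _) fun t => ?_
    have h1 := real_inner_le_norm (f t) (f' t)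
    have h2 : 2 * η * inner ℝ (f t) (f' t) - η ^ 2 * ‖f t‖ ^ 2 ≤ ‖f' t‖ ^ 2 := by
      nlinarith [sq_nonneg (‖f' t‖ - η * ‖f t‖)]
    have h3 := mul_le_mul_of_nonneg_left h2 (Real.exp_pos (-2 * η * t)).le
    simp only
    linarith
  rw [intervalIntegral.integral_add ((by fun_prop : Continuous _).intervalIntegrable _ _)
    ((by fun_prop : Continuous _).intervalIntegrable _ _), intervalIntegral.integral_const_mul,
    intervalIntegral.integral_const_mul, hint, h0] at hle
  have h4 : 0 ≤ η * (Real.exp (-2 * η * T) * ‖f T‖ ^ 2) := by positivity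
  simp only [norm_zero] at hle
  linarith

lemma lintegral_Icc_ew (η : ℝ) {T : ℝ} (hT : 0 ≤ T) {f : ℝ → Val n} (hf : Continuous f) :
    ∫⁻ t in Icc (0 : ℝ) T, ew η t * ‖f t‖ₑ ^ 2 =
      ENNReal.ofReal (∫ t in (0 : ℝ)..T, Real.exp (-2 * η * t) * ‖f t‖ ^ 2) := by
  have hc : Continuous fun t => Real.exp (-2 * η * t) * ‖f t‖ ^ 2 := by fun_prop
  rw [intervalIntegral.integral_of_le hT, ← integral_Icc_eq_integral_Ioc,
    ofReal_integral_eq_lintegral_ofReal hc.continuousOn.integrableOn_Icc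
      (Filter.Eventually.of_forall fun t => by positivity)]
  refine lintegral_congr fun t => ?_
  rw [ENNReal.ofReal_mul (Real.exp_pos _).le, ofReal_normSq]
  rfl

lemma hardy {f f' : ℝ → Val n} (hf : ∀ t, HasDerivAt f (f' t) t) (hf' : Continuous f')
    (h0 : f 0 = 0) {η : ℝ} (hη : 0 < η) {T : ℝ} (hT : 0 ≤ T) :
    ENNReal.ofReal (η ^ 2) * ∫⁻ t in Icc (0 : ℝ) T, ew η t * ‖f t‖ₑ ^ 2 ≤
      ∫⁻ t in Icc (0 : ℝ) T, ew η t * ‖f' t‖ₑ ^ 2 := by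
  have hc : Continuous f := continuous_iff_continuousAt.2 fun t => (hf t).continuousAt
  rw [lintegral_Icc_ew η hT hc, lintegral_Icc_ew η hT hf', ← ENNReal.ofReal_mul (by positivity)]
  exact ENNReal.ofReal_le_ofReal (hardy_real hf hf' h0 η hη hT)

lemma measurable_ew_mul {E : Type*} [TopologicalSpace E] [MeasurableSpace E]
    [OpensMeasurableSpace (ℝ × E)] (η : ℝ) {w : ℝ × E → Val n}
    (hw : Continuous w) : Measurable fun p : ℝ × E => ew η p.1 * ‖w p‖ₑ ^ 2 :=
  ((continuous_ew η).measurable.comp measurable_fst).mul (measurable_sqNorm hw)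

lemma hardy_int {u : SpaceTime d → Val n} (hu : Smooth u) (h0 : ∀ x ∈ halfSpace d, u (0, x) = 0)
    {η : ℝ} (hη : 0 < η) {T : ℝ} (hT : 0 ≤ T) :
    ENNReal.ofReal (η ^ 2) * wInt η T (sqNormInt u) ≤ wInt η T (sqNormInt (Dt u)) := by
  have hDt : Continuous (Dt u) := (hu.dirD dt).continuous
  rw [wInt_sqNormInt η T hu.continuous, wInt_sqNormInt η T hDt, cyl,
    lintegral_cylinder_symm T _ (measurable_ew_mul η hu.continuous),
    lintegral_cylinder_symm T _ (measurable_ew_mul η hDt),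
    ← lintegral_const_mul' _ _ ENNReal.ofReal_ne_top]
  refine setLIntegral_mono' measurableSet_halfSpace fun x hx => ?_
  exact hardy (fun t => hasDerivAt_time_val hu t x) (hDt.comp (by fun_prop)) (h0 x hx) hη hT

lemma hardy_bdry {u : SpaceTime d → Val n} (hu : Smooth u)
    (h0 : ∀ x ∈ halfSpace d, u (0, x) = 0) {η : ℝ} (hη : 0 < η) {T : ℝ} (hT : 0 ≤ T) :
    ENNReal.ofReal (η ^ 2) * wInt η T (sqNormBdry u) ≤ wInt η T (sqNormBdry (Dt u)) := by
  have hDt : Continuous (Dt u) := (hu.dirD dt).continuous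
  rw [wInt_sqNormBdry η T hu.continuous, wInt_sqNormBdry η T hDt, bcyl,
    lintegral_cylinder_symm T _ (measurable_ew_mul η (continuous_trace hu.continuous)),
    lintegral_cylinder_symm T _ (measurable_ew_mul η (continuous_trace hDt)),
    ← lintegral_const_mul' _ _ ENNReal.ofReal_ne_top]
  refine lintegral_mono fun y => ?_
  exact hardy (fun t => hasDerivAt_time_val hu t (0, y)) (hDt.comp (by fun_prop))
    (h0 (0, y) ⟨le_refl (0 : ℝ), mem_univ _⟩) hη hT

end HalfSpaceIBVP

/-! ### Interior estimate from boundary stability -/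

namespace HalfSpaceProblem
variable {d n : ℕ}

lemma IsSolution.residual_eq_zero {P : HalfSpaceProblem d n} {g : ℝ × Tan d → Val n}
    {u : SpaceTime d → Val n} (h : P.IsSolution 0 g u) {T : ℝ} (p : SpaceTime d)
    (hp : p ∈ cyl d T) : P.residual u p = 0 := by
  have := h.equation p.1 p.2.1 p.2.2 hp.1.1 hp.2.1
  simp only [Pi.zero_apply, add_zero] at this
  exact sub_eq_zero.2 this

lemma IsSolution.initial_eq_zero {P : HalfSpaceProblem d n} {F : SpaceTime d → Val n}
    {g : ℝ × Tan d → Val n} {u : SpaceTime d → Val n} (h : P.IsSolution F g u) (x : ℝ × Tan d)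
    (hx : x ∈ halfSpace d) : u (0, x) = 0 := h.initial x.1 x.2 hx.1

/-- The Dirichlet estimate in the norms of the problem. -/
lemma dirichlet_estimate (P : HalfSpaceProblem d n) :
    ∃ C : ℝ, 0 < C ∧ ∀ (g : ℝ × Tan d → Val n) (u : SpaceTime d → Val n) (η T : ℝ), 0 < η →
      0 ≤ T → P.IsSolution 0 g u →
      wInt η T (sqNormInt u) ≤ ENNReal.ofReal (C / η) * wInt η T (sqNormBdry u) := by
  obtain ⟨C, hC, h⟩ := P.dirichlet_estimate_of_integrable
  refine ⟨C, hC, fun g u η T hη hT hs => ?_⟩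
  have hu : Smooth u := hs.smooth
  have hCη : 0 < C / η := by positivity
  have hpt : ∀ q : ℝ × Tan d, ew η q.1 * ‖trace u q‖ₑ ^ 2 =
      ENNReal.ofReal (Real.exp (-2 * η * q.1) * ‖trace u q‖ ^ 2) := fun q => by
    rw [ENNReal.ofReal_mul (Real.exp_pos _).le, ofReal_normSq]; rfl
  rw [wInt_sqNormInt η T hu.continuous, wInt_sqNormBdry η T hu.continuous]
  -- An infinite boundary norm makes the bound trivial; a finite one gives the integrability that
  -- duality needs.
  by_cases htop : ∫⁻ q in bcyl d T, ew η q.1 * ‖trace u q‖ₑ ^ 2 = ⊤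
  · rw [htop, ENNReal.mul_top (by simpa using hCη)]
    exact le_top
  have hc : Continuous fun q : ℝ × Tan d => Real.exp (-2 * η * q.1) * ‖trace u q‖ ^ 2 := by
    have := continuous_trace hu.continuous
    fun_prop
  have hB : Integrable (fun q => Real.exp (-2 * η * q.1) * ‖trace u q‖ ^ 2)
      (volume.restrict (bcyl d T)) := by
    refine (lintegral_ofReal_ne_top_iff_integrable hc.aestronglyMeasurable
      (Filter.Eventually.of_forall fun q => by positivity)).1 ?_
    simpa only [hpt] using htop
  refine (h η T u hη hT hu (fun p hp => hs.residual_eq_zero p hp) hs.initial_eq_zero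
    (fun x hx => hs.initial_velocity x.1 x.2 hx.1) hB).trans (le_of_eq ?_)
  rw [ENNReal.ofReal_mul hCη.le, ofReal_integral_eq_lintegral_ofReal hB
    (Filter.Eventually.of_forall fun q => by positivity)]
  simp only [hpt]

/-- The factor C/η of the Dirichlet estimate is the extra power of η. -/
theorem interiorEstimate_of_boundaryStableWith (P : HalfSpaceProblem d n) {α : ℝ}
    (h : P.BoundaryStableWith α) : P.InteriorEstimate (α + 1) := by
  obtain ⟨η₀, K, hη₀, hK, h⟩ := h
  obtain ⟨C, hC, hD⟩ := P.dirichlet_estimate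
  refine ⟨η₀, C * K, hη₀, by positivity, fun g u hg hu η T hη hT => ?_⟩
  have hη0 : 0 < η := hη₀.trans_le hη
  refine (hD g u η T hη0 hT hu).trans ?_
  refine (mul_le_mul_right (h g u hg hu η T hη hT) _).trans (le_of_eq ?_)
  rw [← mul_assoc, ← ENNReal.ofReal_mul (by positivity), Real.rpow_add hη0, Real.rpow_one]
  congr 2
  have := Real.rpow_pos_of_pos hη0 α
  field_simp

end HalfSpaceProblem

/-! ### Dilations and the failure of boundary stability -/

namespace HalfSpaceIBVP
variable {d n : ℕ}

/-- The factor by which a dilation changes the Lebesgue measure. -/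
def dilFactor (E : Type*) [AddCommGroup E] [Module ℝ E] (r : ℝ) : ℝ≥0∞ :=
  ENNReal.ofReal |(r ^ Module.finrank ℝ E)⁻¹|

lemma dilFactor_ne_top (E : Type*) [AddCommGroup E] [Module ℝ E] (r : ℝ) : dilFactor E r ≠ ⊤ :=
  ENNReal.ofReal_ne_top

lemma dilFactor_ne_zero (E : Type*) [AddCommGroup E] [Module ℝ E] {r : ℝ} (hr : 0 < r) :
    dilFactor E r ≠ 0 := by
  have : 0 < |(r ^ Module.finrank ℝ E)⁻¹| := abs_pos.2 (by positivity)
  simpa [dilFactor] using this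

lemma lintegral_dilate {E : Type*} [NormedAddCommGroup E] [NormedSpace ℝ E] [FiniteDimensional ℝ E]
    [MeasurableSpace E] [BorelSpace E] (μ : Measure E) [μ.IsAddHaarMeasure] {r : ℝ} (hr : 0 < r)
    (f : E → ℝ≥0∞) : ∫⁻ x, f (r • x) ∂μ = dilFactor E r * ∫⁻ x, f x ∂μ := by
  have h := (Homeomorph.smulOfNeZero r hr.ne').measurableEmbedding.lintegral_map (μ := μ) f
  have e : ⇑(Homeomorph.smulOfNeZero r hr.ne' : E ≃ₜ E) = fun x => r • x := rfl
  rw [e, Measure.map_addHaar_smul μ hr.ne', lintegral_smul_measure] at h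
  exact h.symm

lemma setLIntegral_dilate {E : Type*} [NormedAddCommGroup E] [NormedSpace ℝ E]
    [FiniteDimensional ℝ E] [MeasurableSpace E] [BorelSpace E] (μ : Measure E)
    [μ.IsAddHaarMeasure] {r : ℝ} (hr : 0 < r) {S S' : Set E} (hS : MeasurableSet S)
    (hS' : MeasurableSet S') (h : ∀ x, r • x ∈ S' ↔ x ∈ S) (f : E → ℝ≥0∞) :
    ∫⁻ x in S, f (r • x) ∂μ = dilFactor E r * ∫⁻ x in S', f x ∂μ := by
  rw [← lintegral_indicator hS, ← lintegral_indicator hS', ← lintegral_dilate μ hr]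
  refine lintegral_congr fun x => ?_
  by_cases hx : x ∈ S
  · rw [indicator_of_mem hx, indicator_of_mem ((h x).2 hx)]
  · rw [indicator_of_notMem hx, indicator_of_notMem fun h' => hx ((h x).1 h')]

/-- The dilation of a function. -/
def dilate {E F : Type*} [SMul ℝ E] (r : ℝ) (u : E → F) : E → F := fun p => u (r • p)

lemma sqNormInt_dilate {r : ℝ} (hr : 0 < r) (u : SpaceTime d → Val n) (t : ℝ) :
    sqNormInt (dilate r u) t = dilFactor (ℝ × Tan d) r * sqNormInt u (r * t) :=
  setLIntegral_dilate volume hr measurableSet_halfSpace measurableSet_halfSpace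
    (fun x => by simp [halfSpace, hr]) fun x => ‖u (r * t, x)‖ₑ ^ 2

lemma sqNormBdry_dilate {r : ℝ} (hr : 0 < r) (u : SpaceTime d → Val n) (t : ℝ) :
    sqNormBdry (dilate r u) t = dilFactor (Tan d) r * sqNormBdry u (r * t) := by
  have := lintegral_dilate (volume : Measure (Tan d)) hr fun y => ‖u (r * t, 0, y)‖ₑ ^ 2
  simpa [sqNormBdry, dilate] using this

lemma sqNormDatum_dilate {r : ℝ} (hr : 0 < r) (g : ℝ × Tan d → Val n) (t : ℝ) :
    sqNormDatum (r • dilate r g) t =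
      ENNReal.ofReal (r ^ 2) * (dilFactor (Tan d) r * sqNormDatum g (r * t)) := by
  have := lintegral_dilate (volume : Measure (Tan d)) hr fun y => ‖g (r * t, y)‖ₑ ^ 2
  unfold sqNormDatum
  rw [← this, ← lintegral_const_mul' _ _ ENNReal.ofReal_ne_top]
  refine lintegral_congr fun y => ?_
  simp only [dilate, Pi.smul_apply, enorm_smul, mul_pow, Real.enorm_eq_ofReal hr.le,
    ENNReal.ofReal_pow hr.le]
  rfl

lemma wInt_dilate {r : ℝ} (hr : 0 < r) (η T : ℝ) (N : ℝ → ℝ≥0∞) :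
    wInt (r * η) T (fun t => N (r * t)) = dilFactor ℝ r * wInt η (r * T) N := by
  have h := setLIntegral_dilate (volume : Measure ℝ) hr (S := Icc 0 T) (S' := Icc 0 (r * T))
    measurableSet_Icc measurableSet_Icc (fun x => by simp [hr])
    fun t => ENNReal.ofReal (Real.exp (-2 * η * t)) * N t
  unfold wInt
  rw [← h]
  refine lintegral_congr fun t => ?_
  simp only [smul_eq_mul]
  congr 3
  ring

lemma wInt_const_mul (η T : ℝ) {c : ℝ≥0∞} (hc : c ≠ ⊤) (N : ℝ → ℝ≥0∞) :
    wInt η T (fun t => c * N t) = c * wInt η T N := by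
  unfold wInt
  rw [← lintegral_const_mul' _ _ hc]
  refine lintegral_congr fun t => ?_
  ring

lemma dirD_dilate {r : ℝ} (u : SpaceTime d → Val n) (v : SpaceTime d) :
    dirD v (dilate r u) = r • dilate r (dirD v u) := by
  funext p
  unfold dirD dilate
  rw [fderiv_comp_smul]
  rfl

lemma Smooth.dilate {u : SpaceTime d → Val n} (hu : Smooth u) (r : ℝ) : Smooth (dilate r u) :=
  hu.comp (contDiff_const_smul r)

end HalfSpaceIBVP

namespace HalfSpaceProblem
variable {d n : ℕ}

lemma dirD_dirD_dilate {r : ℝ} {u : SpaceTime d → Val n} (hu : Smooth u) (v w : SpaceTime d) :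
    dirD v (dirD w (dilate r u)) = (r * r) • dilate r (dirD v (dirD w u)) := by
  rw [dirD_dilate, dirD_smul ((hu.dirD w).dilate r), dirD_dilate, smul_smul]

lemma isBoundaryDatum_dilate {r : ℝ} (hr : 0 < r) {g : ℝ × Tan d → Val n}
    (hg : IsBoundaryDatum g) : IsBoundaryDatum (r • dilate r g) := by
  refine ⟨contDiff_const.smul (hg.1.comp (contDiff_const_smul r)), fun t ht => ?_⟩
  have h := (hg.2 (r * t) (by positivity)).comp_homeomorph (Homeomorph.smulOfNeZero r hr.ne')
  exact h.mono fun y hy h0 => hy (by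
    have h1 : g (r * t, r • y) = 0 := h0
    simp [dilate, h1])

/-- The equation is homogeneous of order 2 and L of order 1; the single factor r from L has to go
into the datum. -/
lemma IsSolution.dilate {P : HalfSpaceProblem d n} {g : ℝ × Tan d → Val n}
    {u : SpaceTime d → Val n} (h : P.IsSolution 0 g u) {r : ℝ} (hr : 0 < r) :
    P.IsSolution 0 (r • HalfSpaceIBVP.dilate r g) (HalfSpaceIBVP.dilate r u) where
  smooth := Smooth.dilate h.smooth r
  sq_integrable t ht := by
    rw [sqNormInt_dilate hr]
    exact ENNReal.mul_lt_top (dilFactor_ne_top _ _).lt_top (h.sq_integrable _ (by positivity))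
  equation t x₁ y ht hx := by
    have hu : Smooth u := h.smooth
    have e := h.equation (r * t) (r * x₁) (r • y) (by positivity) (by positivity)
    simp only [Dt, Dnor, Dtan, P₀, dirD_dirD_dilate hu, Pi.smul_apply, act_eq_actL, map_smul,
      Pi.zero_apply, add_zero, ← Finset.smul_sum, ← smul_add] at e ⊢
    congr 1
  initial x₁ y hx := by
    have := h.initial (r * x₁) (r • y) (by positivity)
    simpa [HalfSpaceIBVP.dilate] using this
  initial_velocity x₁ y hx := by
    have := h.initial_velocity (r * x₁) (r • y) (by positivity)
    simp only [Dt, dirD_dilate, Pi.smul_apply, HalfSpaceIBVP.dilate] at this ⊢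
    simpa using Or.inr this
  boundary t y ht := by
    have e := h.boundary (r * t) (r • y) (by positivity)
    have e' : P.L u (r • (t, 0, y)) = g (r • (t, y)) := by
      simpa using e
    simp only [L, Dt, Dnor, Dtan, dirD_dilate, Pi.smul_apply, act_eq_actL, map_smul,
      ← Finset.smul_sum, ← smul_add, HalfSpaceIBVP.dilate] at e' ⊢
    rw [e']

/-- The boundary estimate for one pair `(η, T)`. -/
def BoundaryEstimateAt (P : HalfSpaceProblem d n) (η T K : ℝ) : Prop :=
  ∀ (g : ℝ × Tan d → Val n) (u : SpaceTime d → Val n), IsBoundaryDatum g → P.IsSolution 0 g u →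
    wInt η T (sqNormBdry u) ≤ ENNReal.ofReal K * wInt η T (sqNormDatum g)

/-- The volume factors on the two sides agree and cancel; r² is the square of the factor r in the
datum. -/
lemma BoundaryEstimateAt.dilate {P : HalfSpaceProblem d n} {η T K : ℝ} {r : ℝ} (hr : 0 < r)
    (hK : 0 ≤ K) (h : P.BoundaryEstimateAt (r * η) T K) :
    P.BoundaryEstimateAt η (r * T) (K * r ^ 2) := by
  intro g u hg hu
  have h1 := h _ _ (isBoundaryDatum_dilate hr hg) (hu.dilate hr)
  have e1 : wInt (r * η) T (sqNormBdry (HalfSpaceIBVP.dilate r u)) =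
      dilFactor (Tan d) r * (dilFactor ℝ r * wInt η (r * T) (sqNormBdry u)) := by
    rw [← wInt_dilate hr, ← wInt_const_mul _ _ (dilFactor_ne_top _ _)]
    simp only [← sqNormBdry_dilate hr]
  have e2 : wInt (r * η) T (sqNormDatum (r • HalfSpaceIBVP.dilate r g)) =
      ENNReal.ofReal (r ^ 2) *
        (dilFactor (Tan d) r * (dilFactor ℝ r * wInt η (r * T) (sqNormDatum g))) := by
    rw [← wInt_dilate hr, ← wInt_const_mul _ _ (dilFactor_ne_top _ _),
      ← wInt_const_mul _ _ ENNReal.ofReal_ne_top]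
    simp only [← sqNormDatum_dilate hr]
  rw [e1, e2] at h1
  have h2 : dilFactor (Tan d) r * (dilFactor ℝ r * wInt η (r * T) (sqNormBdry u)) ≤
      dilFactor (Tan d) r * (dilFactor ℝ r * (ENNReal.ofReal (K * r ^ 2) *
        wInt η (r * T) (sqNormDatum g))) := by
    refine h1.trans (le_of_eq ?_)
    rw [ENNReal.ofReal_mul hK]
    ring
  have h3 := (ENNReal.mul_le_mul_iff_right (dilFactor_ne_zero _ hr) (dilFactor_ne_top _ _)).1 h2
  exact (ENNReal.mul_le_mul_iff_right (dilFactor_ne_zero _ hr) (dilFactor_ne_top _ _)).1 h3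

/-- By homogeneity, an estimate for a single `η` and all `T` implies boundary stability. -/
lemma boundaryStable_of_estimateAt (P : HalfSpaceProblem d n) {η K : ℝ} (hη : 0 < η) (hK : 0 < K)
    (h : ∀ T, 0 ≤ T → P.BoundaryEstimateAt η T K) : P.BoundaryStable := by
  refine ⟨2, two_pos, 1, K * η ^ 2, one_pos, by positivity, fun g u hg hu ζ T hζ hT => ?_⟩
  have hζ0 : 0 < ζ := one_pos.trans_le hζ
  -- This ratio carries the estimate at η on [0, T/r] to ζ on [0, T], with constant K r² = Kη²/ζ²;
  -- hence the exponent 2.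
  obtain ⟨r, hr⟩ : ∃ r, r = η / ζ := ⟨_, rfl⟩
  have hr0 : 0 < r := by rw [hr]; positivity
  have h1 := h (T / r) (by positivity)
  have e : r * ζ = η := by rw [hr]; field_simp
  rw [← e] at h1
  have h2 := h1.dilate hr0 hK.le g u hg hu
  rw [mul_div_cancel₀ _ hr0.ne'] at h2
  refine h2.trans (le_of_eq ?_)
  congr 2
  rw [Real.rpow_two, hr]
  field_simp

lemma wInt_le_of_exp_le {η ζ T c : ℝ} (hc : 0 ≤ c)
    (h : ∀ t ∈ Icc (0 : ℝ) T, Real.exp (-2 * η * t) ≤ c * Real.exp (-2 * ζ * t))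
    (N : ℝ → ℝ≥0∞) : wInt η T N ≤ ENNReal.ofReal c * wInt ζ T N := by
  unfold wInt
  rw [← lintegral_const_mul' _ _ ENNReal.ofReal_ne_top]
  refine setLIntegral_mono' measurableSet_Icc fun t ht => ?_
  rw [← mul_assoc, ← ENNReal.ofReal_mul hc]
  exact mul_le_mul_left (ENNReal.ofReal_le_ofReal (h t ht)) _

/-- Lowering the exponential rate only enlarges the data side; the solution side costs the factor c.
-/
lemma BoundaryEstimateAt.of_le {P : HalfSpaceProblem d n} {η ζ T K c : ℝ} (hc : 0 ≤ c)
    (hηζ : η ≤ ζ) (h : P.BoundaryEstimateAt ζ T K)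
    (hexp : ∀ t ∈ Icc (0 : ℝ) T, Real.exp (-2 * η * t) ≤ c * Real.exp (-2 * ζ * t)) :
    P.BoundaryEstimateAt η T (c * K) := by
  intro g u hg hu
  have h2 : wInt ζ T (sqNormDatum g) ≤ ENNReal.ofReal 1 * wInt η T (sqNormDatum g) := by
    refine wInt_le_of_exp_le zero_le_one (fun t ht => ?_) _
    rw [one_mul]
    refine Real.exp_le_exp.2 ?_
    nlinarith [ht.1]
  rw [ENNReal.ofReal_one, one_mul] at h2
  rw [ENNReal.ofReal_mul hc, mul_assoc]
  exact (wInt_le_of_exp_le hc hexp _).trans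
    (mul_le_mul_right ((h g u hg hu).trans (mul_le_mul_right h2 _)) _)

/-- The hypothesis covers one interval [0, T₀] and all large η. Dilations exchange these roles and
give an estimate at η₀ alone for every T, uniformly, which suffices by homogeneity. -/
theorem StronglyStable.boundaryStable {P : HalfSpaceProblem d n} (h : P.StronglyStable) :
    P.BoundaryStable := by
  obtain ⟨η₀, T₀, K, hη₀, hT₀, hK, h⟩ := h
  -- With F = 0, only the boundary norm of u_t is kept; Hardy in time trades it for that of u and
  -- gains η^{-2}.
  have base : ∀ η, η₀ ≤ η → P.BoundaryEstimateAt η T₀ (K / η ^ 2) := by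
    intro η hη g u hg hu
    have hη0 : 0 < η := hη₀.trans_le hη
    have hF : IsForcing (0 : SpaceTime d → Val n) :=
      ⟨contDiff_const, fun t _ => ⟨0, fun _ _ _ _ => rfl⟩⟩
    have hs : Smooth u := hu.smooth
    have h1 := h 0 g u hF hg hu η hη
    have e0 : wInt η T₀ (sqNormInt (0 : SpaceTime d → Val n)) = 0 := by
      simp [wInt, sqNormInt]
    rw [e0, add_zero] at h1
    have h2 : ENNReal.ofReal η * wInt η T₀ (sqNormBdry (Dt u)) ≤
        ENNReal.ofReal η * (ENNReal.ofReal K * wInt η T₀ (sqNormDatum g)) :=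
      calc ENNReal.ofReal η * wInt η T₀ (sqNormBdry (Dt u))
          ≤ ENNReal.ofReal η * wInt η T₀ (fun t => sqH1Bdry u t + sqNormBdry (Dt u) t) :=
            mul_le_mul_right (wInt_mono η T₀ fun t => le_add_self) _
        _ ≤ _ := le_trans le_self_add h1
        _ = _ := by ring
    have h3 := (ENNReal.mul_le_mul_iff_right (by simpa using hη0) ENNReal.ofReal_ne_top).1 h2
    have h4 := (hardy_bdry hs hu.initial_eq_zero hη0 hT₀.le).trans h3
    have hη2 : 0 < η ^ 2 := by positivity
    refine (ENNReal.mul_le_mul_iff_right (a := ENNReal.ofReal (η ^ 2)) (by simpa using hη0.ne')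
      ENNReal.ofReal_ne_top).1 (h4.trans (le_of_eq ?_))
    rw [← mul_assoc, ← ENNReal.ofReal_mul hη2.le, mul_div_cancel₀ _ hη2.ne']
  have hM : 0 < Real.exp (2 * η₀ * T₀) := Real.exp_pos _
  have hM1 : 1 ≤ Real.exp (2 * η₀ * T₀) := Real.one_le_exp (by positivity)
  have mono : ∀ {η T K K' : ℝ}, K ≤ K' → P.BoundaryEstimateAt η T K →
      P.BoundaryEstimateAt η T K' := fun hKK h g u hg hu =>
    (h g u hg hu).trans (mul_le_mul_left (ENNReal.ofReal_le_ofReal hKK) _)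
  refine P.boundaryStable_of_estimateAt hη₀
    (K := Real.exp (2 * η₀ * T₀) * (K / η₀ ^ 2)) (by positivity) fun T hT => ?_
  rcases hT.eq_or_lt with h0 | h0
  · intro g u _ _
    have : wInt η₀ T (sqNormBdry u) = 0 := by
      rw [← h0]
      simp [wInt]
    rw [this]
    exact zero_le
  set r : ℝ := T / T₀ with hr
  have hr0 : 0 < r := by positivity
  have hrT : r * T₀ = T := by rw [hr]; field_simp
  rcases le_or_gt 1 r with h1 | h1
  -- Long intervals: the factor r² from the dilation is compensated exactly by the η^{-2} of `base`
  -- at rη₀.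
  · have h2 := (base (r * η₀) (le_mul_of_one_le_left hη₀.le h1)).dilate hr0 (by positivity)
    rw [hrT] at h2
    refine mono ?_ h2
    have e : K / (r * η₀) ^ 2 * r ^ 2 = K / η₀ ^ 2 := by field_simp
    rw [e]
    exact le_mul_of_one_le_left (by positivity) hM1
  -- Short intervals: dilation leads to the larger rate η₀/r. Returning to η₀ costs at most
  -- e^{2η₀T₀}, because (η₀/r)t ≤ η₀T₀ for t ≤ T = rT₀.
  · have h2 := base η₀ le_rfl
    have e : r * (η₀ / r) = η₀ := by field_simp
    rw [← e] at h2
    have h3 := h2.dilate hr0 (by positivity)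
    rw [hrT, e] at h3
    have h4 : η₀ ≤ η₀ / r := le_div_self hη₀.le hr0 h1.le
    refine mono ?_ (h3.of_le hM.le h4 fun t ht => ?_)
    · gcongr
      have : r ^ 2 ≤ 1 := pow_le_one₀ hr0.le h1.le
      exact mul_le_of_le_one_right (by positivity) this
    · rw [← Real.exp_add]
      refine Real.exp_le_exp.2 ?_
      have h5 : η₀ / r * t ≤ η₀ * T₀ := by
        rw [div_mul_eq_mul_div, div_le_iff₀ hr0, mul_assoc]
        have : t ≤ T₀ * r := by rw [mul_comm, hrT]; exact ht.2
        gcongr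
      have h6 : 0 ≤ η₀ * t := mul_nonneg hη₀.le ht.1
      linarith

theorem illPosed_of_not_boundaryStable (P : HalfSpaceProblem d n) (h : ¬ P.BoundaryStable) :
    P.IllPosed := by
  rintro (hs | hs)
  · exact h hs.boundaryStable
  · exact h hs.1

theorem exists_violation_of_not_boundaryStable (P : HalfSpaceProblem d n)
    (h : ¬ P.BoundaryStable) {η K : ℝ} (hη : 0 < η) (hK : 0 < K) :
    ∃ (T : ℝ) (g : ℝ × Tan d → Val n) (u : SpaceTime d → Val n),
      0 ≤ T ∧ IsBoundaryDatum g ∧ P.IsSolution 0 g u ∧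
      ENNReal.ofReal K * wInt η T (sqNormDatum g) < wInt η T (sqNormBdry u) := by
  by_contra! hc
  exact h (P.boundaryStable_of_estimateAt hη hK fun T hT g u hg hu => hc T g u hT hg hu)

end HalfSpaceProblem

/-! ### Energy estimate from strong boundary stability -/

namespace HalfSpaceProblem
variable {d n : ℕ}

lemma actL_normSq_le (M : Matrix (Fin n) (Fin n) ℂ) (x : Val n) :
    ‖actL M x‖ ^ 2 ≤ ‖actL M‖ ^ 2 * ‖x‖ ^ 2 := by
  rw [← mul_pow]
  gcongr
  exact (actL M).le_opNorm x

/-- On the boundary the energy flux is controlled by the data and the tangential derivatives. -/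
lemma exists_flux_bound (P : HalfSpaceProblem d n) :
    ∃ K : ℝ, 0 < K ∧ ∀ (g : ℝ × Tan d → Val n) (u : SpaceTime d → Val n), P.IsSolution 0 g u →
      ∀ q : ℝ × Tan d, 0 ≤ q.1 → |P.fluxNor u (q.1, 0, q.2)| ≤
        K * (‖g q‖ ^ 2 + (‖trace (Dt u) q‖ ^ 2 + ∑ j, ‖trace (Dtan j u) q‖ ^ 2)) := by
  set N : ℝ := 1 + ‖actL P.C₀‖ ^ 2 + ∑ j, ‖actL (P.C j)‖ ^ 2 with hN
  have hS : 0 ≤ ∑ j, ‖actL (P.C j)‖ ^ 2 := Finset.sum_nonneg fun j _ => by positivity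
  have hN1 : 1 ≤ N := by nlinarith [sq_nonneg ‖actL P.C₀‖]
  have hN0 : ‖actL P.C₀‖ ^ 2 ≤ N := by linarith
  have hNj : ∀ j, ‖actL (P.C j)‖ ^ 2 ≤ N := fun j => by
    have := Finset.single_le_sum (f := fun j => ‖actL (P.C j)‖ ^ 2) (fun j _ => by positivity)
      (Finset.mem_univ j)
    linarith [sq_nonneg ‖actL P.C₀‖]
  refine ⟨(‖actL P.A‖ + 1) * (1 + 3 * (d + 1) * N), by positivity, fun g u hu q hq => ?_⟩
  set G := ‖g q‖ ^ 2
  set X := ‖trace (Dt u) q‖ ^ 2 with hX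
  set Y := ∑ j, ‖trace (Dtan j u) q‖ ^ 2 with hY
  have hG0 : 0 ≤ G := by positivity
  have hX0 : 0 ≤ X := by positivity
  have hY0 : 0 ≤ Y := Finset.sum_nonneg fun j _ => by positivity
  have hb := hu.boundary q.1 q.2 hq
  -- The boundary condition solved for the normal derivative, whose coefficient in L is the
  -- identity.
  have hD : trace (Dnor u) q = g q - actL P.C₀ (trace (Dt u) q) -
      ∑ j, actL (P.C j) (trace (Dtan j u) q) := by
    have : actL P.C₀ (trace (Dt u) q) + trace (Dnor u) q +
      ∑ j, actL (P.C j) (trace (Dtan j u) q) = g q := hb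
    rw [← this]
    abel
  have hsum : ‖∑ j, actL (P.C j) (trace (Dtan j u) q)‖ ^ 2 ≤ d * (N * Y) := by
    have h1 : ‖∑ j, actL (P.C j) (trace (Dtan j u) q)‖ ^ 2 ≤
        (∑ j, ‖actL (P.C j) (trace (Dtan j u) q)‖) ^ 2 := by
      gcongr
      exact norm_sum_le _ _
    have h2 := sq_sum_le_card_mul_sum_sq (s := (Finset.univ : Finset (Fin d)))
      (f := fun j => ‖actL (P.C j) (trace (Dtan j u) q)‖)
    simp only [Finset.card_univ, Fintype.card_fin] at h2
    refine h1.trans (h2.trans ?_)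
    refine mul_le_mul_of_nonneg_left ?_ (Nat.cast_nonneg d)
    rw [hY, Finset.mul_sum]
    exact Finset.sum_le_sum fun j _ => (actL_normSq_le _ _).trans
      (mul_le_mul_of_nonneg_right (hNj j) (by positivity))
  have hC0 : ‖actL P.C₀ (trace (Dt u) q)‖ ^ 2 ≤ N * X :=
    (actL_normSq_le _ _).trans (mul_le_mul_of_nonneg_right hN0 (by positivity))
  have hnor : ‖trace (Dnor u) q‖ ^ 2 ≤ 3 * (G + N * X + d * (N * Y)) := by
    have h1 : ‖trace (Dnor u) q‖ ≤ ‖g q‖ + ‖actL P.C₀ (trace (Dt u) q)‖ +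
        ‖∑ j, actL (P.C j) (trace (Dtan j u) q)‖ := by
      rw [hD]
      exact (norm_sub_le _ _).trans (by gcongr; exact norm_sub_le _ _)
    have h2 := pow_le_pow_left₀ (norm_nonneg _) h1 2
    have h3 : G = ‖g q‖ ^ 2 := rfl
    nlinarith [sq_nonneg (‖g q‖ - ‖actL P.C₀ (trace (Dt u) q)‖),
      sq_nonneg (‖g q‖ - ‖∑ j, actL (P.C j) (trace (Dtan j u) q)‖),
      sq_nonneg (‖actL P.C₀ (trace (Dt u) q)‖ - ‖∑ j, actL (P.C j) (trace (Dtan j u) q)‖)]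
  have hfl : |P.fluxNor u (q.1, 0, q.2)| ≤ ‖actL P.A‖ * (X + ‖trace (Dnor u) q‖ ^ 2) :=
    abs_inner_actL_le P.A _ _
  have hd : (0 : ℝ) ≤ d := Nat.cast_nonneg d
  have hin : X + ‖trace (Dnor u) q‖ ^ 2 ≤ (1 + 3 * (d + 1) * N) * (G + (X + Y)) := by
    have t1 : 0 ≤ (N - 1) * G := mul_nonneg (by linarith) hG0
    have hN' : 0 ≤ N := by linarith
    have t2 : 0 ≤ d * N * G := mul_nonneg (mul_nonneg hd hN') hG0
    have t3 : 0 ≤ d * N * X := mul_nonneg (mul_nonneg hd hN') hX0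
    have t4 : 0 ≤ N * Y := mul_nonneg hN' hY0
    clear_value N X Y G
    linarith
  calc |P.fluxNor u (q.1, 0, q.2)| ≤ ‖actL P.A‖ * (X + ‖trace (Dnor u) q‖ ^ 2) := hfl
    _ ≤ (‖actL P.A‖ + 1) * ((1 + 3 * (d + 1) * N) * (G + (X + Y))) := by
        gcongr
        linarith
    _ = _ := by ring

/-- The weighted energy in the interior is controlled by the energy flux through the boundary. -/
lemma lintegral_energy_le_flux (P : HalfSpaceProblem d n) {g : ℝ × Tan d → Val n}
    {u : SpaceTime d → Val n} (hu : P.IsSolution 0 g u) {η T : ℝ} (hη : 1 ≤ η) (hT : 0 ≤ T) :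
    ∫⁻ p in cyl d T, ew η p.1 * ENNReal.ofReal (P.energy u p) ≤
      ∫⁻ q in bcyl d T, ew η q.1 * ENNReal.ofReal |P.fluxNor u (q.1, 0, q.2)| := by
  obtain ⟨c, hc, hspeed⟩ := P.exists_speedBound
  have hs : Smooth u := hu.smooth
  have sE := P.smooth_energy hs
  have sF := P.smooth_fluxNor hs
  -- the initial energy vanishes
  have hinit : ∀ x ∈ halfSpace d, P.energy u (0, x) = 0 := by
    -- The initial data are prescribed only for x_1 ≥ 0, so the spatial derivatives vanish first for
    -- x_1 > 0; continuity of the energy then gives x_1 = 0.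
    have hU : IsOpen (Ioi (0 : ℝ) ×ˢ (univ : Set (Tan d))) := isOpen_Ioi.prod isOpen_univ
    have h1 : ∀ x ∈ Ioi (0 : ℝ) ×ˢ (univ : Set (Tan d)), P.energy u (0, x) = 0 := by
      intro x hx
      have hv : HasFDerivAt (fun x => u (0, x))
          ((fderiv ℝ u (0, x)).comp (ContinuousLinearMap.inr ℝ ℝ (ℝ × Tan d))) x :=
        (hs.diff (0, x)).hasFDerivAt.comp x (hasFDerivAt_prodMk_right (𝕜 := ℝ) (0 : ℝ) x)
      have h0 : (fun x => u (0, x)) =ᶠ[nhds x] fun _ => 0 := by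
        filter_upwards [hU.mem_nhds hx] with z hz
        exact hu.initial z.1 z.2 (le_of_lt hz.1)
      have h2 := hv.unique ((hasFDerivAt_const (0 : Val n) x).congr_of_eventuallyEq h0)
      have h3 : ∀ v : ℝ × Tan d, dirD (0, v) u (0, x) = 0 := fun v =>
        ContinuousLinearMap.ext_iff.1 h2 v
      have h4 : dirD dt u (0, x) = 0 := hu.initial_velocity x.1 x.2 (le_of_lt hx.1)
      have h5 : dirD d1 u (0, x) = 0 := h3 _
      have h6 : ∀ j, dirD (dj j) u (0, x) = 0 := fun j => h3 _
      simp [energy, h4, h5, h6]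
    have hcl : halfSpace d ⊆ closure (Ioi (0 : ℝ) ×ˢ (univ : Set (Tan d))) := by
      rw [closure_prod_eq, closure_Ioi, closure_univ]
      exact le_rfl
    have hcont : Continuous fun x => P.energy u (0, x) := sE.continuous.comp (by fun_prop)
    intro x hx
    have := closure_minimal (s := Ioi (0 : ℝ) ×ˢ (univ : Set (Tan d)))
      (t := {x | P.energy u (0, x) = 0}) h1 (isClosed_eq hcont continuous_const)
    exact this (hcl hx)
  set w : ℕ → SpaceTime d → ℝ := fun k => weight c η k (0 : ℝ × Tan d) with hw
  have hk : ∀ k, ∫⁻ p in cyl d T, ENNReal.ofReal (w k p * P.energy u p) ≤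
      ∫⁻ q in bcyl d T, ew η q.1 * ENNReal.ofReal |P.fluxNor u (q.1, 0, q.2)| := by
    intro k
    have sw : Smooth (w k) := smooth_weight c η k 0
    have suppw : SpaceSupp (w k) := spaceSupp_weight hc.le η k 0
    have hloc := P.local_energy hspeed hs sw suppw (weight_nonneg c η k 0)
      (weight_speed hc.le η k 0) hT (fun p hp => hu.residual_eq_zero p hp) hinit
    have iE : IntegrableOn (fun p => w k p * P.energy u p) (cyl d T) :=
      (suppw.mul_right (Ψ := P.energy u)).integrableOn_cyl (sw.mul sE).continuous T
    have iF : IntegrableOn (trace fun p => w k p * P.fluxNor u p) (bcyl d T) :=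
      (suppw.mul_right (Ψ := P.fluxNor u)).integrableOn_bcyl (sw.mul sF).continuous T
    have nnE : ∀ p, 0 ≤ w k p * P.energy u p := fun p =>
      mul_nonneg (weight_nonneg _ _ _ _ _) (P.energy_nonneg _ _)
    have h0 : 0 ≤ ∫ p in cyl d T, w k p * P.energy u p := integral_nonneg nnE
    have h1 : ∫ p in cyl d T, w k p * P.energy u p ≤
        ∫ q in bcyl d T, |trace (fun p => w k p * P.fluxNor u p) q| := by
      have h2 := (neg_le_abs _).trans (abs_integral_le_integral_abs
        (f := trace fun p => w k p * P.fluxNor u p) (μ := volume.restrict (bcyl d T)))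
      -- The factor 2η from `local_energy` is at least 1 and is dropped.
      nlinarith
    rw [← ofReal_integral_eq_lintegral_ofReal iE (Filter.Eventually.of_forall nnE)]
    refine (ENNReal.ofReal_le_ofReal h1).trans ?_
    rw [ofReal_integral_eq_lintegral_ofReal iF.abs
      (Filter.Eventually.of_forall fun q => abs_nonneg _)]
    refine lintegral_mono fun q => ?_
    rw [ew, ← ENNReal.ofReal_mul (Real.exp_pos _).le]
    refine ENNReal.ofReal_le_ofReal ?_
    simp only [trace, abs_mul]
    rw [abs_of_nonneg (weight_nonneg _ _ _ _ _)]
    exact mul_le_mul_of_nonneg_right (weight_le _ _ _ _ _) (abs_nonneg _)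
  have hlim : ∀ p : SpaceTime d, Filter.Tendsto (fun k => ENNReal.ofReal (w k p * P.energy u p))
      Filter.atTop (nhds (ew η p.1 * ENNReal.ofReal (P.energy u p))) := by
    intro p
    -- At each point the cut-off equals 1 once k is large, so the sequence is eventually constant;
    -- Fatou's lemma then suffices.
    refine tendsto_const_nhds.congr' ?_
    obtain ⟨k₀, hk₀⟩ := exists_nat_ge (1 + c * (1 + d) * p.1 + softDist (0 : ℝ × Tan d) p)
    filter_upwards [Filter.eventually_ge_atTop k₀] with k hk
    have h1 : cutoff (c * (1 + d)) k (0 : ℝ × Tan d) p = 1 := by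
      refine Real.smoothTransition.one_of_one_le ?_
      have : (k₀ : ℝ) ≤ k := by exact_mod_cast hk
      linarith
    have h2 : w k p = Real.exp (-2 * η * p.1) := by
      change Real.exp (-2 * η * p.1) * cutoff (c * (1 + d)) k (0 : ℝ × Tan d) p = _
      rw [h1, mul_one]
    rw [h2, ENNReal.ofReal_mul (Real.exp_pos _).le]
    rfl
  calc ∫⁻ p in cyl d T, ew η p.1 * ENNReal.ofReal (P.energy u p)
      = ∫⁻ p in cyl d T, Filter.liminf
          (fun k => ENNReal.ofReal (w k p * P.energy u p)) Filter.atTop := by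
        refine lintegral_congr fun p => ?_
        exact (hlim p).liminf_eq.symm
    _ ≤ Filter.liminf (fun k => ∫⁻ p in cyl d T, ENNReal.ofReal (w k p * P.energy u p))
          Filter.atTop := by
        refine lintegral_liminf_le fun k => ?_
        exact ((smooth_weight c η k 0).mul sE).continuous.measurable.ennreal_ofReal
    _ ≤ _ := (Filter.liminf_le_liminf (Filter.Eventually.of_forall hk)).trans (by simp)

lemma wInt_h1Int (η T : ℝ) {u : SpaceTime d → Val n} (hu : Smooth u) :
    wInt η T (fun t => sqH1Int u t + sqNormInt (Dt u) t) =
      wInt η T (sqNormInt u) + ∫⁻ p in cyl d T, ew η p.1 *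
        (‖Dt u p‖ₑ ^ 2 + ‖Dnor u p‖ₑ ^ 2 + ∑ j, ‖Dtan j u p‖ₑ ^ 2) := by
  have c1 : ∀ v, Continuous (dirD v u) := fun v => (hu.dirD v).continuous
  have c0 := hu.continuous
  have m1 : ∀ v, Measurable (sqNormInt (dirD v u)) := fun v => measurable_sqNormInt (c1 v)
  have m0 : Measurable (sqNormInt u) := measurable_sqNormInt c0
  have w1 : ∀ v, Measurable fun p : SpaceTime d => ew η p.1 * ‖dirD v u p‖ₑ ^ 2 := fun v =>
    measurable_ew_mul η (c1 v)
  unfold sqH1Int Dt Dnor Dtan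
  have mS := Finset.measurable_fun_sum (Finset.univ : Finset (Fin d))
    fun j _ => m1 ((0 : ℝ), (0 : ℝ), EuclideanSpace.single j (1 : ℝ))
  have m2 := m0.add (m1 ((0 : ℝ), (1 : ℝ), (0 : Tan d)))
  refine (wInt_add η T (m2.add mS) _).trans ?_
  rw [show wInt η T ((sqNormInt u + sqNormInt (dirD ((0 : ℝ), (1 : ℝ), (0 : Tan d)) u)) + _) = _
    from wInt_add η T m2 _, show wInt η T (sqNormInt u + _) = _ from wInt_add η T m0 _,
    wInt_sum η T fun j => m1 _]
  simp only [fun v => wInt_sqNormInt η T (c1 v), mul_add, Finset.mul_sum]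
  rw [lintegral_add_right _ (Finset.measurable_fun_sum _ fun j _ => w1 _),
    lintegral_add_left (w1 _),
    lintegral_finsetSum _ fun j _ => w1 _]
  ring

lemma le_wInt_h1Bdry (η T : ℝ) {u : SpaceTime d → Val n} (hu : Smooth u) :
    ∫⁻ q in bcyl d T, ew η q.1 *
        (‖trace (Dt u) q‖ₑ ^ 2 + ∑ j, ‖trace (Dtan j u) q‖ₑ ^ 2) ≤
      wInt η T (fun t => sqH1Bdry u t + sqNormBdry (Dt u) t) := by
  have c1 : ∀ v, Continuous (dirD v u) := fun v => (hu.dirD v).continuous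
  have m1 : ∀ v, Measurable (sqNormBdry (dirD v u)) := fun v => measurable_sqNormBdry (c1 v)
  have w1 : ∀ v, Measurable fun q : ℝ × Tan d => ew η q.1 * ‖trace (dirD v u) q‖ₑ ^ 2 := fun v =>
    measurable_ew_mul η (continuous_trace (c1 v))
  refine le_trans (le_of_eq ?_) (wInt_mono η T (M := fun t => (∑ j, sqNormBdry (Dtan j u) t) +
    sqNormBdry (Dt u) t) fun t => by gcongr; exact le_add_self)
  unfold Dt Dtan
  rw [wInt_add η T (Finset.measurable_fun_sum _ fun j _ => m1 _), wInt_sum η T fun j => m1 _]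
  simp only [fun v => wInt_sqNormBdry η T (c1 v), mul_add, Finset.mul_sum]
  rw [lintegral_add_left (w1 _), lintegral_finsetSum _ fun j _ => w1 _, add_comm]

theorem StronglyBoundaryStable.strongInteriorEstimate {P : HalfSpaceProblem d n}
    (h : P.StronglyBoundaryStable) : P.StrongInteriorEstimate := by
  obtain ⟨η₀, K, hη₀, hK, h⟩ := h
  obtain ⟨κ, hκ, -, hco⟩ := P.exists_energy_coercive
  obtain ⟨M, hM, hfl⟩ := P.exists_flux_bound
  -- Taking η₀ + 1 ensures η ≥ 1, which the flux inequality requires and which lets Hardy bound u by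
  -- u_t without loss. The factor 2 adds the norm of u to that of its derivatives.
  refine ⟨η₀ + 1, 2 * (κ⁻¹ * (M * (1 + K))), by positivity, by positivity,
    fun g u hg hu η T hη hT => ?_⟩
  have hη1 : 1 ≤ η := by linarith
  have hs : Smooth u := hu.smooth
  set D := wInt η T (sqNormDatum g) with hD
  set X := ∫⁻ p in cyl d T, ew η p.1 *
    (‖Dt u p‖ₑ ^ 2 + ‖Dnor u p‖ₑ ^ 2 + ∑ j, ‖Dtan j u p‖ₑ ^ 2) with hX
  -- the energy is bounded by the data
  have hflux : ∫⁻ q in bcyl d T, ew η q.1 * ENNReal.ofReal |P.fluxNor u (q.1, 0, q.2)| ≤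
      ENNReal.ofReal (M * (1 + K)) * D := by
    calc ∫⁻ q in bcyl d T, ew η q.1 * ENNReal.ofReal |P.fluxNor u (q.1, 0, q.2)|
        ≤ ∫⁻ q in bcyl d T, ENNReal.ofReal M * (ew η q.1 * ‖g q‖ₑ ^ 2 + ew η q.1 *
            (‖trace (Dt u) q‖ₑ ^ 2 + ∑ j, ‖trace (Dtan j u) q‖ₑ ^ 2)) := by
          refine setLIntegral_mono' (measurableSet_bcyl T) fun q hq => ?_
          rw [← mul_add, mul_left_comm]
          refine mul_le_mul_right ((ENNReal.ofReal_le_ofReal (hfl g u hu q hq.1.1)).trans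
            (le_of_eq ?_)) _
          rw [ENNReal.ofReal_mul hM.le, ENNReal.ofReal_add (by positivity) (by positivity),
            ENNReal.ofReal_add (by positivity) (by positivity),
            ENNReal.ofReal_sum_of_nonneg fun j _ => by positivity]
          simp only [ofReal_normSq]
      _ = ENNReal.ofReal M * (D + ∫⁻ q in bcyl d T, ew η q.1 *
            (‖trace (Dt u) q‖ₑ ^ 2 + ∑ j, ‖trace (Dtan j u) q‖ₑ ^ 2)) := by
          rw [lintegral_const_mul' _ _ ENNReal.ofReal_ne_top,
            lintegral_add_left (measurable_ew_mul η hg.1.continuous), hD,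
            wInt_sqNormDatum η T hg.1.continuous]
      _ ≤ ENNReal.ofReal M * (D + ENNReal.ofReal K * D) := by
          gcongr
          exact (le_wInt_h1Bdry η T hs).trans (h g u hg hu η T (by linarith) hT)
      _ = _ := by
          rw [ENNReal.ofReal_mul hM.le, ENNReal.ofReal_add zero_le_one hK.le, ENNReal.ofReal_one]
          ring
  have hXb : X ≤ ENNReal.ofReal (κ⁻¹ * (M * (1 + K))) * D := by
    calc X ≤ ∫⁻ p in cyl d T, ENNReal.ofReal κ⁻¹ *
          (ew η p.1 * ENNReal.ofReal (P.energy u p)) := by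
          refine lintegral_mono fun p => ?_
          rw [mul_left_comm]
          refine mul_le_mul_right ?_ _
          have h1 : ‖Dt u p‖ ^ 2 + ‖Dnor u p‖ ^ 2 + ∑ j, ‖Dtan j u p‖ ^ 2 ≤
              κ⁻¹ * P.energy u p := by
            rw [← div_eq_inv_mul, le_div_iff₀ hκ, mul_comm]
            exact hco u p
          rw [← ENNReal.ofReal_mul (by positivity)]
          refine le_trans (le_of_eq ?_) (ENNReal.ofReal_le_ofReal h1)
          rw [ENNReal.ofReal_add (by positivity) (by positivity),
            ENNReal.ofReal_add (by positivity) (by positivity),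
            ENNReal.ofReal_sum_of_nonneg fun j _ => by positivity]
          simp only [ofReal_normSq]
      _ ≤ ENNReal.ofReal κ⁻¹ * (ENNReal.ofReal (M * (1 + K)) * D) := by
          rw [lintegral_const_mul' _ _ ENNReal.ofReal_ne_top]
          gcongr
          exact (P.lintegral_energy_le_flux hu hη1 hT).trans hflux
      _ = _ := by rw [← mul_assoc, ← ENNReal.ofReal_mul (by positivity)]
  have hU : wInt η T (sqNormInt u) ≤ X := by
    have h1 : wInt η T (sqNormInt u) ≤ ENNReal.ofReal (η ^ 2) * wInt η T (sqNormInt u) := by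
      refine le_mul_of_one_le_left' ?_
      rw [ENNReal.one_le_ofReal]
      exact one_le_pow₀ hη1
    refine (h1.trans (hardy_int hs hu.initial_eq_zero (by linarith) hT)).trans ?_
    refine (wInt_sqNormInt η T (hs.dirD dt).continuous).trans_le ?_
    refine lintegral_mono fun p => ?_
    gcongr
    rw [add_assoc]
    exact le_self_add
  rw [wInt_h1Int η T hs]
  calc wInt η T (sqNormInt u) + X ≤ X + X := by gcongr
    _ = ENNReal.ofReal 2 * X := by rw [ENNReal.ofReal_ofNat, two_mul]
    _ ≤ ENNReal.ofReal 2 * (ENNReal.ofReal (κ⁻¹ * (M * (1 + K))) * D) := by gcongr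
    _ = _ := by rw [← mul_assoc, ← ENNReal.ofReal_mul (by positivity)]

end HalfSpaceProblem
end

theorem mainTheorem6 (d n : ℕ) (P : HalfSpaceProblem d n) :
    (P.StronglyBoundaryStable → P.StrongInteriorEstimate) ∧
    (∀ α : ℝ, 0 < α → P.BoundaryStableWith α →
      ∃ α' : ℝ, α + 1 ≤ α' ∧ P.InteriorEstimate α') ∧
    (¬ P.BoundaryStable →
      P.IllPosed ∧
      ∀ η K : ℝ, 0 < η → 0 < K →
        ∃ (T : ℝ) (g : ℝ × HalfSpaceIBVP.Tan d → HalfSpaceIBVP.Val n)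
          (u : HalfSpaceIBVP.SpaceTime d → HalfSpaceIBVP.Val n),
          0 ≤ T ∧ HalfSpaceProblem.IsBoundaryDatum g ∧ P.IsSolution 0 g u ∧
          ENNReal.ofReal K * HalfSpaceIBVP.wInt η T (HalfSpaceIBVP.sqNormDatum g) <
            HalfSpaceIBVP.wInt η T (HalfSpaceIBVP.sqNormBdry u)) := by
  exact ⟨fun h => h.strongInteriorEstimate,
    fun α _ h => ⟨α + 1, le_rfl, P.interiorEstimate_of_boundaryStableWith h⟩,
    fun h => ⟨P.illPosed_of_not_boundaryStable h,
      fun η K hη hK => P.exists_violation_of_not_boundaryStable h hη hK⟩⟩
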